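/- Let $R$ be a commutative ring, let $f\colon X\to Y$ be a continuous map of topological spaces, and let $\mathcal U=(U_\alpha)_{\alpha\in I}$ be an open cover of $Y$, indexed by a linearly ordered set $I$, such that the open cover $f^{-1}\mathcal U=(f^{-1}(U_\alpha))_{\alpha\in I}$ of $X$ is locally finite. Let $X=K_0\supseteq K_1\supseteq\cdots\supseteq K_N=\emptyset$ be a filtration of $X$ by subspaces, and put $K_i=X$ for $i\le 0$ and $K_i=\emptyset$ for $i\ge N$. Write $H^*$ for singular cohomology with coefficients in $R$. For a persistence module $M=(M_i,\varphi_i\colon M_i\to M_{i+1})_{i\in\mathbb Z}$ let $\alpha(M)=\bigoplus_{i\in\mathbb Z}M_i$ be the graded $R[t]$-module on which $t$ sends $m\in M_i$ to $\varphi_i(m)\in M_{i+1}$. Let $PH^n(X)=\bigoplus_{i\in\mathbb Z}H^n(K_i)$ be the graded $R[t]$-module of the persistence module $i\mapsto H^n(K_i)$ with the restriction maps, and for $V\subseteq Y$ let $PH^q(f^{-1}V)=\bigoplus_{i\in\mathbb Z}H^q(K_i\cap f^{-1}V)$; this is a presheaf of graded $R[t]$-modules on $Y$. Let $H^p_\delta(\mathcal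 U,PH^q(f^{-1}\mathcal U))$ be the cohomology of its Čech complex $$C^p=\prod_{\alpha_0<\dots<\alpha_p}PH^q\bigl(f^{-1}(U_{\alpha_0}\cap\dots\cap U_{\alpha_p})\bigr),\qquad (\delta c)_{\alpha_0\dots\alpha_{p+1}}=\sum_{j=0}^{p+1}(-1)^j\,c_{\alpha_0\dots\widehat{\alpha_j}\dots\alpha_{p+1}}\big|_{f^{-1}(U_{\alpha_0}\cap\dots\cap U_{\alpha_{p+1}})},$$ where the product is taken in the category of graded $R[t]$-modules (that is, it consists of the families all of whose members are supported in a common finite set of degrees; this is the full product if $\mathcal U$ is finite). Then there is a first quadrant cohomological spectral sequence $(E_r^{p,q},d_r)_{r\ge 2}$ of graded $R[t]$-modules, with $R[t]$-linear differentials $d_r\colon E_r^{p,q}\to E_r^{p+r,q-r+1}$ of degree $0$ in the grading and isomorphisms $H(E_r,d_r)\cong E_{r+1}$ of graded $R[t]$-modules, such that for all $p,q\ge 0$ there is an isomorphism of graded $R[t]$-modules $$E_2^{p,q}\cong H^p_\delta(\mathcal U,PH^q(f^{-1}\mathcal U)),$$ and which converges to $PH^*(X)$: for every $n$ there is a filtration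 $PH^n(X)=F^0\supseteq F^1\supseteq\dots\supseteq F^{n+1}=0$ by graded $R[t]$-submodules such that $F^p/F^{p+1}\cong E_\infty^{p,n-p}$ as graded $R[t]$-modules for $0\le p\le n$, where $E_\infty^{p,q}=E_r^{p,q}$ for $r>\max(p,q+1)$. -/

import Mathlib

open CategoryTheory Opposite Polynomial DirectSum

universe u v w

noncomputable section

namespace PersistentLeray

/-! ### Singular cohomology -/

/-- The contravariant functor sending a set `S` to the `R`-module of functions `S → R`. -/
def functionsFunctor (R : Type v) [CommRing R] : (Type u)ᵒᵖ ⥤ ModuleCat.{max u v} R where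
  obj S := ModuleCat.of R (S.unop → R)
  map g := ModuleCat.ofHom (LinearMap.funLeft R R g.unop)

/-- The singular cochain complex with coefficients in `R`: in degree `q` it is the module of all
functions from the set of singular `q`-simplices to `R`, and the coboundary is the alternating sum
of the maps induced by the faces. -/
def singularCochainFunctor (R : Type v) [CommRing R] :
    TopCat.{u}ᵒᵖ ⥤ CochainComplex (ModuleCat.{max u v} R) ℕ :=
  TopCat.toSSet.op ⋙ (simplicialCosimplicialEquiv (Type u)).functor ⋙
    (CosimplicialObject.whiskering _ _).obj (functionsFunctor R) ⋙
      AlgebraicTopology.alternatingCofaceMapComplex _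

/-- Singular cohomology `H^q(-; R)`. -/
def singularCohomology (R : Type v) [CommRing R] (q : ℕ) :
    TopCat.{u}ᵒᵖ ⥤ ModuleCat.{max u v} R :=
  singularCochainFunctor R ⋙ HomologicalComplex.homologyFunctor _ _ q

/-- Subsets of a topological space, as topological spaces, with the inclusions. -/
def subspaceFunctor (X : Type u) [TopologicalSpace X] : Set X ⥤ TopCat.{u} where
  obj A := TopCat.of A
  map h := TopCat.ofHom ⟨Set.inclusion (leOfHom h), continuous_inclusion (leOfHom h)⟩

/-- `H^q(A; R)` as a contravariant functor of the subspace `A` of `X`. -/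
def subspaceCohomology (R : Type v) [CommRing R] (X : Type u) [TopologicalSpace X] (q : ℕ) :
    (Set X)ᵒᵖ ⥤ ModuleCat.{max u v} R :=
  (subspaceFunctor X).op ⋙ singularCohomology R q

/-! ### Persistence modules and graded `R[t]`-modules -/

/-- Persistence modules: `R`-modules `M i`, `i ∈ ℤ`, with maps `M i → M (i + 1)`
(and their composites). -/
abbrev PersistenceModule (R : Type v) [CommRing R] := ℤ ⥤ ModuleCat.{w} R

section Alpha

variable {R : Type v} [CommRing R]

/-- The endomorphism of `⨁ i, M i` sending the summand `M i` to the summand `M (i + 1)` by the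
structure map of `M`. -/
def shift (M : PersistenceModule.{v, w} R) : (⨁ i : ℤ, M.obj i) →ₗ[R] (⨁ i : ℤ, M.obj i) :=
  DirectSum.toModule R ℤ _ fun i =>
    DirectSum.lof R ℤ (fun i => M.obj i) (i + 1) ∘ₗ
      (M.map (homOfLE (Int.le_add_one le_rfl) : i ⟶ i + 1)).hom

/-- The `R[t]`-module `α(M) = ⨁ i, M i` of a persistence module; `t` acts by `shift M`. -/
def Alpha (M : PersistenceModule.{v, w} R) : Type w := ⨁ i : ℤ, M.obj i

instance (M : PersistenceModule.{v, w} R) : AddCommGroup (Alpha M) :=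
  inferInstanceAs (AddCommGroup (⨁ i : ℤ, M.obj i))

instance (M : PersistenceModule.{v, w} R) : Module R (Alpha M) :=
  inferInstanceAs (Module R (⨁ i : ℤ, M.obj i))

/-- The identification of `⨁ i, M i` with `α(M)`. -/
def Alpha.of (M : PersistenceModule.{v, w} R) : (⨁ i : ℤ, M.obj i) ≃ₗ[R] Alpha M :=
  LinearEquiv.refl R _

/-- Multiplication by `t` on `α(M)`. -/
def Alpha.t (M : PersistenceModule.{v, w} R) : Module.End R (Alpha M) :=
  (Alpha.of M).toLinearMap ∘ₗ shift M ∘ₗ (Alpha.of M).symm.toLinearMap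

/-- A polynomial `P` acts on `α(M)` as `P(t)`. -/
instance (M : PersistenceModule.{v, w} R) : Module R[X] (Alpha M) :=
  Module.compHom (Alpha M) (aeval (Alpha.t M)).toRingHom

lemma Alpha.X_smul (M : PersistenceModule.{v, w} R) (m : Alpha M) :
    (X : R[X]) • m = Alpha.t M m :=
  congrArg (fun φ : Module.End R (Alpha M) => φ m) (aeval_X (Alpha.t M))

lemma Alpha.C_smul (M : PersistenceModule.{v, w} R) (a : R) (m : Alpha M) :
    (C a : R[X]) • m = a • m :=
  congrArg (fun φ : Module.End R (Alpha M) => φ m) (aeval_C (Alpha.t M) a)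

instance (M : PersistenceModule.{v, w} R) : IsScalarTower R R[X] (Alpha M) where
  smul_assoc a P m := by
    rw [Polynomial.smul_eq_C_mul, mul_smul, Alpha.C_smul]

/-- The homogeneous component of degree `i` of an element of `α(M)`. -/
def Alpha.component (M : PersistenceModule.{v, w} R) (i : ℤ) : Alpha M →ₗ[R] M.obj i :=
  DirectSum.component R ℤ (fun i => M.obj i) i ∘ₗ (Alpha.of M).symm.toLinearMap

/-- The grading of `α(M)`: the degree `i` part is the summand `M i`. -/
def Alpha.grading (M : PersistenceModule.{v, w} R) (i : ℤ) : AddSubgroup (Alpha M) :=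
  (LinearMap.range ((Alpha.of M).toLinearMap ∘ₗ
    DirectSum.lof R ℤ (fun i => M.obj i) i)).toAddSubgroup

lemma shift_lof (M : PersistenceModule.{v, w} R) (i : ℤ) (x : M.obj i) :
    shift M (DirectSum.lof R ℤ (fun i => M.obj i) i x) =
      DirectSum.lof R ℤ (fun i => M.obj i) (i + 1)
        ((M.map (homOfLE (Int.le_add_one le_rfl) : i ⟶ i + 1)).hom x) := by
  simp [shift]

lemma shift_apply_succ (M : PersistenceModule.{v, w} R) (m : ⨁ i : ℤ, M.obj i) (j : ℤ) :
    shift M m (j + 1) = (M.map (homOfLE (Int.le_add_one le_rfl) : j ⟶ j + 1)).hom (m j) := by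
  induction m using DirectSum.induction_on with
  | zero => simp
  | of i x =>
    have h := shift_lof M i x
    rw [DirectSum.lof_eq_of, DirectSum.lof_eq_of] at h
    rw [h]
    by_cases hij : i = j
    · subst hij
      simp [DirectSum.of_eq_same]
    · rw [DirectSum.of_eq_of_ne _ _ _ (by lia), DirectSum.of_eq_of_ne _ _ _ (by lia), map_zero]
  | add x y hx hy => rw [map_add, DirectSum.add_apply, hx, hy, DirectSum.add_apply, map_add]

lemma Alpha.component_X_smul (M : PersistenceModule.{v, w} R) (m : Alpha M) (j : ℤ) :
    Alpha.component M (j + 1) ((X : R[X]) • m) =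
      (M.map (homOfLE (Int.le_add_one le_rfl) : j ⟶ j + 1)).hom (Alpha.component M j m) := by
  rw [Alpha.X_smul]
  exact shift_apply_succ M _ j

/-- The `R[t]`-linear map `α(M) → α(M')` induced by a morphism of persistence modules. -/
def Alpha.map {M M' : PersistenceModule.{v, w} R} (g : M ⟶ M') : Alpha M →ₗ[R[X]] Alpha M' :=
  let φ : Alpha M →ₗ[R] Alpha M' := (Alpha.of M').toLinearMap ∘ₗ
    DirectSum.lmap (fun i => (g.app i).hom) ∘ₗ (Alpha.of M).symm.toLinearMap
  { φ with
    map_smul' := by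
      have h : DirectSum.lmap (fun i => (g.app i).hom) ∘ₗ shift M =
          shift M' ∘ₗ DirectSum.lmap (fun i => (g.app i).hom) := by
        refine DirectSum.linearMap_ext _ fun i => LinearMap.ext fun x => ?_
        simp only [LinearMap.comp_apply, shift_lof, DirectSum.lmap_lof]
        congr 1
        exact congrArg (fun k => k.hom x)
          (g.naturality (homOfLE (Int.le_add_one le_rfl) : i ⟶ i + 1))
      have hX (m : Alpha M) : φ ((X : R[X]) • m) = (X : R[X]) • φ m := by
        rw [Alpha.X_smul, Alpha.X_smul]
        exact LinearMap.congr_fun h m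
      have hP (P : R[X]) : ∀ m : Alpha M, φ (P • m) = P • φ m := by
        induction P using Polynomial.induction_on with
        | C a => intro m; rw [Alpha.C_smul, Alpha.C_smul, map_smul]
        | add P Q hP hQ => intro m; rw [add_smul, add_smul, map_add, hP, hQ]
        | monomial n a ih =>
          intro m
          rw [pow_succ, ← mul_assoc, mul_smul, ih, hX, mul_smul (C a * X ^ n)]
      exact hP }

lemma Alpha.component_map {M M' : PersistenceModule.{v, w} R} (g : M ⟶ M') (m : Alpha M) (i : ℤ) :
    Alpha.component M' i (Alpha.map g m) = (g.app i).hom (Alpha.component M i m) :=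
  rfl

lemma Alpha.ext {M : PersistenceModule.{v, w} R} {m m' : Alpha M}
    (h : ∀ i, Alpha.component M i m = Alpha.component M i m') : m = m' :=
  (Alpha.of M).symm.injective (DFinsupp.ext h)

lemma Alpha.map_map {M M' M'' : PersistenceModule.{v, w} R} (g : M ⟶ M') (g' : M' ⟶ M'')
    (m : Alpha M) : Alpha.map g' (Alpha.map g m) = Alpha.map (g ≫ g') m :=
  Alpha.ext fun _ => by simp [Alpha.component_map]

end Alpha

/-- A grading of an `R[t]`-module by `ℤ`, where `R` has degree `0` and `t` has degree `1`. -/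
structure IsGrading {R : Type v} [CommRing R] {M : Type w} [AddCommGroup M] [Module R[X] M]
    (gr : ℤ → AddSubgroup M) : Prop where
  isInternal : DirectSum.IsInternal gr
  C_smul_mem : ∀ (a : R) (i : ℤ) (m : M), m ∈ gr i → (C a : R[X]) • m ∈ gr i
  X_smul_mem : ∀ (i : ℤ) (m : M), m ∈ gr i → (X : R[X]) • m ∈ gr (i + 1)

/-- The grading induced on the homology of a complex of graded modules: the degree `i` part
consists of the classes of the cycles of degree `i`. -/
def homologyGrading {S : Type v} [Ring S] {κ : Type*} {c : ComplexShape κ}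
    (K : HomologicalComplex (ModuleCat.{w} S) c) (gr : ∀ k, ℤ → AddSubgroup (K.X k)) (k : κ)
    (i : ℤ) : AddSubgroup (K.homology k) :=
  ((gr k i).comap (K.iCycles k).hom.toAddMonoidHom).map (K.homologyπ k).hom.toAddMonoidHom

/-! ### Persistent cohomology -/

/-- The persistence module `i ↦ H^q(L_i; R)` of a decreasing sequence `L_0 ⊇ L_1 ⊇ ⋯` of subspaces,
where `L_i = L_0` for `i ≤ 0`. The structure maps are the restrictions. The graded `R[t]`-module
`PH^q` is `Alpha` of it. -/
def persistentCohomology (R : Type v) [CommRing R] {X : Type u} [TopologicalSpace X]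
    (L : ℕ → Set X) (hL : Antitone L) (q : ℕ) : PersistenceModule.{v, max u v} R where
  obj i := (subspaceCohomology R X q).obj (op (L i.toNat))
  map h := (subspaceCohomology R X q).map (homOfLE (hL (Int.toNat_le_toNat (leOfHom h)))).op
  map_id _ := (subspaceCohomology R X q).map_id _
  map_comp _ _ := (subspaceCohomology R X q).map_comp _ _

/-- The presheaf of persistence modules `V ↦ (i ↦ H^q(K_i ∩ f⁻¹ V; R))` on `Y`. -/
def persistentCohomologyPresheaf (R : Type v) [CommRing R] {X : Type u} [TopologicalSpace X]
    {Y : Type*} (f : X → Y) (K : ℕ → Set X) (hK : Antitone K) (q : ℕ) :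
    (Set Y)ᵒᵖ ⥤ PersistenceModule.{v, max u v} R where
  obj V := persistentCohomology R (fun i => K i ∩ f ⁻¹' V.unop)
    (fun _ _ h => Set.inter_subset_inter_left _ (hK h)) q
  map {V W} h :=
    { app := fun i => (subspaceCohomology R X q).map
        (homOfLE (Set.inter_subset_inter_right (K i.toNat)
          (Set.preimage_mono (f := f) (leOfHom h.unop)))).op
      naturality := fun _ _ _ => by
        dsimp only [persistentCohomology]
        rw [← (subspaceCohomology R X q).map_comp, ← (subspaceCohomology R X q).map_comp]
        rfl }
  map_id _ := by
    ext1; funext i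
    exact (subspaceCohomology R X q).map_id _
  map_comp _ _ := by
    ext1; funext i
    exact (subspaceCohomology R X q).map_comp _ _

/-! ### Čech cohomology -/

section Cech

variable {R : Type v} [CommRing R] {Y : Type*} {ι : Type*} [LinearOrder ι]

/-- `U_{α₀} ∩ ⋯ ∩ U_{αₚ}` for `α₀ < ⋯ < αₚ`. -/
def cechInter (U : ι → Set Y) {p : ℕ} (σ : Fin (p + 1) ↪o ι) : Set Y := ⋂ k, U (σ k)

/-- Omit `αⱼ` from `α₀ < ⋯ < αₚ₊₁`. -/
def cechFace {p : ℕ} (σ : Fin (p + 2) ↪o ι) (j : Fin (p + 2)) : Fin (p + 1) ↪o ι :=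
  (Fin.succAboveOrderEmb j).trans σ

lemma cechInter_subset (U : ι → Set Y) {p : ℕ} (σ : Fin (p + 2) ↪o ι) (j : Fin (p + 2)) :
    cechInter U σ ⊆ cechInter U (cechFace σ j) :=
  Set.subset_iInter fun k => Set.iInter_subset (fun k => U (σ k)) (j.succAbove k)

variable (U : ι → Set Y) (F : (Set Y)ᵒᵖ ⥤ PersistenceModule.{v, w} R)

/-- The Čech `p`-cochains of `U` with values in the presheaf of graded `R[t]`-modules `α ∘ F`. The
product over `α₀ < ⋯ < αₚ` is that of graded modules: it consists of the families
whose components lie in finitely many degrees, so that it is the direct sum of its homogeneous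
parts `∏ F(U_{α₀…αₚ})_i`. For a finite cover it is the full product. -/
def cechCochains (p : ℕ) :
    Submodule R[X] (∀ σ : Fin (p + 1) ↪o ι, Alpha (F.obj (op (cechInter U σ)))) where
  carrier := {c | ∃ S : Finset ℤ, ∀ σ, ∀ i ∉ S, Alpha.component _ i (c σ) = 0}
  zero_mem' := ⟨∅, fun _ _ _ => map_zero _⟩
  add_mem' := by
    rintro a b ⟨S, hS⟩ ⟨T, hT⟩
    refine ⟨S ∪ T, fun σ i hi => ?_⟩
    rw [Finset.notMem_union] at hi
    rw [Pi.add_apply, map_add, hS σ i hi.1, hT σ i hi.2, add_zero]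
  smul_mem' := by
    intro P
    induction P using Polynomial.induction_on' with
    | add P Q hP hQ =>
      intro c hc
      obtain ⟨S, hS⟩ := hP hc
      obtain ⟨T, hT⟩ := hQ hc
      refine ⟨S ∪ T, fun σ i hi => ?_⟩
      rw [Finset.notMem_union] at hi
      rw [add_smul, Pi.add_apply, map_add, hS σ i hi.1, hT σ i hi.2, add_zero]
    | monomial n a =>
      rintro c ⟨S, hS⟩
      rw [← Polynomial.C_mul_X_pow_eq_monomial]
      have hX : ∀ n : ℕ, ∃ S : Finset ℤ, ∀ σ, ∀ i ∉ S,
          Alpha.component _ i (((X : R[X]) ^ n • c) σ) = 0 := by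
        intro n
        induction n with
        | zero => exact ⟨S, by simpa using hS⟩
        | succ n ih =>
          obtain ⟨T, hT⟩ := ih
          refine ⟨T.image (· + 1), fun σ i hi => ?_⟩
          obtain ⟨j, rfl⟩ : ∃ j, i = j + 1 := ⟨i - 1, by ring⟩
          have hj : j ∉ T := fun h => hi (Finset.mem_image_of_mem _ h)
          rw [pow_succ', mul_smul, Pi.smul_apply, Alpha.component_X_smul, hT σ j hj, map_zero]
      obtain ⟨T, hT⟩ := hX n
      refine ⟨T, fun σ i hi => ?_⟩
      rw [mul_smul, Pi.smul_apply, Alpha.C_smul, map_smul, hT σ i hi, smul_zero]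

/-- The restriction `α(F(U_{α₀…α̂ⱼ…αₚ₊₁})) → α(F(U_{α₀…αₚ₊₁}))`. -/
def cechRes {p : ℕ} (σ : Fin (p + 2) ↪o ι) (j : Fin (p + 2)) :
    Alpha (F.obj (op (cechInter U (cechFace σ j)))) →ₗ[R[X]] Alpha (F.obj (op (cechInter U σ))) :=
  Alpha.map (F.map (homOfLE (cechInter_subset U σ j)).op)

/-- The Čech differential
`(δ c)_{α₀…αₚ₊₁} = ∑ j, (-1)^j c_{α₀…α̂ⱼ…αₚ₊₁}` (restricted to `U_{α₀…αₚ₊₁}`). -/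
def cechDelta (p : ℕ) : cechCochains U F p →ₗ[R[X]] cechCochains U F (p + 1) :=
  LinearMap.codRestrict _
    (LinearMap.pi fun σ => ∑ j : Fin (p + 2),
      (-1 : ℤ) ^ (j : ℕ) • (cechRes U F σ j ∘ₗ LinearMap.proj (cechFace σ j) ∘ₗ
        (cechCochains U F p).subtype))
    (by
      rintro ⟨c, S, hS⟩
      refine ⟨S, fun σ i hi => ?_⟩
      simp only [LinearMap.pi_apply, LinearMap.sum_apply, map_sum]
      refine Finset.sum_eq_zero fun j _ => ?_
      rw [LinearMap.smul_apply, map_zsmul]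
      refine (congrArg _ ((Alpha.component_map _ _ i).trans ?_)).trans (smul_zero _)
      exact (congrArg _ (hS (cechFace σ j) i hi)).trans (map_zero _))

lemma cechDelta_apply (p : ℕ) (c : cechCochains U F p) (σ : Fin (p + 2) ↪o ι) :
    (cechDelta U F p c).1 σ =
      ∑ j : Fin (p + 2), (-1 : ℤ) ^ (j : ℕ) • cechRes U F σ j (c.1 (cechFace σ j)) := by
  simp [cechDelta]

lemma cechRes_comp_eq {p : ℕ} (c : cechCochains U F p) (σ : Fin (p + 3) ↪o ι)
    {j j' : Fin (p + 3)} {k k' : Fin (p + 2)}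
    (h : cechFace (cechFace σ j) k = cechFace (cechFace σ j') k') :
    cechRes U F σ j (cechRes U F (cechFace σ j) k (c.1 (cechFace (cechFace σ j) k))) =
      cechRes U F σ j' (cechRes U F (cechFace σ j') k' (c.1 (cechFace (cechFace σ j') k'))) := by
  have key : ∀ (τ : Fin (p + 1) ↪o ι) (hτ : cechFace (cechFace σ j) k = τ)
      (hle : cechInter U σ ⊆ cechInter U τ),
      cechRes U F σ j (cechRes U F (cechFace σ j) k (c.1 (cechFace (cechFace σ j) k))) =
        Alpha.map (F.map (homOfLE hle).op) (c.1 τ) := by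
    rintro _ rfl hle
    refine (Alpha.map_map _ _ _).trans ?_
    rw [← F.map_comp]
    rfl
  rw [key _ h ((cechInter_subset U σ j').trans (cechInter_subset U _ k'))]
  refine ((Alpha.map_map _ _ _).trans ?_).symm
  rw [← F.map_comp]
  rfl

lemma cechFace_cechFace {p : ℕ} (σ : Fin (p + 3) ↪o ι) {j k : Fin (p + 2)} (h : k ≤ j) :
    cechFace (cechFace σ j.succ) k = cechFace (cechFace σ k.castSucc) j := by
  refine RelEmbedding.ext fun l => ?_
  change σ (j.succ.succAbove (k.succAbove l)) = σ (k.castSucc.succAbove (j.succAbove l))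
  congr 1
  simp only [Fin.succAbove, Fin.lt_def, Fin.le_def, Fin.ext_iff] at h ⊢
  split_ifs <;> simp_all <;> lia

lemma cechDelta_cechDelta (p : ℕ) (c : cechCochains U F p) :
    cechDelta U F (p + 1) (cechDelta U F p c) = 0 := by
  refine Subtype.ext (funext fun σ => ?_)
  rw [cechDelta_apply]
  simp only [cechDelta_apply, map_sum, map_zsmul, Finset.smul_sum, smul_smul, ← pow_add]
  rw [← Finset.sum_product', Finset.univ_product_univ,
    ← Finset.sum_filter_add_sum_filter_not _ (fun x : Fin (p + 3) × Fin (p + 2) =>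
      x.2.castSucc < x.1)]
  refine (eq_neg_iff_add_eq_zero (G := Alpha _)).1 ?_
  rw [← Finset.sum_neg_distrib]
  refine Finset.sum_bij' (fun x hx => (x.2.castSucc, x.1.pred
      (Fin.ne_zero_of_lt (Finset.mem_filter.1 hx).2)))
    (fun x hx => (x.2.succ, x.1.castPred
      (Fin.ne_last_of_lt (lt_of_le_of_lt (not_lt.1 (Finset.mem_filter.1 hx).2)
        (Fin.castSucc_lt_succ (i := x.2)))))) ?_ ?_ ?_ ?_ ?_
  · rintro ⟨j, k⟩ h
    simp only [Finset.mem_filter, Finset.mem_univ, true_and, Fin.lt_def, Fin.val_castSucc,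
      Fin.val_pred, not_lt] at h ⊢
    lia
  · rintro ⟨j, k⟩ h
    simp only [Finset.mem_filter, Finset.mem_univ, true_and, Fin.lt_def, Fin.val_castSucc,
      Fin.val_succ, Fin.coe_castPred, not_lt] at h ⊢
    lia
  · rintro ⟨j, k⟩ h
    simp
  · rintro ⟨j, k⟩ h
    simp
  · rintro ⟨j, k⟩ h
    have h' : k.castSucc < j := (Finset.mem_filter.1 h).2
    obtain ⟨j, rfl⟩ := Fin.exists_succ_eq.2 (Fin.ne_zero_of_lt h')
    have hkj : k ≤ j := by
      simp only [Fin.lt_def, Fin.le_def, Fin.val_castSucc, Fin.val_succ] at h' ⊢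
      lia
    simp only [Fin.pred_succ, Fin.val_succ, Fin.val_castSucc]
    rw [cechRes_comp_eq U F c σ (cechFace_cechFace σ hkj), ← neg_smul]
    congr 1
    ring

/-- The Čech complex of `U` with values in the presheaf of graded `R[t]`-modules `α ∘ F`. -/
def cechComplex : CochainComplex (ModuleCat R[X]) ℕ :=
  CochainComplex.of (fun p => ModuleCat.of R[X] (cechCochains U F p))
    (fun p => ModuleCat.ofHom (cechDelta U F p))
    (fun p => by
      refine ModuleCat.hom_ext (LinearMap.ext fun c => ?_)
      exact cechDelta_cechDelta U F p c)

/-- The grading of the Čech cochains: `c` has degree `i` if all its values have degree `i`. -/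
def cechGrading (p : ℕ) (i : ℤ) : AddSubgroup ((cechComplex U F).X p) :=
  (AddSubgroup.pi Set.univ fun σ : Fin (p + 1) ↪o ι =>
    Alpha.grading (F.obj (op (cechInter U σ))) i).comap
      (cechCochains U F p).subtype.toAddMonoidHom

/-- Čech cohomology `H^p(U, α ∘ F)`, an `R[t]`-module. -/
abbrev cechCohomology (p : ℕ) : ModuleCat R[X] := (cechComplex U F).homology p

end Cech

/-! ### Spectral sequences of graded `R[t]`-modules -/

/-- A first quadrant `E₂` cohomological spectral sequence of `ℤ`-graded `R[t]`-modules: the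
differentials and the identifications `H(E_r) ≅ E_{r+1}` are `R[t]`-linear of degree `0`. -/
structure GradedSpectralSequence (R : Type v) [CommRing R] where
  /-- the underlying spectral sequence of `R[t]`-modules -/
  E : E₂CohomologicalSpectralSequenceNat (ModuleCat.{w} R[X])
  /-- the gradings of the terms of the pages -/
  gr (r : ℤ) (hr : 2 ≤ r) (pq : ℕ × ℕ) : ℤ → AddSubgroup ((E.page r hr).X pq)
  isGrading (r : ℤ) (hr : 2 ≤ r) (pq : ℕ × ℕ) : IsGrading (R := R) (gr r hr pq)
  d_mem (r : ℤ) (hr : 2 ≤ r) (pq pq' : ℕ × ℕ) (i : ℤ) (x : (E.page r hr).X pq)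
    (hx : x ∈ gr r hr pq i) : ((E.page r hr).d pq pq').hom x ∈ gr r hr pq' i
  iso_map (r : ℤ) (hr : 2 ≤ r) (pq : ℕ × ℕ) (i : ℤ) :
    (homologyGrading (E.page r hr) (gr r hr) pq i).map
      (E.iso r (r + 1) pq rfl hr).hom.hom.toAddMonoidHom = gr (r + 1) (by lia) pq i

/-- Convergence of a first quadrant spectral sequence of graded `R[t]`-modules to a sequence `A` of
graded `R[t]`-modules. Each `A n` has a decreasing filtration
`A n = F⁰ ⊇ F¹ ⊇ ⋯ ⊇ Fⁿ⁺¹ = 0` by homogeneous `R[t]`-submodules such that `F^p / F^{p+1}` is, as a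
graded `R[t]`-module, isomorphic to `E_∞^{p,q}` for `p + q = n`. Here `E_∞^{p,q} = E_r^{p,q}` for
all `r > max (p, q + 1)`: then no differential of `E_r` at `(p,q)` stays in the first quadrant. -/
def GradedSpectralSequence.ConvergesTo {R : Type v} [CommRing R]
    (𝓔 : GradedSpectralSequence.{v, w} R) (A : ℕ → Type*) [∀ n, AddCommGroup (A n)]
    [∀ n, Module R[X] (A n)] (grA : ∀ n, ℤ → AddSubgroup (A n)) : Prop :=
  ∃ F : ∀ n, ℕ → Submodule R[X] (A n),
    (∀ n, Antitone (F n)) ∧ (∀ n, F n 0 = ⊤) ∧ (∀ n, F n (n + 1) = ⊥) ∧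
    (∀ n p, (F n p).toAddSubgroup = ⨆ i, (F n p).toAddSubgroup ⊓ grA n i) ∧
    ∀ (p q : ℕ) (r : ℤ) (hr : 2 ≤ r), (p : ℤ) < r → (q : ℤ) + 1 < r →
      ∃ e : (𝓔.E.page r hr).X (p, q) ≃ₗ[R[X]]
          (F (p + q) p ⧸ (F (p + q) (p + 1)).submoduleOf (F (p + q) p)),
        ∀ i, (𝓔.gr r hr (p, q) i).map e.toLinearMap.toAddMonoidHom =
          ((grA (p + q) i).comap (F (p + q) p).subtype.toAddMonoidHom).map
            ((F (p + q) (p + 1)).submoduleOf (F (p + q) p)).mkQ.toAddMonoidHom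

end PersistentLeray

end

/-!
In each degree `i` the Čech cochains with values in the singular cochains of the spaces
`K_i ∩ f⁻¹(U_{α₀} ∩ ⋯ ∩ U_{αₚ})` form a double complex, and these assemble to a double complex of
graded `R[t]`-modules. The spectral sequence is that of its total complex, filtered by the Čech
degree `p`.

Taking singular cohomology first gives the Čech complex of `PH^q`, because a family supported in
finitely many degrees can be lifted to cocycles, or written as a coboundary, one component at a
time. For the limit, the rows are exact: on a fixed singular simplex a row is the cochain complex
of the full simplex on the members of the cover containing it, which inserting one fixed vertex
contracts. So the total complex computes the cohomology of the singular cochains of `K_i` modulo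
those vanishing on all simplices small with respect to the cover, and the latter cochains are
acyclic by iterated barycentric subdivision.

Each term is a subquotient, and is identified with the graded module it represents through a linear
relation between representatives and classes; a relation is easier to compose and to restrict than
the isomorphism it induces.
-/

noncomputable section

namespace PersistentLeray

/-! ### Ordered chains on a set of vertices -/

section Chains

open Finsupp (single supported single_mem_supported)

/-- Integral chains on `k`-tuples of elements of `V`: ordered simplicial chains of dimension
`k - 1`. The tuples need not be injective, and `k = 0` is the augmentation. -/
abbrev TupleChain (V : Type*) (k : ℕ) := (Fin k → V) →₀ ℤ

namespace TupleChain

variable {V V' : Type*}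

/-- The boundary of a chain, the alternating sum of the faces. -/
def bd (k : ℕ) : TupleChain V (k + 1) →ₗ[ℤ] TupleChain V k :=
  Finsupp.linearCombination ℤ fun w => ∑ j : Fin (k + 1),
    (-1 : ℤ) ^ (j : ℕ) • single (w ∘ j.succAbove) (1 : ℤ)

/-- The cone with apex `b`. -/
def cone (b : V) (k : ℕ) : TupleChain V k →ₗ[ℤ] TupleChain V (k + 1) :=
  Finsupp.lmapDomain ℤ ℤ fun w => Fin.cons b w

/-- The chain map induced by a map of vertices. -/
def push (g : V → V') (k : ℕ) : TupleChain V k →ₗ[ℤ] TupleChain V' k :=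
  Finsupp.lmapDomain ℤ ℤ fun w => g ∘ w

lemma bd_single (k : ℕ) (w : Fin (k + 1) → V) :
    bd k (single w 1) =
      ∑ j : Fin (k + 1), (-1 : ℤ) ^ (j : ℕ) • single (w ∘ j.succAbove) (1 : ℤ) := by
  simp [bd]

lemma cone_single (b : V) (k : ℕ) (w : Fin k → V) :
    cone b k (single w 1) = single (Fin.cons b w) 1 := by
  simp [cone]

lemma push_single (g : V → V') (k : ℕ) (w : Fin k → V) :
    push g k (single w 1) = single (g ∘ w) 1 := by
  simp [push]

lemma linearMap_ext {k : ℕ} {M : Type*} [AddCommGroup M] {f g : TupleChain V k →ₗ[ℤ] M}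
    (h : ∀ w, f (single w 1) = g (single w 1)) : f = g :=
  Finsupp.lhom_ext' fun w => LinearMap.ext_ring (h w)

lemma bd_cone_zero (b : V) (c : TupleChain V 0) : bd 0 (cone b 0 c) = c := by
  suffices h : bd 0 ∘ₗ cone b 0 = LinearMap.id from LinearMap.congr_fun h c
  refine linearMap_ext fun w => ?_
  simp only [LinearMap.comp_apply, cone_single, bd_single, LinearMap.id_apply]
  simp

lemma bd_cone (b : V) (k : ℕ) (c : TupleChain V (k + 1)) :
    bd (k + 1) (cone b (k + 1) c) = c - cone b k (bd k c) := by
  suffices h : bd (k + 1) ∘ₗ cone b (k + 1) = LinearMap.id - cone b k ∘ₗ bd k from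
    LinearMap.congr_fun h c
  refine linearMap_ext fun w => ?_
  have face_zero : (Fin.cons b w : Fin (k + 2) → V) ∘ (0 : Fin (k + 2)).succAbove = w := by
    ext; simp
  have face_succ (j : Fin (k + 1)) : (Fin.cons b w : Fin (k + 2) → V) ∘ j.succ.succAbove =
      Fin.cons b (w ∘ j.succAbove) := by
    ext l
    cases l using Fin.cases <;> simp
  simp only [LinearMap.comp_apply, cone_single, bd_single, LinearMap.id_apply,
    LinearMap.sub_apply, map_sum, map_zsmul]
  rw [Fin.sum_univ_succ, sub_eq_add_neg, ← Finset.sum_neg_distrib, face_zero]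
  simp [face_succ, pow_succ]

lemma bd_comp_bd (k : ℕ) : bd k ∘ₗ bd (k + 1) = (0 : TupleChain V (k + 2) →ₗ[ℤ] _) := by
  induction k with
  | zero =>
    refine linearMap_ext fun w => ?_
    rw [LinearMap.comp_apply, ← Fin.cons_self_tail w, ← cone_single, bd_cone, map_sub,
      bd_cone_zero, sub_self, LinearMap.zero_apply]
  | succ k ih =>
    refine linearMap_ext fun w => ?_
    rw [LinearMap.comp_apply, ← Fin.cons_self_tail w, ← cone_single, bd_cone, map_sub, bd_cone,
      ← LinearMap.comp_apply (bd k), ih]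
    simp

lemma bd_bd (k : ℕ) (c : TupleChain V (k + 2)) : bd k (bd (k + 1) c) = 0 :=
  LinearMap.congr_fun (bd_comp_bd k) c

lemma push_bd (g : V → V') (k : ℕ) (c : TupleChain V (k + 1)) :
    push g k (bd k c) = bd k (push g (k + 1) c) := by
  suffices h : push g k ∘ₗ bd k = bd k ∘ₗ push g (k + 1) from LinearMap.congr_fun h c
  refine linearMap_ext fun w => ?_
  simp only [LinearMap.comp_apply, bd_single, push_single, map_sum, map_zsmul, Function.comp_assoc]

lemma push_cone (g : V → V') (b : V) (k : ℕ) (c : TupleChain V k) :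
    push g (k + 1) (cone b k c) = cone (g b) k (push g k c) := by
  suffices h : push g (k + 1) ∘ₗ cone b k = cone (g b) k ∘ₗ push g k from LinearMap.congr_fun h c
  refine linearMap_ext fun w => ?_
  simp only [LinearMap.comp_apply, cone_single, push_single, Fin.comp_cons]

/-! ### Subdivision of chains -/

variable (β : ∀ k, (Fin (k + 1) → V) → V)

/-- The subdivision operator attached to a choice `β` of a point for each simplex: a simplex is
replaced by the cone with apex that point over the subdivision of its boundary. -/
def sd : ∀ k, TupleChain V k →ₗ[ℤ] TupleChain V k
  | 0 => LinearMap.id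
  | k + 1 => Finsupp.linearCombination ℤ fun w => cone (β k w) k (sd k (bd k (single w 1)))

/-- The chain homotopy between the identity and the subdivision operator. -/
def sdHomotopy : ∀ k, TupleChain V k →ₗ[ℤ] TupleChain V (k + 1)
  | 0 => 0
  | k + 1 => Finsupp.linearCombination ℤ fun w =>
      cone (β k w) (k + 1) (single w 1 - sdHomotopy k (bd k (single w 1)))

lemma sd_single (k : ℕ) (w : Fin (k + 1) → V) :
    sd β (k + 1) (single w 1) = cone (β k w) k (sd β k (bd k (single w 1))) := by
  simp [sd]

lemma sdHomotopy_single (k : ℕ) (w : Fin (k + 1) → V) :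
    sdHomotopy β (k + 1) (single w 1) =
      cone (β k w) (k + 1) (single w 1 - sdHomotopy β k (bd k (single w 1))) := by
  simp [sdHomotopy]

lemma bd_comp_sd (k : ℕ) : bd k ∘ₗ sd β (k + 1) = sd β k ∘ₗ bd k := by
  induction k with
  | zero =>
    refine linearMap_ext fun w => ?_
    rw [LinearMap.comp_apply, LinearMap.comp_apply, sd_single, bd_cone_zero]
  | succ k ih =>
    refine linearMap_ext fun w => ?_
    rw [LinearMap.comp_apply, LinearMap.comp_apply, sd_single, bd_cone,
      ← LinearMap.comp_apply (bd k), ih, LinearMap.comp_apply, bd_bd, map_zero, map_zero, sub_zero]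

lemma bd_sd (k : ℕ) (c : TupleChain V (k + 1)) : bd k (sd β (k + 1) c) = sd β k (bd k c) :=
  LinearMap.congr_fun (bd_comp_sd β k) c

lemma bd_comp_sdHomotopy_add (k : ℕ) :
    bd (k + 1) ∘ₗ sdHomotopy β (k + 1) + sdHomotopy β k ∘ₗ bd k =
      LinearMap.id - sd β (k + 1) := by
  induction k with
  | zero =>
    refine linearMap_ext fun w => ?_
    simp [bd_cone, sdHomotopy, sd]
  | succ k ih =>
    refine linearMap_ext fun w => ?_
    have h := LinearMap.congr_fun ih (bd (k + 1) (single w 1))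
    simp only [LinearMap.add_apply, LinearMap.sub_apply, LinearMap.comp_apply, LinearMap.id_apply,
      bd_bd, map_zero, add_zero] at h
    simp only [LinearMap.add_apply, LinearMap.sub_apply, LinearMap.comp_apply, LinearMap.id_apply,
      sdHomotopy_single, sd_single, bd_cone]
    rw [map_sub (bd (k + 1)), h, sub_sub_cancel]
    abel

/-- The chain homotopy between the identity and the `m`-fold iterate of the subdivision. -/
def sdPowHomotopy (m k : ℕ) : TupleChain V k →ₗ[ℤ] TupleChain V (k + 1) :=
  ∑ i ∈ Finset.range m, sdHomotopy β k ∘ₗ sd β k ^ i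

lemma sdPowHomotopy_apply (m k : ℕ) (c : TupleChain V k) :
    sdPowHomotopy β m k c = ∑ i ∈ Finset.range m, sdHomotopy β k ((sd β k ^ i) c) := by
  simp [sdPowHomotopy]

lemma bd_sd_pow (k m : ℕ) (c : TupleChain V (k + 1)) :
    bd k ((sd β (k + 1) ^ m) c) = (sd β k ^ m) (bd k c) := by
  induction m with
  | zero => rfl
  | succ m ih => rw [pow_succ', pow_succ', Module.End.mul_apply, Module.End.mul_apply, bd_sd, ih]

lemma bd_sdPowHomotopy_add (k m : ℕ) (c : TupleChain V (k + 1)) :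
    bd (k + 1) (sdPowHomotopy β m (k + 1) c) + sdPowHomotopy β m k (bd k c) =
      c - (sd β (k + 1) ^ m) c := by
  simp only [sdPowHomotopy_apply]
  induction m with
  | zero => simp
  | succ m ih =>
    have h := LinearMap.congr_fun (bd_comp_sdHomotopy_add β k) ((sd β (k + 1) ^ m) c)
    simp only [LinearMap.add_apply, LinearMap.sub_apply, LinearMap.comp_apply, LinearMap.id_apply,
      bd_sd_pow] at h
    rw [Finset.sum_range_succ, Finset.sum_range_succ, map_add, add_add_add_comm, ih, h, pow_succ',
      Module.End.mul_apply]
    abel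

variable {β} {β' : ∀ k, (Fin (k + 1) → V') → V'} {g : V → V'}

lemma push_sd (hg : ∀ k w, g (β k w) = β' k (g ∘ w)) (k : ℕ) (c : TupleChain V k) :
    push g k (sd β k c) = sd β' k (push g k c) := by
  induction k with
  | zero => rfl
  | succ k ih =>
    suffices h : push g (k + 1) ∘ₗ sd β (k + 1) = sd β' (k + 1) ∘ₗ push g (k + 1) from
      LinearMap.congr_fun h c
    refine linearMap_ext fun w => ?_
    rw [LinearMap.comp_apply, LinearMap.comp_apply, sd_single, push_cone, ih, push_bd, push_single,
      sd_single, hg]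

lemma push_sdHomotopy (hg : ∀ k w, g (β k w) = β' k (g ∘ w)) (k : ℕ) (c : TupleChain V k) :
    push g (k + 1) (sdHomotopy β k c) = sdHomotopy β' k (push g k c) := by
  induction k with
  | zero => simp [sdHomotopy]
  | succ k ih =>
    suffices h : push g (k + 2) ∘ₗ sdHomotopy β (k + 1) =
        sdHomotopy β' (k + 1) ∘ₗ push g (k + 1) from LinearMap.congr_fun h c
    refine linearMap_ext fun w => ?_
    rw [LinearMap.comp_apply, LinearMap.comp_apply, sdHomotopy_single, push_cone, map_sub, ih,
      push_bd, push_single, sdHomotopy_single, hg]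

lemma push_sd_pow (hg : ∀ k w, g (β k w) = β' k (g ∘ w)) (k m : ℕ) (c : TupleChain V k) :
    push g k ((sd β k ^ m) c) = (sd β' k ^ m) (push g k c) := by
  induction m with
  | zero => rfl
  | succ m ih =>
    rw [pow_succ', pow_succ', Module.End.mul_apply, Module.End.mul_apply, push_sd hg, ih]

lemma push_sdPowHomotopy (hg : ∀ k w, g (β k w) = β' k (g ∘ w)) (k m : ℕ) (c : TupleChain V k) :
    push g (k + 1) (sdPowHomotopy β m k c) = sdPowHomotopy β' m k (push g k c) := by
  simp only [sdPowHomotopy_apply, map_sum, push_sdHomotopy hg, push_sd_pow hg]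

/-! ### Supports of subdivisions -/

lemma map_mem_supported {k l : ℕ} (f : TupleChain V k →ₗ[ℤ] TupleChain V l)
    {P : Set (Fin k → V)} {Q : Set (Fin l → V)} (h : ∀ w ∈ P, f (single w 1) ∈ supported ℤ ℤ Q)
    {c : TupleChain V k} (hc : c ∈ supported ℤ ℤ P) : f c ∈ supported ℤ ℤ Q := by
  suffices hle : supported ℤ ℤ P ≤ (supported ℤ ℤ Q).comap f from hle hc
  rw [Finsupp.supported_eq_span_single, Submodule.span_le]
  rintro _ ⟨w, hw, rfl⟩
  exact h w hw

lemma bd_mem_supported {k : ℕ} {P : Set (Fin (k + 1) → V)} {Q : Set (Fin k → V)}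
    (h : ∀ w ∈ P, ∀ j : Fin (k + 1), w ∘ j.succAbove ∈ Q) {c : TupleChain V (k + 1)}
    (hc : c ∈ supported ℤ ℤ P) : bd k c ∈ supported ℤ ℤ Q := by
  refine map_mem_supported _ (fun w hw => ?_) hc
  rw [bd_single]
  exact sum_mem fun j _ => Submodule.smul_mem _ _ (single_mem_supported ℤ _ (h w hw j))

lemma cone_mem_supported {k : ℕ} {b : V} {P : Set (Fin k → V)} {Q : Set (Fin (k + 1) → V)}
    (h : ∀ w ∈ P, Fin.cons b w ∈ Q) {c : TupleChain V k}
    (hc : c ∈ supported ℤ ℤ P) : cone b k c ∈ supported ℤ ℤ Q := by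
  refine map_mem_supported _ (fun w hw => ?_) hc
  rw [cone_single]
  exact single_mem_supported ℤ _ (h w hw)

/-- The tuples with entries in `C`. -/
def tuplesIn (C : Set V) (k : ℕ) : Set (Fin k → V) := {w | ∀ j, w j ∈ C}

lemma cons_mem_tuplesIn {C : Set V} {k : ℕ} {b : V} (hb : b ∈ C) (w : Fin k → V)
    (hw : w ∈ tuplesIn C k) : Fin.cons b w ∈ tuplesIn C (k + 1) :=
  Fin.cases (by simpa using hb) fun j => by simpa using hw j

variable {C : Set V}

lemma bd_mem_supported_tuplesIn {k : ℕ} {c : TupleChain V (k + 1)}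
    (hc : c ∈ supported ℤ ℤ (tuplesIn C (k + 1))) : bd k c ∈ supported ℤ ℤ (tuplesIn C k) :=
  bd_mem_supported (P := tuplesIn C (k + 1)) (Q := tuplesIn C k)
    (fun _ hw j l => hw (j.succAbove l)) hc

lemma sd_mem_supported_tuplesIn (hC : ∀ k, ∀ w ∈ tuplesIn C (k + 1), β k w ∈ C) {k : ℕ}
    {c : TupleChain V k} (hc : c ∈ supported ℤ ℤ (tuplesIn C k)) :
    sd β k c ∈ supported ℤ ℤ (tuplesIn C k) := by
  induction k with
  | zero => exact hc
  | succ k ih =>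
    refine map_mem_supported _ (fun w hw => ?_) hc
    rw [sd_single]
    exact cone_mem_supported (cons_mem_tuplesIn (hC k w hw))
      (ih (bd_mem_supported_tuplesIn (single_mem_supported ℤ _ hw)))

lemma sdHomotopy_mem_supported_tuplesIn (hC : ∀ k, ∀ w ∈ tuplesIn C (k + 1), β k w ∈ C) {k : ℕ}
    {c : TupleChain V k} (hc : c ∈ supported ℤ ℤ (tuplesIn C k)) :
    sdHomotopy β k c ∈ supported ℤ ℤ (tuplesIn C (k + 1)) := by
  induction k with
  | zero => simp [sdHomotopy]
  | succ k ih =>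
    refine map_mem_supported _ (fun w hw => ?_) hc
    have hw' := single_mem_supported (M := ℤ) ℤ 1 hw
    rw [sdHomotopy_single]
    exact cone_mem_supported (cons_mem_tuplesIn (hC k w hw))
      (sub_mem hw' (ih (bd_mem_supported_tuplesIn hw')))

end TupleChain

/-! ### Affine simplices in a standard simplex -/

open TupleChain

/-- The standard simplex with vertex set `Fin n`, so of dimension `n - 1`. -/
abbrev Simp (n : ℕ) := stdSimplex ℝ (Fin n)

/-- The affine map between standard simplices with prescribed values at the vertices. -/
def affineSimplex {k n : ℕ} (w : Fin k → Simp n) : C(Simp k, Simp n) where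
  toFun t := ⟨∑ i, t i • (w i : Fin n → ℝ), (convex_stdSimplex ℝ (Fin n)).sum_mem
    (fun i _ => t.2.1 i) t.2.2 (fun i _ => (w i).2)⟩
  continuous_toFun := by
    refine Continuous.subtype_mk (continuous_finsetSum _ fun i _ => ?_) _
    exact ((continuous_apply i).comp (continuous_subtype_val (p := (· ∈ Simp k)))).smul
      (continuous_const (y := (w i : Fin n → ℝ)))

lemma affineSimplex_coe {k n : ℕ} (w : Fin k → Simp n) (t : Simp k) :
    (affineSimplex w t : Fin n → ℝ) = ∑ i, t i • (w i : Fin n → ℝ) := rfl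

lemma affineSimplex_apply {k n : ℕ} (w : Fin k → Simp n) (t : Simp k) (l : Fin n) :
    affineSimplex w t l = ∑ i, t i * w i l := by
  rw [affineSimplex_coe, Finset.sum_apply]
  rfl

lemma simp_ext {n : ℕ} {s t : Simp n} (h : ∀ i, s i = t i) : s = t := Subtype.ext (funext h)

lemma affineSimplex_affineSimplex {k n m : ℕ} (u : Fin n → Simp m) (w : Fin k → Simp n)
    (t : Simp k) :
    affineSimplex u (affineSimplex w t) = affineSimplex (affineSimplex u ∘ w) t := by
  refine simp_ext fun l => ?_
  simp only [affineSimplex_apply, Function.comp_apply, Finset.sum_mul, Finset.mul_sum]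
  rw [Finset.sum_comm]
  simp only [mul_assoc]

lemma vertex_apply {n : ℕ} (i j : Fin n) :
    (stdSimplex.vertex i : Simp n) j = if i = j then 1 else 0 := by
  change (stdSimplex.vertex i : Simp n).1 j = _
  simp [Pi.single_apply, eq_comm]

lemma affineSimplex_vertex {k n : ℕ} (w : Fin k → Simp n) (i : Fin k) :
    affineSimplex w (stdSimplex.vertex i) = w i :=
  simp_ext fun l => by simp [affineSimplex_apply, vertex_apply]

lemma affineSimplex_vertices {n : ℕ} (t : Simp n) :
    affineSimplex (fun i : Fin n => (stdSimplex.vertex i : Simp n)) t = t :=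
  simp_ext fun l => by simp [affineSimplex_apply, vertex_apply]

lemma map_eq_affineSimplex {k n : ℕ} (g : Fin k → Fin n) (t : Simp k) :
    stdSimplex.map g t = affineSimplex (fun i => (stdSimplex.vertex (g i) : Simp n)) t := by
  refine simp_ext fun l => ?_
  rw [affineSimplex_apply, stdSimplex.map_coe]
  simp only [FunOnFinite.linearMap_apply_apply, vertex_apply, mul_ite, mul_one, mul_zero,
    Finset.sum_ite, Finset.sum_const_zero, add_zero]

lemma mem_tuplesIn_range_affineSimplex {k l n : ℕ} {w : Fin k → Simp n} {u : Fin l → Simp n} :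
    u ∈ tuplesIn (Set.range (affineSimplex w)) l ↔ ∃ t : Fin l → Simp k, affineSimplex w ∘ t = u :=
  ⟨fun h => ⟨fun j => (h j).choose, funext fun j => (h j).choose_spec⟩,
    fun ⟨t, ht⟩ j => ⟨t j, congrFun ht j⟩⟩

lemma self_mem_tuplesIn_range_affineSimplex {n k : ℕ} (w : Fin k → Simp n) :
    w ∈ tuplesIn (Set.range (affineSimplex w)) k :=
  fun j => ⟨_, affineSimplex_vertex w j⟩

/-- The barycenter of an affine simplex. -/
def bary {n : ℕ} (k : ℕ) (w : Fin (k + 1) → Simp n) : Simp n :=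
  affineSimplex w stdSimplex.barycenter

lemma affineSimplex_bary {n m : ℕ} (u : Fin n → Simp m) (k : ℕ) (w : Fin (k + 1) → Simp n) :
    affineSimplex u (bary k w) = bary k (affineSimplex u ∘ w) :=
  affineSimplex_affineSimplex u w _

lemma bary_mem_range_affineSimplex {n k : ℕ} (w : Fin k → Simp n) (l : ℕ) (u : Fin (l + 1) → Simp n)
    (hu : u ∈ tuplesIn (Set.range (affineSimplex w)) (l + 1)) :
    bary l u ∈ Set.range (affineSimplex w) := by
  obtain ⟨t, rfl⟩ := mem_tuplesIn_range_affineSimplex.1 hu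
  exact ⟨bary l t, affineSimplex_bary w l t⟩

/-! ### The mesh of subdivisions -/

lemma dist_affineSimplex_le {k n : ℕ} (w : Fin k → Simp n) (t : Simp k) (x : Simp n) {d : ℝ}
    (h : ∀ i, dist (w i) x ≤ d) : dist (affineSimplex w t) x ≤ d :=
  (convex_closedBall (x : Fin n → ℝ) d).sum_mem (t := Finset.univ) (w := fun i => t i)
    (z := fun i => (w i : Fin n → ℝ)) (fun i _ => t.2.1 i) t.2.2 (fun i _ => h i)

lemma bary_sub_eq_sum {n k : ℕ} (w : Fin (k + 1) → Simp n) (x : Fin n → ℝ) :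
    (bary k w : Fin n → ℝ) - x = ∑ i, ((k : ℝ) + 1)⁻¹ • ((w i : Fin n → ℝ) - x) := by
  have hb (i : Fin (k + 1)) : (stdSimplex.barycenter : Simp (k + 1)) i = ((k : ℝ) + 1)⁻¹ :=
    (stdSimplex.barycenter_apply (𝕜 := ℝ) i).trans (by simp)
  have hk : (k : ℝ) + 1 ≠ 0 := by positivity
  rw [bary, affineSimplex_coe]
  simp only [hb, smul_sub, Finset.sum_sub_distrib, Finset.sum_const, Finset.card_univ,
    Fintype.card_fin]
  rw [← Nat.cast_smul_eq_nsmul ℝ, smul_smul, Nat.cast_succ, mul_inv_cancel₀ hk, one_smul]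

lemma dist_bary_le {n k : ℕ} (w : Fin (k + 1) → Simp n) {d : ℝ}
    (h : ∀ i j, dist (w i) (w j) ≤ d) (j : Fin (k + 1)) :
    dist (w j) (bary k w) ≤ k / (k + 1) * d := by
  have hk : (0 : ℝ) ≤ ((k : ℝ) + 1)⁻¹ := by positivity
  have hterm (i) : ‖((k : ℝ) + 1)⁻¹ • ((w i : Fin n → ℝ) - w j)‖ ≤ ((k : ℝ) + 1)⁻¹ * d := by
    rw [norm_smul, Real.norm_of_nonneg hk, ← dist_eq_norm]
    exact mul_le_mul_of_nonneg_left (h i j) hk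
  calc dist (w j) (bary k w)
      = ‖∑ i, ((k : ℝ) + 1)⁻¹ • ((w i : Fin n → ℝ) - w j)‖ := by
        rw [dist_comm, ← bary_sub_eq_sum, ← dist_eq_norm]
        rfl
    _ = ‖∑ i ∈ Finset.univ.erase j, ((k : ℝ) + 1)⁻¹ • ((w i : Fin n → ℝ) - w j)‖ := by
        rw [← Finset.add_sum_erase _ _ (Finset.mem_univ j), sub_self, smul_zero, zero_add]
    _ ≤ ∑ _i ∈ Finset.univ.erase j, ((k : ℝ) + 1)⁻¹ * d :=
        (norm_sum_le _ _).trans (Finset.sum_le_sum fun i _ => hterm i)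
    _ = k / (k + 1) * d := by
        simp [Finset.card_erase_of_mem]
        ring

/-- The tuples of diameter at most `d`. -/
def tuplesDiam (n k : ℕ) (d : ℝ) : Set (Fin k → Simp n) := {w | ∀ i j, dist (w i) (w j) ≤ d}

lemma cons_mem_tuplesDiam {n k : ℕ} {d : ℝ} (hd : 0 ≤ d) {b : Simp n} {u : Fin k → Simp n}
    (hu : u ∈ tuplesDiam n k d) (hb : ∀ j, dist (u j) b ≤ d) :
    (Fin.cons b u : Fin (k + 1) → Simp n) ∈ tuplesDiam n (k + 1) d := by
  intro i j
  cases i using Fin.cases <;> cases j using Fin.cases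
  · simpa using hd
  · simpa [dist_comm] using hb _
  · simpa using hb _
  · simpa using hu _ _

lemma sd_bd_single_mem_supported_range {n k : ℕ} (w : Fin (k + 1) → Simp n) :
    sd bary k (bd k (single w 1)) ∈ supported ℤ ℤ (tuplesIn (Set.range (affineSimplex w)) k) :=
  sd_mem_supported_tuplesIn (bary_mem_range_affineSimplex w) (bd_mem_supported_tuplesIn
    (single_mem_supported ℤ _ (self_mem_tuplesIn_range_affineSimplex w)))

lemma div_succ_le_div_succ {k N : ℕ} (h : k ≤ N) : (k : ℝ) / (k + 1) ≤ N / (N + 1) := by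
  have : (k : ℝ) ≤ N := by exact_mod_cast h
  rw [div_le_div_iff₀ (by positivity) (by positivity)]
  linarith

lemma sd_mem_supported_tuplesDiam {n N k : ℕ} (hk : k ≤ N + 1) {d : ℝ} (hd : 0 ≤ d)
    {c : TupleChain (Simp n) k} (hc : c ∈ supported ℤ ℤ (tuplesDiam n k d)) :
    sd bary k c ∈ supported ℤ ℤ (tuplesDiam n k (N / (N + 1) * d)) := by
  induction k with
  | zero =>
    have : tuplesDiam n 0 (N / (N + 1) * d) = Set.univ :=
      Set.eq_univ_of_forall fun w i => i.elim0
    rw [this, Finsupp.supported_univ]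
    trivial
  | succ k ih =>
    refine map_mem_supported _ (fun w hw => ?_) hc
    have hdiam : sd bary k (bd k (single w 1)) ∈
        supported ℤ ℤ (tuplesDiam n k (N / (N + 1) * d)) :=
      ih (by lia) (bd_mem_supported (P := tuplesDiam n (k + 1) d) (Q := tuplesDiam n k d)
        (fun w hw j i i' => hw _ _) (single_mem_supported ℤ _ hw))
    rw [sd_single]
    refine cone_mem_supported (P := tuplesDiam n k (N / (N + 1) * d) ∩
      tuplesIn (Set.range (affineSimplex w)) k) (fun u hu => ?_) ?_
    · refine cons_mem_tuplesDiam (by positivity) hu.1 fun j => ?_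
      obtain ⟨t, ht⟩ := hu.2 j
      rw [← ht]
      exact dist_affineSimplex_le w t _ fun i => (dist_bary_le w hw i).trans
        (mul_le_mul_of_nonneg_right (div_succ_le_div_succ (by lia)) hd)
    · rw [Finsupp.supported_inter]
      exact ⟨hdiam, sd_bd_single_mem_supported_range w⟩

lemma sd_pow_mem_supported_tuplesDiam {n k : ℕ} (m : ℕ) {d : ℝ} (hd : 0 ≤ d)
    {c : TupleChain (Simp n) (k + 1)} (hc : c ∈ supported ℤ ℤ (tuplesDiam n (k + 1) d)) :
    (sd bary (k + 1) ^ m) c ∈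
      supported ℤ ℤ (tuplesDiam n (k + 1) (((k : ℝ) / (k + 1)) ^ m * d)) := by
  induction m with
  | zero => simpa using hc
  | succ m ih =>
    rw [pow_succ' (sd bary (k + 1)), Module.End.mul_apply, pow_succ', mul_assoc]
    exact sd_mem_supported_tuplesDiam le_rfl (by positivity) ih

lemma exists_sd_pow_mem_supported_tuplesDiam_lt {n k : ℕ} {δ : ℝ} (hδ : 0 < δ)
    (c : TupleChain (Simp n) (k + 1)) :
    ∃ m, ∃ d < δ, (sd bary (k + 1) ^ m) c ∈ supported ℤ ℤ (tuplesDiam n (k + 1) d) := by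
  obtain ⟨d, hd⟩ := Metric.isBounded_iff.1 (isCompact_univ (X := Simp n)).isBounded
  have hc : c ∈ supported ℤ ℤ (tuplesDiam n (k + 1) (max d 0)) :=
    fun w _ i j => (hd (Set.mem_univ _) (Set.mem_univ _)).trans (le_max_left _ _)
  have hlt : (k : ℝ) / (k + 1) < 1 := by
    rw [div_lt_one (by positivity)]
    linarith
  have hlim : Filter.Tendsto (fun m : ℕ => ((k : ℝ) / (k + 1)) ^ m * max d 0) Filter.atTop
      (nhds 0) := by
    simpa using (tendsto_pow_atTop_nhds_zero_of_lt_one (by positivity) hlt).mul_const (max d 0)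
  obtain ⟨m, hm⟩ := (hlim.eventually_lt_const hδ).exists
  exact ⟨m, _, hm, sd_pow_mem_supported_tuplesDiam m (le_max_right _ _) hc⟩

/-! ### Singular cochains vanishing on small simplices -/

section Small

variable {A : Type u} [TopologicalSpace A] {ι : Type w} {W : ι → Set A}

/-- The affine simplices `w` in a standard simplex for which `s ∘ w` lies in a member of the
family `W`. -/
def smallTuples (W : ι → Set A) {n : ℕ} (s : C(Simp n, A)) (k : ℕ) : Set (Fin k → Simp n) :=
  {w | ∃ a, ∀ t, s (affineSimplex w t) ∈ W a}

lemma tuplesIn_range_subset_smallTuples {n : ℕ} {s : C(Simp n, A)} {k : ℕ} {w : Fin k → Simp n}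
    (hw : w ∈ smallTuples W s k) (l : ℕ) :
    tuplesIn (Set.range (affineSimplex w)) l ⊆ smallTuples W s l := by
  intro u hu
  obtain ⟨a, ha⟩ := hw
  obtain ⟨t, rfl⟩ := mem_tuplesIn_range_affineSimplex.1 hu
  refine ⟨a, fun x => ?_⟩
  rw [← affineSimplex_affineSimplex]
  exact ha _

lemma sd_mem_supported_smallTuples {n : ℕ} {s : C(Simp n, A)} {k : ℕ}
    {c : TupleChain (Simp n) k} (hc : c ∈ supported ℤ ℤ (smallTuples W s k)) :
    sd bary k c ∈ supported ℤ ℤ (smallTuples W s k) :=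
  map_mem_supported _ (fun w hw => Finsupp.supported_mono (tuplesIn_range_subset_smallTuples hw k)
    (sd_mem_supported_tuplesIn (bary_mem_range_affineSimplex w)
      (single_mem_supported ℤ _ (self_mem_tuplesIn_range_affineSimplex w)))) hc

lemma sdHomotopy_mem_supported_smallTuples {n : ℕ} {s : C(Simp n, A)} {k : ℕ}
    {c : TupleChain (Simp n) k} (hc : c ∈ supported ℤ ℤ (smallTuples W s k)) :
    sdHomotopy bary k c ∈ supported ℤ ℤ (smallTuples W s (k + 1)) :=
  map_mem_supported _ (fun w hw => Finsupp.supported_mono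
    (tuplesIn_range_subset_smallTuples hw (k + 1))
    (sdHomotopy_mem_supported_tuplesIn (bary_mem_range_affineSimplex w)
      (single_mem_supported ℤ _ (self_mem_tuplesIn_range_affineSimplex w)))) hc

lemma sd_pow_mem_supported_smallTuples {n : ℕ} {s : C(Simp n, A)} {k : ℕ}
    {c : TupleChain (Simp n) k} {m m' : ℕ} (hm : m ≤ m')
    (hc : (sd bary k ^ m) c ∈ supported ℤ ℤ (smallTuples W s k)) :
    (sd bary k ^ m') c ∈ supported ℤ ℤ (smallTuples W s k) := by
  induction m', hm using Nat.le_induction with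
  | base => exact hc
  | succ m' _ ih =>
    rw [pow_succ', Module.End.mul_apply]
    exact sd_mem_supported_smallTuples ih

lemma exists_sd_pow_mem_supported_smallTuples (hW : ∀ a, IsOpen (W a))
    (hcov : ∀ x, ∃ a, x ∈ W a) {n k : ℕ} (s : C(Simp n, A)) (c : TupleChain (Simp n) (k + 1)) :
    ∃ m, (sd bary (k + 1) ^ m) c ∈ supported ℤ ℤ (smallTuples W s (k + 1)) := by
  obtain ⟨δ, hδ, h⟩ := lebesgue_number_lemma_of_metric (isCompact_univ (X := Simp n))
    (c := fun a => s ⁻¹' W a) (fun a => (hW a).preimage s.continuous)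
    (fun x _ => Set.mem_iUnion.2 (hcov (s x)))
  obtain ⟨m, d, hd, hm⟩ := exists_sd_pow_mem_supported_tuplesDiam_lt hδ c
  refine ⟨m, Finsupp.supported_mono (fun w hw => ?_) hm⟩
  obtain ⟨a, ha⟩ := h (w 0) (Set.mem_univ _)
  exact ⟨a, fun t => ha ((dist_affineSimplex_le w t (w 0) fun i => hw i 0).trans_lt hd)⟩

/-- The fundamental chain of the standard simplex. -/
def fundamental (n : ℕ) : TupleChain (Simp n) n :=
  single (fun i => stdSimplex.vertex i) 1

/-- The inclusion of the `j`-th face of a standard simplex. -/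
def faceMap {n : ℕ} (j : Fin (n + 1)) : C(Simp n, Simp (n + 1)) :=
  affineSimplex fun i => stdSimplex.vertex (j.succAbove i)

lemma bd_fundamental (n : ℕ) :
    bd n (fundamental (n + 1)) =
      ∑ j : Fin (n + 1), (-1 : ℤ) ^ (j : ℕ) • push (faceMap j) n (fundamental n) := by
  rw [fundamental, bd_single]
  refine Finset.sum_congr rfl fun j _ => ?_
  rw [fundamental, push_single]
  congr 2
  funext i
  exact (affineSimplex_vertex _ i).symm

variable {G : Type v} [AddCommGroup G]

/-- The coboundary of a singular cochain. -/
def coboundary {n : ℕ} (φ : C(Simp n, A) → G) (s : C(Simp (n + 1), A)) : G :=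
  ∑ j : Fin (n + 1), (-1 : ℤ) ^ (j : ℕ) • φ (s.comp (faceMap j))

/-- The singular cochain `φ` vanishes on the simplices lying in a member of the family `W`. -/
def VanishesOnSmall (W : ι → Set A) {n : ℕ} (φ : C(Simp n, A) → G) : Prop :=
  ∀ s a, (∀ t, s t ∈ W a) → φ s = 0

/-- The value of a singular cochain on the image of a chain under a singular simplex. -/
def evalChain {n k : ℕ} (φ : C(Simp k, A) → G) (s : C(Simp n, A)) :
    TupleChain (Simp n) k →ₗ[ℤ] G :=
  Finsupp.linearCombination ℤ fun w => φ (s.comp (affineSimplex w))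

lemma evalChain_single {n k : ℕ} (φ : C(Simp k, A) → G) (s : C(Simp n, A)) (w : Fin k → Simp n) :
    evalChain φ s (single w 1) = φ (s.comp (affineSimplex w)) := by
  simp [evalChain]

lemma evalChain_zero {n k : ℕ} (s : C(Simp n, A)) :
    evalChain (0 : C(Simp k, A) → G) s = 0 :=
  linearMap_ext fun w => evalChain_single 0 s w

lemma evalChain_fundamental {n : ℕ} (φ : C(Simp n, A) → G) (s : C(Simp n, A)) :
    evalChain φ s (fundamental n) = φ s := by
  rw [fundamental, evalChain_single]
  congr 1
  ext t
  exact congrArg s (affineSimplex_vertices t)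

lemma evalChain_bd {n k : ℕ} (φ : C(Simp k, A) → G) (s : C(Simp n, A))
    (c : TupleChain (Simp n) (k + 1)) :
    evalChain φ s (bd k c) = evalChain (coboundary φ) s c := by
  suffices h : evalChain φ s ∘ₗ bd k = evalChain (coboundary φ) s from LinearMap.congr_fun h c
  refine linearMap_ext fun w => ?_
  simp only [LinearMap.comp_apply, evalChain_single, bd_single, map_sum, map_zsmul, coboundary]
  refine Finset.sum_congr rfl fun j _ => ?_
  congr 2
  ext t
  refine congrArg s (Eq.symm ((affineSimplex_affineSimplex _ _ t).trans ?_))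
  congr 2
  funext i
  exact affineSimplex_vertex _ _

lemma evalChain_push {n m k : ℕ} (φ : C(Simp k, A) → G) (s : C(Simp n, A)) (u : Fin m → Simp n)
    (c : TupleChain (Simp m) k) :
    evalChain φ s (push (affineSimplex u) k c) = evalChain φ (s.comp (affineSimplex u)) c := by
  suffices h : evalChain φ s ∘ₗ push (affineSimplex u) k = evalChain φ (s.comp (affineSimplex u))
    from LinearMap.congr_fun h c
  refine linearMap_ext fun w => ?_
  simp only [LinearMap.comp_apply, evalChain_single, push_single]
  congr 1
  ext t
  exact congrArg s (affineSimplex_affineSimplex _ _ t).symm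

lemma VanishesOnSmall.evalChain_eq_zero {n k : ℕ} {φ : C(Simp k, A) → G}
    (hφ : VanishesOnSmall W φ) {s : C(Simp n, A)} {c : TupleChain (Simp n) k}
    (hc : c ∈ supported ℤ ℤ (smallTuples W s k)) : evalChain φ s c = 0 := by
  rw [evalChain, Finsupp.linearCombination_apply]
  refine Finset.sum_eq_zero fun w hw => ?_
  obtain ⟨a, ha⟩ := (Finsupp.mem_supported ℤ c).1 hc hw
  exact (congrArg _ (hφ _ a ha)).trans (smul_zero _)

/-- The homotopy operator on cochains dual to `sdPowHomotopy`, with `m` subdivisions. -/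
def sdCochainHomotopy (m : ℕ) {n : ℕ} (φ : C(Simp (n + 1), A) → G) (s : C(Simp n, A)) : G :=
  evalChain φ s (sdPowHomotopy bary m n (fundamental n))

lemma sdCochainHomotopy_eq_sum (m : ℕ) {n : ℕ} (φ : C(Simp (n + 1), A) → G) (s : C(Simp n, A)) :
    sdCochainHomotopy m φ s = ∑ i ∈ Finset.range m,
      evalChain φ s (sdHomotopy bary n ((sd bary n ^ i) (fundamental n))) := by
  rw [sdCochainHomotopy, sdPowHomotopy_apply, map_sum]

lemma VanishesOnSmall.sdCochainHomotopy_stable {n : ℕ} {φ : C(Simp (n + 1), A) → G}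
    (hφ : VanishesOnSmall W φ) {s : C(Simp n, A)} {m m' : ℕ} (hm : m ≤ m')
    (hs : (sd bary n ^ m) (fundamental n) ∈ supported ℤ ℤ (smallTuples W s n)) :
    sdCochainHomotopy m φ s = sdCochainHomotopy m' φ s := by
  rw [sdCochainHomotopy_eq_sum, sdCochainHomotopy_eq_sum]
  refine Finset.sum_subset (Finset.range_mono hm) fun i _ hi => hφ.evalChain_eq_zero ?_
  exact sdHomotopy_mem_supported_smallTuples
    (sd_pow_mem_supported_smallTuples (not_lt.1 fun h => hi (Finset.mem_range.2 h)) hs)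

lemma coboundary_sdCochainHomotopy (m : ℕ) {n : ℕ} (φ : C(Simp (n + 1), A) → G)
    (s : C(Simp (n + 1), A)) :
    coboundary (sdCochainHomotopy m φ) s =
      evalChain φ s (sdPowHomotopy bary m n (bd n (fundamental (n + 1)))) := by
  simp only [coboundary, sdCochainHomotopy, bd_fundamental, map_sum, map_zsmul]
  refine Finset.sum_congr rfl fun j _ => ?_
  rw [faceMap, ← push_sdPowHomotopy fun k w => affineSimplex_bary _ k w, evalChain_push]

lemma VanishesOnSmall.coboundary_sdCochainHomotopy {n : ℕ} {φ : C(Simp (n + 1), A) → G}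
    (hφ : VanishesOnSmall W φ) (hd : coboundary φ = 0) {s : C(Simp (n + 1), A)} {m : ℕ}
    (hs : (sd bary (n + 1) ^ m) (fundamental (n + 1)) ∈ supported ℤ ℤ (smallTuples W s (n + 1))) :
    coboundary (sdCochainHomotopy m φ) s = φ s := by
  have h := congrArg (evalChain φ s) (bd_sdPowHomotopy_add bary n m (fundamental (n + 1)))
  rwa [map_add, map_sub, evalChain_bd, hd, evalChain_zero, LinearMap.zero_apply, zero_add,
    evalChain_fundamental, hφ.evalChain_eq_zero hs, sub_zero,
    ← PersistentLeray.coboundary_sdCochainHomotopy] at h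

/-- The number of subdivisions depends on the simplex, so the primitive is the sum of the
homotopies over all subdivisions, which is locally finite because its terms vanish eventually. -/
theorem VanishesOnSmall.exists_coboundary_eq (hW : ∀ a, IsOpen (W a))
    (hcov : ∀ x, ∃ a, x ∈ W a) {n : ℕ} {φ : C(Simp (n + 2), A) → G}
    (hφ : VanishesOnSmall W φ) (hd : coboundary φ = 0) :
    ∃ ψ : C(Simp (n + 1), A) → G, VanishesOnSmall W ψ ∧ coboundary ψ = φ := by
  choose m hm using fun s : C(Simp (n + 1), A) =>
    exists_sd_pow_mem_supported_smallTuples hW hcov s (fundamental (n + 1))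
  refine ⟨fun s => sdCochainHomotopy (m s) φ s, fun s a hs => ?_, funext fun s => ?_⟩
  · have hsmall : (sd bary (n + 1) ^ 0) (fundamental (n + 1)) ∈
        supported ℤ ℤ (smallTuples W s (n + 1)) :=
      single_mem_supported ℤ _ ⟨a, fun t => hs _⟩
    exact (hφ.sdCochainHomotopy_stable (Nat.zero_le (m s)) hsmall).symm.trans
      (sdCochainHomotopy_eq_sum 0 φ s)
  · obtain ⟨m', hm'⟩ := exists_sd_pow_mem_supported_smallTuples hW hcov s (fundamental (n + 2))
    let M := m' + ∑ j, m (s.comp (faceMap j))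
    have hM (j) : m (s.comp (faceMap j)) ≤ M :=
      (Finset.single_le_sum (f := fun j => m (s.comp (faceMap j))) (fun _ _ => Nat.zero_le _)
        (Finset.mem_univ j)).trans (Nat.le_add_left _ _)
    rw [← hφ.coboundary_sdCochainHomotopy hd
      (sd_pow_mem_supported_smallTuples (Nat.le_add_right m' _ : m' ≤ M) hm')]
    exact Finset.sum_congr rfl fun j _ => congrArg _ (hφ.sdCochainHomotopy_stable (hM j) (hm _))

end Small

end Chains

/-! ### Graded modules -/

section Grading

variable {ι M M' : Type*} [DecidableEq ι] [AddCommGroup M] [AddCommGroup M']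
  {gr : ι → AddSubgroup M} {gr' : ι → AddSubgroup M'}

lemma isInternal_of_sum
    (hspan : ∀ x, ∃ (s : Finset ι) (g : ι → M), (∀ i, g i ∈ gr i) ∧ x = ∑ i ∈ s, g i)
    (hind : ∀ (s : Finset ι) (g : ι → M), (∀ i, g i ∈ gr i) → ∑ i ∈ s, g i = 0 →
      ∀ i ∈ s, g i = 0) : DirectSum.IsInternal gr := by
  classical
  constructor
  · rw [injective_iff_map_eq_zero]
    intro f hf
    rw [DirectSum.coeAddMonoidHom_eq_dfinsuppSum, DFinsupp.sum] at hf
    refine DFinsupp.ext fun i => Subtype.ext ?_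
    by_cases hi : i ∈ DFinsupp.support f
    · exact hind _ (fun i => (f i : M)) (fun i => (f i).2) hf i hi
    · exact congrArg Subtype.val (DFinsupp.notMem_support_iff.1 hi)
  · intro x
    obtain ⟨s, g, hg, rfl⟩ := hspan x
    exact ⟨∑ i ∈ s, DirectSum.of (fun i => gr i) i ⟨g i, hg i⟩, by simp⟩

/-- The projection of an internally graded group to its part of degree `i`. -/
def gproj (h : DirectSum.IsInternal gr) (i : ι) : M →+ M :=
  letI := h.chooseDecomposition
  (gr i).subtype.comp ((DFinsupp.evalAddMonoidHom i).comp
    (DirectSum.decomposeAddEquiv gr).toAddMonoidHom)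

variable (h : DirectSum.IsInternal gr) (h' : DirectSum.IsInternal gr')

lemma gproj_mem (i : ι) (x : M) : gproj h i x ∈ gr i := SetLike.coe_mem _

lemma gproj_of_mem {i : ι} {x : M} (hx : x ∈ gr i) : gproj h i x = x :=
  letI := h.chooseDecomposition
  DirectSum.decompose_of_mem_same gr hx

lemma gproj_of_mem_of_ne {i j : ι} (hij : i ≠ j) {x : M} (hx : x ∈ gr j) : gproj h i x = 0 :=
  letI := h.chooseDecomposition
  DirectSum.decompose_of_mem_ne gr hx hij.symm

lemma gproj_sum {s : Finset ι} {g : ι → M} (hg : ∀ i, g i ∈ gr i) {i : ι} (hi : i ∈ s) :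
    gproj h i (∑ j ∈ s, g j) = g i := by
  rw [map_sum, Finset.sum_eq_single_of_mem i hi fun j _ hj => gproj_of_mem_of_ne h hj.symm (hg j),
    gproj_of_mem h (hg i)]

lemma exists_forall_eq_sum_gproj (x : M) :
    ∃ s : Finset ι, ∀ s', s ⊆ s' → x = ∑ i ∈ s', gproj h i x := by
  classical
  let _ := h.chooseDecomposition
  refine ⟨DFinsupp.support (DirectSum.decompose gr x), fun s' hs' => ?_⟩
  have hzero (i) (hi : i ∉ DFinsupp.support (DirectSum.decompose gr x)) : gproj h i x = 0 := by
    change ((DirectSum.decompose gr x i : gr i) : M) = 0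
    rw [DFinsupp.notMem_support_iff.1 hi, ZeroMemClass.coe_zero]
  rw [← Finset.sum_subset hs' fun i _ hi => hzero i hi]
  exact (DirectSum.sum_support_decompose gr x).symm

lemma exists_mem_eq_sum_gproj (i : ι) (x : M) :
    ∃ s : Finset ι, i ∈ s ∧ x = ∑ j ∈ s, gproj h j x := by
  obtain ⟨s, hs⟩ := exists_forall_eq_sum_gproj h x
  exact ⟨insert i s, Finset.mem_insert_self i s, hs _ (Finset.subset_insert i s)⟩

lemma map_gproj (φ : M →+ M') (hφ : ∀ i, ∀ x ∈ gr i, φ x ∈ gr' i) (i : ι) (x : M) :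
    φ (gproj h i x) = gproj h' i (φ x) := by
  obtain ⟨s, hi, hs⟩ := exists_mem_eq_sum_gproj h i x
  conv_rhs => rw [hs, map_sum]
  rw [gproj_sum h' (fun j => hφ j _ (gproj_mem h j x)) hi]

variable {S : Type*} [Ring S] [Module S M] [Module S M']

/-- A submodule of a graded module is homogeneous if it contains the homogeneous components of its
elements. -/
def IsHomogeneousSub (N : Submodule S M) : Prop :=
  ∀ i, ∀ x ∈ N, gproj h i x ∈ N

variable {h h'} {N N' : Submodule S M}

lemma IsHomogeneousSub.sup (hN : IsHomogeneousSub h N) (hN' : IsHomogeneousSub h N') :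
    IsHomogeneousSub h (N ⊔ N') := by
  intro i x hx
  obtain ⟨a, ha, b, hb, rfl⟩ := Submodule.mem_sup.1 hx
  rw [map_add]
  exact Submodule.add_mem_sup (hN i a ha) (hN' i b hb)

lemma IsHomogeneousSub.inf (hN : IsHomogeneousSub h N) (hN' : IsHomogeneousSub h N') :
    IsHomogeneousSub h (N ⊓ N') :=
  fun i x hx => ⟨hN i x hx.1, hN' i x hx.2⟩

lemma IsHomogeneousSub.map (hN : IsHomogeneousSub h N) {φ : M →ₗ[S] M'}
    (hφ : ∀ i, ∀ x ∈ gr i, φ x ∈ gr' i) : IsHomogeneousSub h' (N.map φ) := by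
  rintro i _ ⟨x, hx, rfl⟩
  exact ⟨gproj h i x, hN i x hx, map_gproj h h' φ.toAddMonoidHom hφ i x⟩

lemma IsHomogeneousSub.comap {N : Submodule S M'} (hN : IsHomogeneousSub h' N) {φ : M →ₗ[S] M'}
    (hφ : ∀ i, ∀ x ∈ gr i, φ x ∈ gr' i) : IsHomogeneousSub h (N.comap φ) := fun i x hx =>
  (congrArg (· ∈ N) (map_gproj h h' φ.toAddMonoidHom hφ i x)).mpr (hN i _ hx)

lemma isHomogeneousSub_ker {φ : M →ₗ[S] M'} (h : DirectSum.IsInternal gr)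
    (h' : DirectSum.IsInternal gr') (hφ : ∀ i, ∀ x ∈ gr i, φ x ∈ gr' i) :
    IsHomogeneousSub h (LinearMap.ker φ) := by
  have hbot : IsHomogeneousSub h' (⊥ : Submodule S M') := fun i x hx => by
    rw [(Submodule.mem_bot S).1 hx, map_zero]
    exact zero_mem _
  exact hbot.comap hφ

lemma IsHomogeneousSub.toAddSubgroup_eq (hN : IsHomogeneousSub h N) :
    N.toAddSubgroup = ⨆ i, N.toAddSubgroup ⊓ gr i := by
  refine le_antisymm (fun x hx => ?_) (iSup_le fun i => inf_le_left)
  obtain ⟨s, hs⟩ := exists_forall_eq_sum_gproj h x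
  rw [hs s subset_rfl]
  exact sum_mem fun i _ => AddSubgroup.mem_iSup_of_mem i ⟨hN i x hx, gproj_mem h i x⟩

end Grading

/-! ### Presentations of graded modules by linear relations -/

section Presentation

variable {ι S M N N' : Type*} [Ring S] [AddCommGroup M] [Module S M] [AddCommGroup N] [Module S N]
  [AddCommGroup N'] [Module S N'] {gr : ι → AddSubgroup M} {grN : ι → AddSubgroup N}
  {grN' : ι → AddSubgroup N'} {G : Submodule S (M × N)} {G' : Submodule S (M × N')}

/-- The linear relation `G`, read as: `x : M` represents `n : N`, exhibits the graded module `N` as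
a subquotient of the graded module `M`: the submodule of all representatives modulo the submodule
of representatives of `0`. -/
structure IsPresentation (gr : ι → AddSubgroup M) (grN : ι → AddSubgroup N)
    (G : Submodule S (M × N)) : Prop where
  exists_rep (n : N) : ∃ x, (x, n) ∈ G
  eq_zero {n : N} (hn : (0, n) ∈ G) : n = 0
  mem_gr_iff {i : ι} {n : N} : n ∈ grN i ↔ ∃ x ∈ gr i, (x, n) ∈ G

lemma IsPresentation.eq_of_mem (hG : IsPresentation gr grN G) {x : M} {n n' : N}
    (h : (x, n) ∈ G) (h' : (x, n') ∈ G) : n = n' :=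
  sub_eq_zero.1 (hG.eq_zero (by simpa using sub_mem h h'))

/-- The linear relation `G` exhibits the graded module `N` as the subquotient `Z / B` of the graded
module `M`. -/
structure IsSubquotientRel (Z B : Submodule S M) (gr : ι → AddSubgroup M) (grN : ι → AddSubgroup N)
    (G : Submodule S (M × N)) : Prop extends IsPresentation gr grN G where
  exists_mem_iff {x : M} : (∃ n, (x, n) ∈ G) ↔ x ∈ Z
  mem_zero_iff {x : M} : (x, 0) ∈ G ↔ x ∈ B

lemma sum_mk_mem {α : Type*} {s : Finset α} {x : α → M} {n : α → N}
    (h : ∀ a ∈ s, (x a, n a) ∈ G) : (∑ a ∈ s, x a, ∑ a ∈ s, n a) ∈ G := by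
  have hsum : ∑ a ∈ s, (x a, n a) = (∑ a ∈ s, x a, ∑ a ∈ s, n a) := by
    ext <;> simp only [Prod.fst_sum, Prod.snd_sum]
  exact hsum ▸ sum_mem h

lemma exists_linearMap_of_rel (htotal : ∀ x, ∃ n, (x, n) ∈ G) (hzero : ∀ n, (0, n) ∈ G → n = 0) :
    ∃ θ : M →ₗ[S] N, ∀ x, (x, θ x) ∈ G := by
  choose θ hθ using htotal
  have huniq {x : M} {n n' : N} (h : (x, n) ∈ G) (h' : (x, n') ∈ G) : n = n' :=
    sub_eq_zero.1 (hzero _ (by simpa using sub_mem h h'))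
  exact ⟨{ toFun := θ
           map_add' := fun x y => huniq (hθ (x + y)) (add_mem (hθ x) (hθ y))
           map_smul' := fun a x => huniq (hθ (a • x)) (G.smul_mem a (hθ x)) }, hθ⟩

lemma IsPresentation.exists_linearMap (hG : IsPresentation gr grN G)
    (hG' : IsPresentation gr grN' G') (hdom : ∀ x, (∃ n, (x, n) ∈ G) → ∃ n, (x, n) ∈ G')
    (hker : ∀ x, (x, 0) ∈ G → (x, 0) ∈ G') :
    ∃ θ : N →ₗ[S] N', ∀ x n, (x, n) ∈ G → (x, θ n) ∈ G' := by
  let H : Submodule S (N × N') :=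
    (G.comap (LinearMap.prodMap LinearMap.id (LinearMap.fst S N N')) ⊓
      G'.comap (LinearMap.prodMap LinearMap.id (LinearMap.snd S N N'))).map
        (LinearMap.snd S M (N × N'))
  have mem_H {n n'} : (n, n') ∈ H ↔ ∃ x, (x, n) ∈ G ∧ (x, n') ∈ G' := by
    simp [H]
  obtain ⟨θ, hθ⟩ := exists_linearMap_of_rel (G := H)
    (fun n => by
      obtain ⟨x, hx⟩ := hG.exists_rep n
      obtain ⟨n', hn'⟩ := hdom x ⟨n, hx⟩
      exact ⟨n', mem_H.2 ⟨x, hx, hn'⟩⟩)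
    (fun n' hn' => by
      obtain ⟨x, hx, hx'⟩ := mem_H.1 hn'
      exact hG'.eq_of_mem hx' (hker x hx))
  refine ⟨θ, fun x n hx => ?_⟩
  obtain ⟨y, hy, hy'⟩ := mem_H.1 (hθ n)
  have hxy : (x - y, 0) ∈ G' := hker _ (by simpa using sub_mem hx hy)
  simpa using add_mem hxy hy'

theorem IsPresentation.exists_equiv (hG : IsPresentation gr grN G)
    (hG' : IsPresentation gr grN' G') (hdom : ∀ x, (∃ n, (x, n) ∈ G) ↔ ∃ n, (x, n) ∈ G')
    (hker : ∀ x, (x, 0) ∈ G ↔ (x, 0) ∈ G') :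
    ∃ e : N ≃ₗ[S] N', ∀ i, (grN i).map e.toLinearMap.toAddMonoidHom = grN' i := by
  obtain ⟨θ, hθ⟩ := hG.exists_linearMap hG' (fun x => (hdom x).1) fun x => (hker x).1
  obtain ⟨θ', hθ'⟩ := hG'.exists_linearMap hG (fun x => (hdom x).2) fun x => (hker x).2
  have hθθ' (n) : θ (θ' n) = n := by
    obtain ⟨x, hx⟩ := hG'.exists_rep n
    exact hG'.eq_of_mem (hθ _ _ (hθ' _ _ hx)) hx
  have hθ'θ (n) : θ' (θ n) = n := by
    obtain ⟨x, hx⟩ := hG.exists_rep n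
    exact hG.eq_of_mem (hθ' _ _ (hθ _ _ hx)) hx
  refine ⟨LinearEquiv.ofLinearMap θ θ' (LinearMap.ext hθθ') (LinearMap.ext hθ'θ),
    fun i => le_antisymm ?_ fun n hn => ?_⟩
  · rintro _ ⟨n, hn, rfl⟩
    obtain ⟨x, hxi, hx⟩ := hG.mem_gr_iff.1 hn
    exact hG'.mem_gr_iff.2 ⟨x, hxi, hθ _ _ hx⟩
  · obtain ⟨x, hxi, hx⟩ := hG'.mem_gr_iff.1 hn
    exact ⟨θ' n, hG.mem_gr_iff.2 ⟨x, hxi, hθ' _ _ hx⟩, hθθ' n⟩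

variable [DecidableEq ι]

lemma IsPresentation.gproj_mem (hG : IsPresentation gr grN G) (h : DirectSum.IsInternal gr)
    (hN : DirectSum.IsInternal grN)
    (hdom : ∀ i x n, (x, n) ∈ G → ∃ n', (gproj h i x, n') ∈ G)
    (i : ι) {x : M} {n : N} (hx : (x, n) ∈ G) : (gproj h i x, gproj hN i n) ∈ G := by
  choose n' hn' using fun j => hdom j x n hx
  obtain ⟨s, hi, hs⟩ := exists_mem_eq_sum_gproj h i x
  have hsum : (x, ∑ j ∈ s, n' j) ∈ G := by
    have := sum_mk_mem fun j (_ : j ∈ s) => hn' j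
    rwa [← hs] at this
  rw [hG.eq_of_mem hx hsum,
    gproj_sum hN (fun j => hG.mem_gr_iff.2 ⟨_, PersistentLeray.gproj_mem h j x, hn' j⟩) hi]
  exact hn' i

lemma isPresentation_of_gproj_mem (h : DirectSum.IsInternal gr) (hN : DirectSum.IsInternal grN)
    (hrep : ∀ n, ∃ x, (x, n) ∈ G) (hzero : ∀ n, (0, n) ∈ G → n = 0)
    (hgproj : ∀ i x n, (x, n) ∈ G → (gproj h i x, gproj hN i n) ∈ G) :
    IsPresentation gr grN G where
  exists_rep := hrep
  eq_zero := hzero _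
  mem_gr_iff {i n} := by
    constructor
    · intro hn
      obtain ⟨x, hx⟩ := hrep n
      exact ⟨gproj h i x, gproj_mem h i x, by simpa only [gproj_of_mem hN hn] using hgproj i x n hx⟩
    · rintro ⟨x, hxi, hx⟩
      have hx' := hgproj i x n hx
      rw [gproj_of_mem h hxi] at hx'
      have hn : n = gproj hN i n := sub_eq_zero.1 (hzero _ (by simpa using sub_mem hx hx'))
      exact hn ▸ gproj_mem hN i n

end Presentation

section Subquotient

variable {ι S M : Type*} [Ring S] [AddCommGroup M] [Module S M] {gr : ι → AddSubgroup M}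
  {Z B : Submodule S M}

/-- The grading induced on the subquotient `Z / (Z ∩ B)`. -/
def subquotGrading (gr : ι → AddSubgroup M) (Z B : Submodule S M) (i : ι) :
    AddSubgroup (Z ⧸ B.submoduleOf Z) :=
  ((gr i).comap Z.subtype.toAddMonoidHom).map (B.submoduleOf Z).mkQ.toAddMonoidHom

/-- The relation between the elements of `Z` and their classes in `Z / (Z ∩ B)`. -/
def subquotRel (Z B : Submodule S M) : Submodule S (M × (Z ⧸ B.submoduleOf Z)) :=
  LinearMap.range (Z.subtype.prod (B.submoduleOf Z).mkQ)

lemma mem_subquotRel {x : M} {y : Z ⧸ B.submoduleOf Z} :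
    (x, y) ∈ subquotRel Z B ↔ ∃ hx : x ∈ Z, (B.submoduleOf Z).mkQ ⟨x, hx⟩ = y := by
  simp [subquotRel]

lemma exists_mem_subquotRel_iff {x : M} : (∃ y, (x, y) ∈ subquotRel Z B) ↔ x ∈ Z :=
  ⟨fun ⟨_, h⟩ => (mem_subquotRel.1 h).1, fun hx => ⟨_, mem_subquotRel.2 ⟨hx, rfl⟩⟩⟩

lemma mkQ_submoduleOf_eq_zero {z : Z} : (B.submoduleOf Z).mkQ z = 0 ↔ (z : M) ∈ B := by
  rw [Submodule.mkQ_apply, Submodule.Quotient.mk_eq_zero]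
  rfl

lemma isPresentation_subquotRel : IsPresentation gr (subquotGrading gr Z B) (subquotRel Z B) where
  exists_rep y := by
    obtain ⟨z, rfl⟩ := Submodule.mkQ_surjective _ y
    exact ⟨z, mem_subquotRel.2 ⟨z.2, rfl⟩⟩
  eq_zero hy := by
    obtain ⟨h0, rfl⟩ := mem_subquotRel.1 hy
    exact map_zero _
  mem_gr_iff {i y} := by
    constructor
    · rintro ⟨z, hz, rfl⟩
      exact ⟨z, hz, mem_subquotRel.2 ⟨z.2, rfl⟩⟩
    · rintro ⟨x, hxi, hx⟩
      obtain ⟨hxZ, rfl⟩ := mem_subquotRel.1 hx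
      exact ⟨⟨x, hxZ⟩, hxi, rfl⟩

variable [DecidableEq ι] {h : DirectSum.IsInternal gr}

lemma isInternal_subquotGrading (hZ : IsHomogeneousSub h Z) (hB : IsHomogeneousSub h B) :
    DirectSum.IsInternal (subquotGrading gr Z B) := by
  refine isInternal_of_sum (fun x => ?_) fun s g hg hsum i hi => ?_
  · obtain ⟨z, rfl⟩ := Submodule.mkQ_surjective _ x
    obtain ⟨s, hs⟩ := exists_forall_eq_sum_gproj h (z : M)
    refine ⟨s, fun i => (B.submoduleOf Z).mkQ ⟨gproj h i z, hZ i _ z.2⟩,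
      fun i => ⟨_, gproj_mem h i z, rfl⟩, ?_⟩
    rw [← map_sum]
    refine congrArg _ (Subtype.ext ?_)
    rw [AddSubmonoidClass.coe_finsetSum]
    exact hs s subset_rfl
  · choose z hz hzg using hg
    have hmk (i : ι) : (B.submoduleOf Z).mkQ (z i) = g i := hzg i
    simp only [← hmk] at hsum ⊢
    rw [← map_sum, mkQ_submoduleOf_eq_zero, AddSubmonoidClass.coe_finsetSum] at hsum
    rw [mkQ_submoduleOf_eq_zero]
    have := hB i _ hsum
    rwa [gproj_sum h (g := fun i => (z i : M)) hz hi] at this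

lemma gproj_mem_subquotRel (hZ : IsHomogeneousSub h Z) (hB : IsHomogeneousSub h B) (i : ι) {x : M}
    {y : Z ⧸ B.submoduleOf Z} (hxy : (x, y) ∈ subquotRel Z B) :
    (gproj h i x, gproj (isInternal_subquotGrading hZ hB) i y) ∈ subquotRel Z B :=
  isPresentation_subquotRel.gproj_mem h _
    (fun j x _ hx => ⟨_, mem_subquotRel.2 ⟨hZ j x (mem_subquotRel.1 hx).1, rfl⟩⟩) i hxy

end Subquotient

section RelImage

variable {ι S M N : Type*} [Ring S] [AddCommGroup M] [Module S M] [AddCommGroup N] [Module S N]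
  {gr : ι → AddSubgroup M} {grN : ι → AddSubgroup N} {G : Submodule S (M × N)}
  {F F' : Submodule S M}

/-- The image of the submodule `F` of `M` under the linear relation `G`. -/
def relImage (G : Submodule S (M × N)) (F : Submodule S M) : Submodule S N :=
  (G ⊓ F.prod ⊤).map (LinearMap.snd S M N)

lemma mem_relImage {n : N} : n ∈ relImage G F ↔ ∃ x ∈ F, (x, n) ∈ G := by
  simp [relImage, and_comm]

/-- The relation induced by `G` between elements of `F` and the subquotient of `N` given by the
images of `F` and `F'`. -/
def relImageSubquotRel (G : Submodule S (M × N)) (F F' : Submodule S M) :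
    Submodule S (M × (relImage G F ⧸ (relImage G F').submoduleOf (relImage G F))) where
  carrier := {w | w.1 ∈ F ∧
    ∃ n, (w.1, n) ∈ G ∧ (n, w.2) ∈ subquotRel (relImage G F) (relImage G F')}
  zero_mem' := ⟨zero_mem _, 0, zero_mem _, zero_mem _⟩
  add_mem' := fun ⟨hx, _, hn, hy⟩ ⟨hx', _, hn', hy'⟩ =>
    ⟨add_mem hx hx', _, add_mem hn hn', add_mem hy hy'⟩
  smul_mem' := fun a _ ⟨hx, _, hn, hy⟩ =>
    ⟨F.smul_mem a hx, _, G.smul_mem a hn, Submodule.smul_mem _ a hy⟩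

lemma exists_mem_relImageSubquotRel_iff {x : M} :
    (∃ y, (x, y) ∈ relImageSubquotRel G F F') ↔ x ∈ F ∧ ∃ n, (x, n) ∈ G :=
  ⟨fun ⟨_, hx, n, hn, _⟩ => ⟨hx, n, hn⟩, fun ⟨hx, n, hn⟩ =>
    ⟨_, hx, n, hn, mem_subquotRel.2 ⟨mem_relImage.2 ⟨x, hx, hn⟩, rfl⟩⟩⟩

lemma mem_relImageSubquotRel_zero_iff {x : M} :
    (x, 0) ∈ relImageSubquotRel G F F' ↔
      x ∈ F ∧ ∃ x' ∈ F', (∃ n, (x', n) ∈ G) ∧ (x - x', 0) ∈ G := by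
  constructor
  · rintro ⟨hx, n, hn, hy⟩
    obtain ⟨hnF, h0⟩ := mem_subquotRel.1 hy
    obtain ⟨x', hx', hn'⟩ := mem_relImage.1 (mkQ_submoduleOf_eq_zero.1 h0)
    exact ⟨hx, x', hx', ⟨n, hn'⟩, by simpa using sub_mem hn hn'⟩
  · rintro ⟨hx, x', hx', ⟨n, hn⟩, h0⟩
    have hxn : (x, n) ∈ G := by simpa using add_mem h0 hn
    exact ⟨hx, n, hxn, mem_subquotRel.2 ⟨mem_relImage.2 ⟨x, hx, hxn⟩,
      mkQ_submoduleOf_eq_zero.2 (mem_relImage.2 ⟨x', hx', hn⟩)⟩⟩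

variable [DecidableEq ι] {h : DirectSum.IsInternal gr} {hN : DirectSum.IsInternal grN}

lemma isHomogeneousSub_relImage
    (hG : ∀ i x n, (x, n) ∈ G → (gproj h i x, gproj hN i n) ∈ G) (hF : IsHomogeneousSub h F) :
    IsHomogeneousSub hN (relImage G F) := by
  intro i n hn
  obtain ⟨x, hx, hxn⟩ := mem_relImage.1 hn
  exact mem_relImage.2 ⟨_, hF i x hx, hG i x n hxn⟩

lemma isPresentation_relImageSubquotRel
    (hG : ∀ i x n, (x, n) ∈ G → (gproj h i x, gproj hN i n) ∈ G)
    (hzero : ∀ n, (0, n) ∈ G → n = 0) (hF : IsHomogeneousSub h F) (hF' : IsHomogeneousSub h F') :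
    IsPresentation gr (subquotGrading grN (relImage G F) (relImage G F'))
      (relImageSubquotRel G F F') := by
  have hFN := isHomogeneousSub_relImage hG hF
  have hFN' := isHomogeneousSub_relImage hG hF'
  refine isPresentation_of_gproj_mem h (isInternal_subquotGrading hFN hFN') (fun y => ?_) ?_ ?_
  · obtain ⟨n, hy⟩ := (isPresentation_subquotRel (gr := grN)).exists_rep y
    obtain ⟨x, hx, hxn⟩ := mem_relImage.1 (mem_subquotRel.1 hy).1
    exact ⟨x, hx, n, hxn, hy⟩
  · rintro y ⟨-, n, hn, hy⟩
    rw [hzero n hn] at hy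
    exact (isPresentation_subquotRel (gr := grN)).eq_zero hy
  · rintro i x y ⟨hx, n, hn, hy⟩
    exact ⟨hF i x hx, _, hG i x n hn, gproj_mem_subquotRel hFN hFN' i hy⟩

end RelImage

lemma isGrading_subquotGrading {R : Type v} [CommRing R] {M : Type*} [AddCommGroup M]
    [Module R[X] M] {gr : ℤ → AddSubgroup M} (h : IsGrading (R := R) gr) {Z B : Submodule R[X] M}
    (hZ : IsHomogeneousSub h.isInternal Z) (hB : IsHomogeneousSub h.isInternal B) :
    IsGrading (R := R) (subquotGrading gr Z B) where
  isInternal := isInternal_subquotGrading hZ hB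
  C_smul_mem := by
    rintro a i _ ⟨z, hz, rfl⟩
    exact ⟨C a • z, h.C_smul_mem a i _ hz, map_smul (B.submoduleOf Z).mkQ _ _⟩
  X_smul_mem := by
    rintro i _ ⟨z, hz, rfl⟩
    exact ⟨(X : R[X]) • z, h.X_smul_mem i _ hz, map_smul (B.submoduleOf Z).mkQ _ _⟩

/-! ### Classes of cycles -/

section Homology

variable {S : Type v} [Ring S] {κ : Type*} {c : ComplexShape κ}
  {K L : HomologicalComplex (ModuleCat.{w} S) c} {k : κ}

lemma iCycles_injective : Function.Injective (K.iCycles k).hom :=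
  (ModuleCat.mono_iff_injective _).1 inferInstance

lemma exists_iCycles_eq {x : K.X k} (hx : ∀ l, (K.d k l).hom x = 0) :
    ∃ y : K.cycles k, (K.iCycles k).hom y = x := by
  have hx' : (K.sc k).g.hom x = 0 := hx _
  refine ⟨(K.sc k).moduleCatCyclesIso.inv.hom ⟨x, hx'⟩, ?_⟩
  exact congrArg (fun g => g.hom ⟨x, hx'⟩) (K.sc k).moduleCatCyclesIso_inv_iCycles

lemma homologyπ_eq_zero_iff (y : K.cycles k) :
    (K.homologyπ k).hom y = 0 ↔ ∃ j x, (K.d j k).hom x = (K.iCycles k).hom y := by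
  constructor
  · intro h
    have hex : (ShortComplex.mk (K.toCycles (c.prev k) k) (K.homologyπ k) (by simp)).Exact :=
      ShortComplex.exact_of_g_is_cokernel _ (K.homologyIsCokernel _ k rfl)
    obtain ⟨x, rfl⟩ := (ShortComplex.moduleCat_exact_iff _).1 hex y h
    exact ⟨_, x, (congrArg (fun g => g.hom x) (K.toCycles_i (c.prev k) k)).symm⟩
  · rintro ⟨j, x, hx⟩
    have hy : (K.toCycles j k).hom x = y := iCycles_injective
      ((congrArg (fun g => g.hom x) (K.toCycles_i j k)).trans hx)
    rw [← hy]
    exact congrArg (fun g => g.hom x) (K.toCycles_comp_homologyπ j k)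

variable (K k) in
/-- The relation between the cycles of a complex and their classes in its homology. -/
def classRel : Submodule S (K.X k × K.homology k) :=
  LinearMap.range ((K.iCycles k).hom.prod (K.homologyπ k).hom)

lemma mem_classRel {z : K.X k} {h : K.homology k} :
    (z, h) ∈ classRel K k ↔ ∃ y, (K.iCycles k).hom y = z ∧ (K.homologyπ k).hom y = h := by
  simp [classRel]

lemma d_eq_zero_of_mem_classRel {z : K.X k} {h : K.homology k} (hz : (z, h) ∈ classRel K k)
    (l : κ) : (K.d k l).hom z = 0 := by
  obtain ⟨y, rfl, -⟩ := mem_classRel.1 hz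
  exact congrArg (fun g => g.hom y) (K.iCycles_d k l)

lemma exists_mem_classRel_iff {z : K.X k} :
    (∃ h, (z, h) ∈ classRel K k) ↔ ∀ l, (K.d k l).hom z = 0 := by
  refine ⟨fun ⟨h, hz⟩ => d_eq_zero_of_mem_classRel hz, fun hz => ?_⟩
  obtain ⟨y, rfl⟩ := exists_iCycles_eq hz
  exact ⟨_, y, rfl⟩

lemma mem_classRel_zero_iff {z : K.X k} :
    (z, 0) ∈ classRel K k ↔ ∃ j x, (K.d j k).hom x = z := by
  constructor
  · intro hz
    obtain ⟨y, rfl, hy⟩ := mem_classRel.1 hz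
    exact (homologyπ_eq_zero_iff y).1 hy
  · rintro ⟨j, x, rfl⟩
    obtain ⟨y, hy⟩ := exists_iCycles_eq (x := (K.d j k).hom x) fun l =>
      congrArg (fun g => g.hom x) (K.d_comp_d j k l)
    exact mem_classRel.2 ⟨y, hy, (homologyπ_eq_zero_iff y).2 ⟨j, x, hy.symm⟩⟩

lemma isPresentation_classRel (gr : ∀ k, ℤ → AddSubgroup (K.X k)) :
    IsPresentation (gr k) (homologyGrading K gr k) (classRel K k) where
  exists_rep h := by
    obtain ⟨y, rfl⟩ := (ModuleCat.epi_iff_surjective (K.homologyπ k)).1 inferInstance h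
    exact ⟨_, y, rfl⟩
  eq_zero hz := by
    obtain ⟨y, hy, rfl⟩ := mem_classRel.1 hz
    rw [iCycles_injective (hy.trans (map_zero _).symm), map_zero]
  mem_gr_iff {i h} := by
    constructor
    · rintro ⟨y, hy, rfl⟩
      exact ⟨_, hy, y, rfl⟩
    · rintro ⟨x, hxi, hx⟩
      obtain ⟨y, rfl, rfl⟩ := mem_classRel.1 hx
      exact ⟨y, hxi, rfl⟩

lemma map_mem_classRel (f : K ⟶ L) {z : K.X k} {h : K.homology k} (hz : (z, h) ∈ classRel K k) :
    ((f.f k).hom z, (HomologicalComplex.homologyMap f k).hom h) ∈ classRel L k := by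
  obtain ⟨y, rfl, rfl⟩ := mem_classRel.1 hz
  exact ⟨(HomologicalComplex.cyclesMap f k).hom y, Prod.ext
    (congrArg (fun g => g.hom y) (HomologicalComplex.cyclesMap_i f k))
    (congrArg (fun g => g.hom y) (HomologicalComplex.homologyπ_naturality f k).symm)⟩

theorem exists_homology_equiv {gr : ∀ k, ℤ → AddSubgroup (K.X k)} {N : Type*} [AddCommGroup N]
    [Module S N] {grN : ℤ → AddSubgroup N} {G : Submodule S (K.X k × N)}
    (hG : IsPresentation (gr k) grN G)
    (hdom : ∀ x, (∃ n, (x, n) ∈ G) ↔ ∀ l, (K.d k l).hom x = 0)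
    (hker : ∀ x, (x, 0) ∈ G ↔ ∃ j y, (K.d j k).hom y = x) :
    ∃ e : K.homology k ≃ₗ[S] N,
      ∀ i, (homologyGrading K gr k i).map e.toLinearMap.toAddMonoidHom = grN i :=
  (isPresentation_classRel gr).exists_equiv hG
    (fun x => exists_mem_classRel_iff.trans (hdom x).symm)
    fun x => mem_classRel_zero_iff.trans (hker x).symm

end Homology

/-! ### The spectral sequence of a filtered complex of graded modules -/

/-- A first quadrant filtered complex of graded `R[t]`-modules. The complex is given by a module
`T` with a differential `D`; the submodule `F n p` of `T` is the `p`-th step of the filtration of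
the term of degree `n`. -/
structure FilteredComplex (R : Type v) [CommRing R] (T : Type w) [AddCommGroup T]
    [Module R[X] T] where
  /-- the differential -/
  D : T →ₗ[R[X]] T
  D_D (x : T) : D (D x) = 0
  /-- the filtration -/
  F : ℤ → ℤ → Submodule R[X] T
  anti (n : ℤ) {p p' : ℤ} (h : p ≤ p') : F n p' ≤ F n p
  D_mem (n p : ℤ) (x : T) (hx : x ∈ F n p) : D x ∈ F (n + 1) p
  le_of_nonpos (n p : ℤ) (x : T) (hx : x ∈ F n p) (p' : ℤ) (hp : p' ≤ 0) : x ∈ F n p'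
  eq_zero (n p : ℤ) (x : T) (hx : x ∈ F n p) (h : n < p) : x = 0
  /-- the grading -/
  gr : ℤ → AddSubgroup T
  isGrading : IsGrading (R := R) gr
  D_gr (i : ℤ) (x : T) (hx : x ∈ gr i) : D x ∈ gr i
  F_homogeneous (n p : ℤ) : IsHomogeneousSub isGrading.isInternal (F n p)

namespace FilteredComplex

variable {R : Type v} [CommRing R] {T : Type w} [AddCommGroup T] [Module R[X] T]
  (C : FilteredComplex R T)

section Page

lemma mem_of_le {n p p' : ℤ} (h : p ≤ p') {x : T} (hx : x ∈ C.F n p') : x ∈ C.F n p :=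
  C.anti n h hx

lemma mem_of_le_zero {n p p' : ℤ} (hp : p' ≤ 0) {x : T} (hx : x ∈ C.F n p) :
    x ∈ C.F n p' := C.le_of_nonpos n p x hx p' hp

/-- The elements of `F n p` with differential in filtration `m`. -/
def Z (n p m : ℤ) : Submodule R[X] T := C.F n p ⊓ (C.F (n + 1) m).comap C.D

lemma mem_Z {n p m : ℤ} {x : T} : x ∈ C.Z n p m ↔ x ∈ C.F n p ∧ C.D x ∈ C.F (n + 1) m := Iff.rfl

lemma Z_anti {n p m m' : ℤ} (h : m ≤ m') {x : T} (hx : x ∈ C.Z n p m') : x ∈ C.Z n p m :=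
  ⟨hx.1, C.mem_of_le h hx.2⟩

lemma mem_Z_of_D_eq_zero {n p m : ℤ} {x : T} (hx : x ∈ C.F n p) (h : C.D x = 0) :
    x ∈ C.Z n p m := C.mem_Z.2 ⟨hx, h ▸ zero_mem _⟩

lemma D_eq_zero_of_mem_Z {n p m : ℤ} (h : n + 1 < m) {x : T} (hx : x ∈ C.Z n p m) : C.D x = 0 :=
  C.eq_zero _ _ _ hx.2 h

/-- The submodule by which `Z n p (p + r)` is divided to obtain the `r`-th page. -/
def B (r n p : ℤ) : Submodule R[X] T :=
  C.Z n (p + 1) (p + r) ⊔ (C.Z (n - 1) (p - r + 1) p).map C.D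

lemma mem_B {r n p m s : ℤ} {x : T} (hm : n = m + 1) (hs : s = p - r + 1) : x ∈ C.B r n p ↔
    ∃ a ∈ C.Z n (p + 1) (p + r), ∃ b ∈ C.Z m s p, a + C.D b = x := by
  subst hm hs
  simp [B, Submodule.mem_sup]

lemma Z_le_B (r n p : ℤ) : C.Z n (p + 1) (p + r) ≤ C.B r n p := le_sup_left

lemma D_mem_B {r n p m s : ℤ} {b : T} (hm : n = m + 1) (hs : s = p - r + 1)
    (hb : b ∈ C.Z m s p) : C.D b ∈ C.B r n p :=
  (C.mem_B hm hs).2 ⟨0, zero_mem _, b, hb, zero_add _⟩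

lemma Z_homogeneous (n p m : ℤ) : IsHomogeneousSub C.isGrading.isInternal (C.Z n p m) :=
  (C.F_homogeneous n p).inf ((C.F_homogeneous (n + 1) m).comap C.D_gr)

lemma B_homogeneous (r n p : ℤ) : IsHomogeneousSub C.isGrading.isInternal (C.B r n p) :=
  (C.Z_homogeneous _ _ _).sup ((C.Z_homogeneous _ _ _).map C.D_gr)

/-- The term `Z n p (p + r) / B r n p` of the `r`-th page in total degree `n` and filtration
degree `p`. -/
abbrev E (r n p : ℤ) : Type w := C.Z n p (p + r) ⧸ (C.B r n p).submoduleOf (C.Z n p (p + r))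

/-- The class of an element of `Z` in a page. -/
abbrev cls (r n p : ℤ) : C.Z n p (p + r) →ₗ[R[X]] C.E r n p :=
  ((C.B r n p).submoduleOf (C.Z n p (p + r))).mkQ

lemma cls_surjective (r n p : ℤ) : Function.Surjective (C.cls r n p) := Submodule.mkQ_surjective _

lemma cls_eq_zero {r n p : ℤ} {z : C.Z n p (p + r)} : C.cls r n p z = 0 ↔ (z : T) ∈ C.B r n p :=
  mkQ_submoduleOf_eq_zero

lemma cls_eq_cls {r n p : ℤ} {z z' : C.Z n p (p + r)} :
    C.cls r n p z = C.cls r n p z' ↔ (z : T) - z' ∈ C.B r n p := by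
  rw [← sub_eq_zero, ← map_sub, cls_eq_zero]
  rfl

lemma D_mem_Z {r n p n' p' : ℤ} (hn : n' = n + 1) (hp : p' = p + r) {x : T}
    (hx : x ∈ C.Z n p (p + r)) (m : ℤ) : C.D x ∈ C.Z n' p' m := by
  subst hn hp
  exact C.mem_Z_of_D_eq_zero hx.2 (C.D_D x)

/-- The differential of the `r`-th page. -/
def dE (r : ℤ) {n p n' p' : ℤ} (hn : n' = n + 1) (hp : p' = p + r) :
    C.E r n p →ₗ[R[X]] C.E r n' p' :=
  Submodule.mapQ _ _ (C.D.restrict fun _ hx => C.D_mem_Z hn hp hx _) fun x hx => by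
    have hxB : (x : T) ∈ C.B r n p := hx
    obtain ⟨a, ha, b, -, hab⟩ := (C.mem_B (m := n - 1) (by ring) rfl).1 hxB
    change C.D x ∈ C.B r n' p'
    rw [← hab, map_add, C.D_D, add_zero]
    exact C.D_mem_B hn (s := p + 1) (by lia) (hp ▸ ha)

/-- The shape of the `r`-th page of a first quadrant cohomological spectral sequence. -/
abbrev shape (r : ℤ) : ComplexShape (ℕ × ℕ) := ComplexShape.spectralSequenceNat (r, 1 - r)

lemma total_eq {r : ℤ} {a b : ℕ × ℕ} (h : (shape r).Rel a b) :
    (b.1 + b.2 : ℤ) = (a.1 + a.2 : ℤ) + 1 := by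
  have h' : (a.1 : ℤ) + r = b.1 ∧ (a.2 : ℤ) + (1 - r) = b.2 := h
  lia

lemma fst_eq {r : ℤ} {a b : ℕ × ℕ} (h : (shape r).Rel a b) : (b.1 : ℤ) = a.1 + r := h.1.symm

lemma lt_of_forall_not_rel_next {r : ℤ} {a : ℕ × ℕ} (hr : 0 ≤ r)
    (h : ∀ b, ¬ (shape r).Rel a b) : (a.1 + a.2 : ℤ) + 1 < a.1 + r := by
  by_contra hlt
  refine h (((a.1 : ℤ) + r).toNat, ((a.2 : ℤ) + 1 - r).toNat) ⟨?_, ?_⟩ <;> simp only <;> lia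

lemma lt_of_forall_not_rel_prev {r : ℤ} {a : ℕ × ℕ} (hr : 1 ≤ r)
    (h : ∀ b, ¬ (shape r).Rel b a) : (a.1 : ℤ) < r := by
  by_contra hlt
  refine h (((a.1 : ℤ) - r).toNat, ((a.2 : ℤ) + r - 1).toNat) ⟨?_, ?_⟩ <;> simp only <;> lia

open Classical in
/-- The `r`-th page of the spectral sequence of a filtered complex. -/
def page (r : ℤ) : HomologicalComplex (ModuleCat.{w} R[X]) (shape r) where
  X a := ModuleCat.of R[X] (C.E r (a.1 + a.2) a.1)
  d a b := if h : (shape r).Rel a b then ModuleCat.ofHom (C.dE r (total_eq h) (fst_eq h)) else 0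
  shape a b h := dif_neg h
  d_comp_d' a b c hab hbc := by
    rw [dif_pos hab, dif_pos hbc]
    refine ModuleCat.hom_ext (LinearMap.ext fun x => ?_)
    obtain ⟨z, rfl⟩ := C.cls_surjective _ _ _ x
    refine C.cls_eq_zero.2 ?_
    change C.D (C.D z) ∈ _
    rw [C.D_D]
    exact zero_mem _

lemma page_d_cls {r : ℤ} {a b : ℕ × ℕ} (h : (shape r).Rel a b)
    (z : C.Z (a.1 + a.2) a.1 (a.1 + r)) :
    ((C.page r).d a b).hom (C.cls r (a.1 + a.2) a.1 z) =
      C.cls r (b.1 + b.2) b.1 ⟨C.D z, C.D_mem_Z (total_eq h) (fst_eq h) z.2 _⟩ := by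
  have : (C.page r).d a b = ModuleCat.ofHom (C.dE r (total_eq h) (fst_eq h)) := dif_pos h
  rw [this]
  rfl

/-- The grading of the `r`-th page. -/
def pageGr (r : ℤ) (a : ℕ × ℕ) (i : ℤ) : AddSubgroup ((C.page r).X a) :=
  subquotGrading C.gr (C.Z (a.1 + a.2) a.1 (a.1 + r)) (C.B r (a.1 + a.2) a.1) i

lemma isGrading_pageGr (r : ℤ) (a : ℕ × ℕ) : IsGrading (R := R) (C.pageGr r a) :=
  isGrading_subquotGrading C.isGrading (C.Z_homogeneous _ _ _) (C.B_homogeneous _ _ _)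

lemma page_d_mem (r : ℤ) (a b : ℕ × ℕ) (i : ℤ) (x : (C.page r).X a) (hx : x ∈ C.pageGr r a i) :
    ((C.page r).d a b).hom x ∈ C.pageGr r b i := by
  by_cases h : (shape r).Rel a b
  · obtain ⟨z, hz, rfl⟩ := hx
    exact ⟨_, C.D_gr i _ hz, (C.page_d_cls h z).symm⟩
  · rw [(C.page r).shape a b h]
    exact zero_mem _

lemma gproj_cls (r : ℤ) (a : ℕ × ℕ) (i : ℤ) (z : C.Z (a.1 + a.2) a.1 (a.1 + r)) :
    gproj (C.isGrading_pageGr r a).isInternal i (C.cls r (a.1 + a.2) a.1 z) =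
      C.cls r (a.1 + a.2) a.1
        ⟨gproj C.isGrading.isInternal i z, C.Z_homogeneous _ _ _ i _ z.2⟩ := by
  obtain ⟨_, hz⟩ := mem_subquotRel.1 (gproj_mem_subquotRel (C.Z_homogeneous _ _ _)
    (C.B_homogeneous r (a.1 + a.2) a.1) i (mem_subquotRel.2 ⟨z.2, rfl⟩))
  exact hz.symm

end Page

section NextPage

variable {r : ℤ} {a : ℕ × ℕ}

/-- The relation between the terms of the `r`-th and the `r + 1`-st page given by the classes of a
common representative. -/
def pageRel (r : ℤ) (a : ℕ × ℕ) : Submodule R[X] ((C.page r).X a × (C.page (r + 1)).X a) :=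
  LinearMap.range (LinearMap.prod
    (C.cls r (a.1 + a.2) a.1 ∘ₗ Submodule.inclusion fun _ hx => C.Z_anti (by lia) hx)
    (C.cls (r + 1) (a.1 + a.2) a.1))

lemma mem_pageRel {x : (C.page r).X a} {y : (C.page (r + 1)).X a} : (x, y) ∈ C.pageRel r a ↔
    ∃ (z : T) (hz : z ∈ C.Z (a.1 + a.2) a.1 (a.1 + (r + 1))),
      C.cls r (a.1 + a.2) a.1 ⟨z, C.Z_anti (by lia) hz⟩ = x ∧
        C.cls (r + 1) (a.1 + a.2) a.1 ⟨z, hz⟩ = y := by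
  constructor
  · rintro ⟨⟨z, hz⟩, h⟩
    exact ⟨z, hz, congrArg Prod.fst h, congrArg Prod.snd h⟩
  · rintro ⟨z, hz, rfl, rfl⟩
    exact ⟨⟨z, hz⟩, rfl⟩

lemma isPresentation_pageRel :
    IsPresentation (C.pageGr r a) (C.pageGr (r + 1) a) (C.pageRel r a) := by
  refine isPresentation_of_gproj_mem (C.isGrading_pageGr r a).isInternal
    (C.isGrading_pageGr (r + 1) a).isInternal (fun y => ?_) (fun y hy => ?_) fun i x y hxy => ?_
  · obtain ⟨⟨z, hz⟩, rfl⟩ := C.cls_surjective _ _ _ y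
    exact ⟨_, C.mem_pageRel.2 ⟨z, hz, rfl, rfl⟩⟩
  · obtain ⟨z, hz, h0, rfl⟩ := C.mem_pageRel.1 hy
    obtain ⟨u, hu, b, hb, rfl⟩ :=
      (C.mem_B (m := a.1 + a.2 - 1) (by ring) rfl).1 (C.cls_eq_zero.1 h0)
    have hDu : C.D u ∈ C.F (a.1 + a.2 + 1) (a.1 + (r + 1)) := by
      have := (C.mem_Z.1 hz).2
      rwa [map_add, C.D_D, add_zero] at this
    exact C.cls_eq_zero.2 ((C.mem_B (m := a.1 + a.2 - 1) (by ring) rfl).2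
      ⟨u, C.mem_Z.2 ⟨hu.1, hDu⟩, b, ⟨C.mem_of_le (by lia) hb.1, hb.2⟩, rfl⟩)
  · obtain ⟨z, hz, rfl, rfl⟩ := C.mem_pageRel.1 hxy
    rw [gproj_cls, gproj_cls]
    exact C.mem_pageRel.2 ⟨_, C.Z_homogeneous _ _ _ i _ hz, rfl, rfl⟩

lemma exists_mem_pageRel_of_d_eq_zero (hr : 0 ≤ r) {x : (C.page r).X a}
    (hx : ∀ b, ((C.page r).d a b).hom x = 0) : ∃ y, (x, y) ∈ C.pageRel r a := by
  obtain ⟨⟨z, hz⟩, rfl⟩ := C.cls_surjective _ _ _ x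
  by_cases hnext : ∃ b, (shape r).Rel a b
  · obtain ⟨b, hab⟩ := hnext
    have h0 := hx b
    rw [C.page_d_cls hab] at h0
    obtain ⟨u, hu, t, ht, hut⟩ := (C.mem_B (total_eq hab) (s := a.1 + 1)
      (by rw [fst_eq hab]; ring)).1 (C.cls_eq_zero.1 h0)
    have hDz : C.D z = u + C.D t := hut.symm
    have ht' : t ∈ C.Z (a.1 + a.2) (a.1 + 1) (a.1 + r) := by
      rwa [← fst_eq hab]
    have hzt : z - t ∈ C.Z (a.1 + a.2) a.1 (a.1 + (r + 1)) := by
      refine C.mem_Z.2 ⟨sub_mem hz.1 (C.mem_of_le (by lia) ht.1), ?_⟩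
      rw [map_sub, hDz, add_sub_cancel_right, ← add_assoc, ← total_eq hab, ← fst_eq hab]
      exact hu.1
    refine ⟨_, C.mem_pageRel.2 ⟨z - t, hzt, C.cls_eq_cls.2 ?_, rfl⟩⟩
    rw [sub_sub_cancel_left]
    exact neg_mem (C.Z_le_B _ _ _ ht')
  · have hD := C.D_eq_zero_of_mem_Z (lt_of_forall_not_rel_next hr (not_exists.1 hnext)) hz
    exact ⟨_, C.mem_pageRel.2 ⟨z, C.mem_Z_of_D_eq_zero hz.1 hD, rfl, rfl⟩⟩

lemma page_d_eq_zero_of_mem_pageRel {x : (C.page r).X a} {y : (C.page (r + 1)).X a}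
    (hxy : (x, y) ∈ C.pageRel r a) (b : ℕ × ℕ) : ((C.page r).d a b).hom x = 0 := by
  obtain ⟨z, hz, rfl, -⟩ := C.mem_pageRel.1 hxy
  by_cases hab : (shape r).Rel a b
  · rw [C.page_d_cls hab]
    refine C.cls_eq_zero.2 (C.Z_le_B _ _ _ ?_)
    exact C.D_mem_Z (total_eq hab) (p := a.1) (r := r + 1) (by rw [fst_eq hab, add_assoc]) hz _
  · rw [(C.page r).shape a b hab]
    rfl

lemma exists_page_d_eq_of_mem_pageRel_zero (hr : 1 ≤ r) {x : (C.page r).X a}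
    (hx : (x, 0) ∈ C.pageRel r a) : ∃ j y, ((C.page r).d j a).hom y = x := by
  obtain ⟨z, hz, rfl, h0⟩ := C.mem_pageRel.1 hx
  by_cases hprev : ∃ j, (shape r).Rel j a
  · obtain ⟨j, hja⟩ := hprev
    obtain ⟨u, hu, b, hb, hub⟩ := (C.mem_B (total_eq hja) (s := j.1)
      (by rw [fst_eq hja]; ring)).1 (C.cls_eq_zero.1 h0)
    refine ⟨j, C.cls r _ _ ⟨b, fst_eq hja ▸ hb⟩, ?_⟩
    rw [C.page_d_cls hja]
    refine C.cls_eq_cls.2 ?_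
    have hub' : C.D b - z = -u := by rw [← show u + C.D b = z from hub]; abel
    rw [hub']
    exact neg_mem (C.Z_le_B _ _ _ (C.Z_anti (by lia) hu))
  · obtain ⟨u, hu, b, hb, hub⟩ :=
      (C.mem_B (m := a.1 + a.2 - 1) (by ring) rfl).1 (C.cls_eq_zero.1 h0)
    have hlt := lt_of_forall_not_rel_prev hr (not_exists.1 hprev)
    refine ⟨a, 0, (map_zero _).trans (C.cls_eq_zero.2 ?_).symm⟩
    exact (C.mem_B (m := a.1 + a.2 - 1) (by ring) rfl).2
      ⟨u, C.Z_anti (by lia) hu, b, ⟨C.mem_of_le_zero (by lia) hb.1, hb.2⟩, hub⟩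

lemma page_d_mem_pageRel_zero (j : ℕ × ℕ) (y : (C.page r).X j) :
    (((C.page r).d j a).hom y, 0) ∈ C.pageRel r a := by
  by_cases hja : (shape r).Rel j a
  · obtain ⟨⟨b, hb⟩, rfl⟩ := C.cls_surjective _ _ _ y
    rw [C.page_d_cls hja]
    refine C.mem_pageRel.2 ⟨C.D b, C.D_mem_Z (total_eq hja) (fst_eq hja) hb _, rfl,
      C.cls_eq_zero.2 (C.D_mem_B (total_eq hja) (s := j.1) (by rw [fst_eq hja]; ring) ?_)⟩
    exact (fst_eq hja).symm ▸ hb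
  · rw [(C.page r).shape j a hja]
    exact zero_mem _

lemma exists_page_iso (r r' : ℤ) (hr : 1 ≤ r) (hrr' : r + 1 = r') (a : ℕ × ℕ) :
    ∃ e : (C.page r).homology a ≅ (C.page r').X a,
      ∀ i, (homologyGrading (C.page r) (C.pageGr r) a i).map e.hom.hom.toAddMonoidHom =
        C.pageGr r' a i := by
  subst hrr'
  obtain ⟨e, he⟩ := exists_homology_equiv (K := C.page r) (gr := C.pageGr r) (k := a)
    C.isPresentation_pageRel
    (fun x => ⟨fun h b => h.elim fun _ hxy => C.page_d_eq_zero_of_mem_pageRel hxy b,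
      C.exists_mem_pageRel_of_d_eq_zero (by lia)⟩)
    (fun x => ⟨C.exists_page_d_eq_of_mem_pageRel_zero hr,
      fun ⟨j, y, hy⟩ => hy ▸ C.page_d_mem_pageRel_zero j y⟩)
  exact ⟨e.toModuleIso, he⟩

/-- The spectral sequence of a filtered complex of graded modules. -/
def spectralSequence : GradedSpectralSequence.{v, w} R where
  E :=
    { page := fun r _ => C.page r
      iso := fun r r' a hrr' hr => (C.exists_page_iso r r' (by lia) hrr' a).choose }
  gr r _ a i := C.pageGr r a i
  isGrading r _ a := C.isGrading_pageGr r a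
  d_mem r _ a b i x hx := C.page_d_mem r a b i x hx
  iso_map r hr a i := (C.exists_page_iso r (r + 1) (by lia) rfl a).choose_spec i

end NextPage

section Convergence

variable {A : ℕ → Type*} [∀ n, AddCommGroup (A n)] [∀ n, Module R[X] (A n)]
  {grA : ∀ n, ℤ → AddSubgroup (A n)} {G : ∀ n : ℕ, Submodule R[X] (T × A n)}

/-- The relations `G n` exhibit the graded modules `A n` as the cohomology of the total complex. -/
abbrev PresentsCohomology (grA : ∀ n, ℤ → AddSubgroup (A n))
    (G : ∀ n : ℕ, Submodule R[X] (T × A n)) : Prop :=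
  ∀ n : ℕ, IsSubquotientRel (C.F n 0 ⊓ LinearMap.ker C.D) ((C.F (n - 1) 0).map C.D) C.gr (grA n)
    (G n)

variable {C} (hA : ∀ n, DirectSum.IsInternal (grA n)) (hG : C.PresentsCohomology grA G)

include hG

lemma PresentsCohomology.gproj_mem (n : ℕ) (i : ℤ) (z : T) (a : A n) (hz : (z, a) ∈ G n) :
    (gproj C.isGrading.isInternal i z, gproj (hA n) i a) ∈ G n := by
  refine (hG n).gproj_mem _ _ (fun j x b hx => ?_) i hz
  obtain ⟨hF, hD⟩ := (hG n).exists_mem_iff.1 ⟨b, hx⟩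
  exact (hG n).exists_mem_iff.2 ⟨C.F_homogeneous n 0 j x hF,
    isHomogeneousSub_ker C.isGrading.isInternal C.isGrading.isInternal C.D_gr j x hD⟩

lemma PresentsCohomology.mem_zero_iff_mem_B {p q : ℕ} {r : ℤ} (hp : p < r) (hq : q + 1 < r)
    {x : T} : (x, 0) ∈ subquotRel (C.Z (p + q) p (p + r)) (C.B r (p + q) p) ↔
      (x, 0) ∈ relImageSubquotRel (G (p + q)) (C.F (p + q : ℕ) p)
        (C.F (p + q : ℕ) (p + 1 : ℕ)) := by
  simp only [mem_subquotRel, mkQ_submoduleOf_eq_zero, mem_relImageSubquotRel_zero_iff,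
    (hG _).exists_mem_iff, (hG _).mem_zero_iff, Submodule.mem_inf, Submodule.mem_map,
    LinearMap.mem_ker, Nat.cast_add, Nat.cast_one, exists_prop]
  constructor
  · rintro ⟨hxZ, hxB⟩
    obtain ⟨a, ha, b, hb, rfl⟩ := (C.mem_B (m := p + q - 1) (by ring) rfl).1 hxB
    exact ⟨hxZ.1, a, ha.1, ⟨C.mem_of_le (by lia) ha.1, C.D_eq_zero_of_mem_Z (by lia) ha⟩, b,
      C.mem_of_le_zero le_rfl hb.1, (add_sub_cancel_left _ _).symm⟩
  · rintro ⟨hx, a, ha, ⟨-, hDa⟩, b, hb, hDb⟩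
    have hDx : C.D x = 0 := by
      rw [← sub_add_cancel x a, ← hDb, map_add, C.D_D, hDa, add_zero]
    refine ⟨C.mem_Z_of_D_eq_zero hx hDx, (C.mem_B (m := p + q - 1) (by ring) rfl).2
      ⟨a, C.mem_Z_of_D_eq_zero ha hDa, b, ⟨C.mem_of_le_zero (by lia) hb, ?_⟩, ?_⟩⟩
    · change C.D b ∈ C.F (p + q - 1 + 1) p
      rw [hDb, sub_add_cancel]
      exact sub_mem hx (C.mem_of_le (by lia) ha)
    · rw [hDb, add_sub_cancel]

include hA

lemma PresentsCohomology.exists_page_equiv {p q : ℕ} {r : ℤ} (hp : p < r) (hq : q + 1 < r) :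
    ∃ e : (C.page r).X (p, q) ≃ₗ[R[X]] _, ∀ i,
      (C.pageGr r (p, q) i).map e.toLinearMap.toAddMonoidHom =
        subquotGrading (grA (p + q)) (relImage (G (p + q)) (C.F (p + q : ℕ) p))
          (relImage (G (p + q)) (C.F (p + q : ℕ) (p + 1 : ℕ))) i := by
  refine (isPresentation_subquotRel (gr := C.gr) (Z := C.Z (p + q) p (p + r))
    (B := C.B r (p + q) p)).exists_equiv
    (isPresentation_relImageSubquotRel (hG.gproj_mem hA (p + q))
      (fun _ hn => (hG _).eq_zero hn) (C.F_homogeneous _ _) (C.F_homogeneous _ _))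
    (fun x => ?_) fun x => hG.mem_zero_iff_mem_B hp hq
  simp only [exists_mem_subquotRel_iff, exists_mem_relImageSubquotRel_iff, (hG _).exists_mem_iff,
    Submodule.mem_inf, LinearMap.mem_ker, Nat.cast_add]
  exact ⟨fun hx => ⟨hx.1, C.mem_of_le (by lia) hx.1, C.D_eq_zero_of_mem_Z (by lia) hx⟩,
    fun hx => C.mem_Z_of_D_eq_zero hx.1 hx.2.2⟩

theorem PresentsCohomology.convergesTo : C.spectralSequence.ConvergesTo A grA := by
  refine ⟨fun n p => relImage (G n) (C.F n p), fun n p p' hp a ha => ?_, fun n => ?_, fun n => ?_,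
    fun n p => (isHomogeneousSub_relImage (hG.gproj_mem hA n)
      (C.F_homogeneous n p)).toAddSubgroup_eq, fun p q r _ hp hq => hG.exists_page_equiv hA hp hq⟩
  · obtain ⟨z, hz, hza⟩ := mem_relImage.1 ha
    exact mem_relImage.2 ⟨z, C.mem_of_le (by exact_mod_cast hp) hz, hza⟩
  · refine eq_top_iff.2 fun a _ => ?_
    obtain ⟨z, hz⟩ := (hG n).exists_rep a
    exact mem_relImage.2 ⟨z, ((hG n).exists_mem_iff.1 ⟨a, hz⟩).1, hz⟩
  · refine eq_bot_iff.2 fun a ha => ?_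
    obtain ⟨z, hz, hza⟩ := mem_relImage.1 ha
    rw [C.eq_zero _ _ _ hz (by push_cast; lia)] at hza
    exact (hG n).eq_zero hza

end Convergence

end FilteredComplex

/-! ### Double complexes -/

/-- The boundaries of a sequence `Q 0 → Q 1 → ⋯` of linear maps; there are none but `0` in
degree `0`. -/
def boundaries {S : Type*} [Ring S] {Q : ℕ → Type*} [∀ q, AddCommGroup (Q q)] [∀ q, Module S (Q q)]
    (d : ∀ q, Q q →ₗ[S] Q (q + 1)) : ∀ q, Submodule S (Q q)
  | 0 => ⊥
  | q + 1 => LinearMap.range (d q)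

/-- A first quadrant double complex of graded `R[t]`-modules with commuting differentials. -/
structure DoubleComplex (R : Type v) [CommRing R] (A : ℕ → ℕ → Type w)
    [∀ p q, AddCommGroup (A p q)] [∀ p q, Module R[X] (A p q)] where
  /-- the horizontal differential -/
  dh (p q : ℕ) : A p q →ₗ[R[X]] A (p + 1) q
  /-- the vertical differential -/
  dv (p q : ℕ) : A p q →ₗ[R[X]] A p (q + 1)
  dh_dh (p q : ℕ) (x : A p q) : dh (p + 1) q (dh p q x) = 0
  dv_dv (p q : ℕ) (x : A p q) : dv p (q + 1) (dv p q x) = 0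
  dh_dv (p q : ℕ) (x : A p q) : dh p (q + 1) (dv p q x) = dv (p + 1) q (dh p q x)
  /-- the gradings -/
  gr (p q : ℕ) : ℤ → AddSubgroup (A p q)
  isGrading (p q : ℕ) : IsGrading (R := R) (gr p q)
  dh_gr (p q : ℕ) (i : ℤ) (x : A p q) (hx : x ∈ gr p q i) : dh p q x ∈ gr (p + 1) q i
  dv_gr (p q : ℕ) (i : ℤ) (x : A p q) (hx : x ∈ gr p q i) : dv p q x ∈ gr p (q + 1) i

namespace DoubleComplex

variable {R : Type v} [CommRing R] {A : ℕ → ℕ → Type w}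
    [∀ p q, AddCommGroup (A p q)] [∀ p q, Module R[X] (A p q)] (C : DoubleComplex R A)

variable (A) in
/-- The direct sum of all terms of a double complex. -/
abbrev Total : Type w := ⨁ a : ℕ × ℕ, A a.1 a.2

variable (R A) in
/-- The inclusion of a term into the direct sum. -/
abbrev inj (p q : ℕ) : A p q →ₗ[R[X]] Total A :=
  DirectSum.lof R[X] (ℕ × ℕ) (fun a => A a.1 a.2) (p, q)

lemma inj_same (p q : ℕ) (x : A p q) : inj R A p q x (p, q) = x :=
  DirectSum.of_eq_same (β := fun a : ℕ × ℕ => A a.1 a.2) (p, q) x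

lemma inj_ne {p q p' q' : ℕ} (h : p' ≠ p ∨ q' ≠ q) (x : A p q) : inj R A p q x (p', q') = 0 :=
  DirectSum.of_eq_of_ne (β := fun a : ℕ × ℕ => A a.1 a.2) (p, q) (p', q') x
    (fun h' => by simp only [Prod.mk.injEq] at h'; lia)

/-- The total differential. -/
def D : Total A →ₗ[R[X]] Total A :=
  DirectSum.toModule R[X] (ℕ × ℕ) _ fun a =>
    inj R A (a.1 + 1) a.2 ∘ₗ C.dh a.1 a.2 + (-1 : ℤ) ^ a.1 • inj R A a.1 (a.2 + 1) ∘ₗ C.dv a.1 a.2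

lemma D_inj (p q : ℕ) (x : A p q) : C.D (inj R A p q x) =
    inj R A (p + 1) q (C.dh p q x) + (-1 : ℤ) ^ p • inj R A p (q + 1) (C.dv p q x) := by
  simp [D, inj]

lemma D_D (x : Total A) : C.D (C.D x) = 0 := by
  refine LinearMap.congr_fun (f := C.D ∘ₗ C.D) (g := 0)
    (DirectSum.linearMap_ext _ fun ⟨p, q⟩ => LinearMap.ext fun x => ?_) x
  change C.D (C.D (inj R A p q x)) = 0
  rw [D_inj, map_add, map_zsmul, D_inj, D_inj, C.dh_dh, C.dv_dv, C.dh_dv, map_zero, map_zero,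
    zero_add, smul_zero, add_zero, pow_succ, mul_neg_one, neg_smul, neg_add_cancel]

/-- The horizontal part of the total differential. -/
def hPart (x : Total A) : ∀ p q, A p q
  | 0, _ => 0
  | p + 1, q => C.dh p q (x (p, q))

/-- The vertical part of the total differential, without sign. -/
def vPart (x : Total A) : ∀ p q, A p q
  | _, 0 => 0
  | p, q + 1 => C.dv p q (x (p, q))

lemma hPart_succ (x : Total A) (p q : ℕ) : C.hPart x (p + 1) q = C.dh p q (x (p, q)) := rfl

lemma vPart_succ (x : Total A) (p q : ℕ) : C.vPart x p (q + 1) = C.dv p q (x (p, q)) := rfl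

lemma hPart_inj (p q : ℕ) (x : A p q) (p' q' : ℕ) :
    C.hPart (inj R A p q x) p' q' = inj R A (p + 1) q (C.dh p q x) (p', q') := by
  cases p' with
  | zero => exact (inj_ne (by lia) _).symm
  | succ p' =>
    by_cases h : p' = p ∧ q' = q
    · obtain ⟨rfl, rfl⟩ := h
      rw [inj_same, hPart, inj_same]
    · rw [inj_ne (by lia), hPart, inj_ne (by lia), map_zero]

lemma vPart_inj (p q : ℕ) (x : A p q) (p' q' : ℕ) :
    C.vPart (inj R A p q x) p' q' = inj R A p (q + 1) (C.dv p q x) (p', q') := by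
  cases q' with
  | zero => exact (inj_ne (by lia) _).symm
  | succ q' =>
    by_cases h : p' = p ∧ q' = q
    · obtain ⟨rfl, rfl⟩ := h
      rw [inj_same, vPart, inj_same]
    · rw [inj_ne (by lia), vPart, inj_ne (by lia), map_zero]

lemma D_inj_apply (p q : ℕ) (x : A p q) (p' q' : ℕ) : C.D (inj R A p q x) (p', q') =
    C.hPart (inj R A p q x) p' q' + (-1 : ℤ) ^ p' • C.vPart (inj R A p q x) p' q' := by
  rw [D_inj, DirectSum.add_apply, hPart_inj, vPart_inj]
  by_cases hp : p' = p
  · subst hp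
    exact congrArg _ (DFinsupp.zsmul_apply _ _ _)
  · rw [← map_zsmul, inj_ne (p' := p') (q := q + 1) (Or.inl hp),
      inj_ne (p' := p') (q := q + 1) (Or.inl hp), smul_zero]

lemma D_apply (x : Total A) (p q : ℕ) :
    C.D x (p, q) = C.hPart x p q + (-1 : ℤ) ^ p • C.vPart x p q := by
  induction x using DirectSum.induction_on with
  | zero => cases p <;> cases q <;> simp [hPart, vPart]
  | add x y hx hy =>
    rw [map_add, DirectSum.add_apply, hx, hy]
    cases p <;> cases q <;> simp only [hPart, vPart, DirectSum.add_apply, map_add, smul_add,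
      add_zero, zero_add, smul_zero]
    abel
  | of a x => exact C.D_inj_apply a.1 a.2 x p q

/-- The filtration of the total complex by columns. -/
def F (R : Type v) [CommRing R] (A : ℕ → ℕ → Type w) [∀ p q, AddCommGroup (A p q)]
    [∀ p q, Module R[X] (A p q)] (n m : ℤ) : Submodule R[X] (Total A) where
  carrier := {x | ∀ p q : ℕ, (p + q : ℤ) ≠ n ∨ p < m → x (p, q) = 0}
  zero_mem' _ _ _ := rfl
  add_mem' hx hy p q h := by rw [DirectSum.add_apply, hx p q h, hy p q h, add_zero]
  smul_mem' a x hx p q h := by rw [DirectSum.smul_apply, hx p q h, smul_zero]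

lemma inj_mem_F {p q : ℕ} {n m : ℤ} (hn : (p + q : ℤ) = n) (hm : m ≤ p) (x : A p q) :
    inj R A p q x ∈ F R A n m :=
  fun _ _ h => inj_ne (by lia) x

/-- The grading of the total complex. -/
def totalGr (i : ℤ) : AddSubgroup (Total A) where
  carrier := {x | ∀ p q : ℕ, x (p, q) ∈ C.gr p q i}
  zero_mem' _ _ := zero_mem _
  add_mem' hx hy p q := by rw [DirectSum.add_apply]; exact add_mem (hx p q) (hy p q)
  neg_mem' {x} hx p q := by
    change -x (p, q) ∈ _
    exact neg_mem (hx p q)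

lemma inj_mem_totalGr {p q : ℕ} {i : ℤ} {x : A p q} (hx : x ∈ C.gr p q i) :
    inj R A p q x ∈ C.totalGr i := by
  intro p' q'
  by_cases h : p' = p ∧ q' = q
  · obtain ⟨rfl, rfl⟩ := h
    rwa [inj_same]
  · rw [inj_ne (by lia)]
    exact zero_mem _

lemma exists_sum_totalGr (x : Total A) :
    ∃ (s : Finset ℤ) (g : ℤ → Total A), (∀ i, g i ∈ C.totalGr i) ∧ x = ∑ i ∈ s, g i := by
  classical
  let g (i : ℤ) : Total A :=
    DFinsupp.mapRange (fun a => gproj (C.isGrading a.1 a.2).isInternal i) (fun _ => map_zero _) x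
  choose s hs using fun a : ℕ × ℕ =>
    exists_forall_eq_sum_gproj (C.isGrading a.1 a.2).isInternal (x a)
  refine ⟨(DFinsupp.support x).biUnion s, g, fun i p q => gproj_mem _ i _, DFinsupp.ext fun a => ?_⟩
  rw [DirectSum.sum_apply]
  by_cases ha : a ∈ DFinsupp.support x
  · exact hs a _ (Finset.subset_biUnion_of_mem s ha)
  · have hxa : x a = 0 := DFinsupp.notMem_support_iff.1 ha
    simp [g, hxa]

lemma isInternal_totalGr : DirectSum.IsInternal C.totalGr := by
  refine isInternal_of_sum C.exists_sum_totalGr fun s g hg hsum i hi => DFinsupp.ext fun a => ?_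
  have hsum_a : ∑ i ∈ s, g i a = 0 := by
    rw [← DirectSum.sum_apply, hsum]
    rfl
  have hga := gproj_sum (C.isGrading a.1 a.2).isInternal (g := fun i => g i a)
    (fun i => hg i a.1 a.2) hi
  rw [hsum_a, map_zero] at hga
  exact hga.symm

lemma gproj_total_apply (i : ℤ) (x : Total A) (p q : ℕ) :
    gproj C.isInternal_totalGr i x (p, q) = gproj (C.isGrading p q).isInternal i (x (p, q)) :=
  map_gproj C.isInternal_totalGr (C.isGrading p q).isInternal
    (DFinsupp.evalAddMonoidHom (β := fun a : ℕ × ℕ => A a.1 a.2) (p, q)) (fun _ _ hx => hx p q) i x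

lemma isGrading_totalGr : IsGrading (R := R) C.totalGr where
  isInternal := C.isInternal_totalGr
  C_smul_mem a i x hx p q := by
    rw [DirectSum.smul_apply]
    exact (C.isGrading p q).C_smul_mem a i _ (hx p q)
  X_smul_mem i x hx p q := by
    rw [DirectSum.smul_apply]
    exact (C.isGrading p q).X_smul_mem i _ (hx p q)

lemma D_mem_totalGr (i : ℤ) (x : Total A) (hx : x ∈ C.totalGr i) : C.D x ∈ C.totalGr i := by
  intro p q
  rw [D_apply]
  refine add_mem ?_ (zsmul_mem ?_ _)
  · cases p with
    | zero => exact zero_mem _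
    | succ p => exact C.dh_gr p q i _ (hx p q)
  · cases q with
    | zero => exact zero_mem _
    | succ q => exact C.dv_gr p q i _ (hx p q)

lemma hPart_eq_zero {n m : ℤ} {x : Total A} (hx : x ∈ F R A n m) {p q : ℕ}
    (h : (p + q : ℤ) ≠ n + 1 ∨ p < m + 1) : C.hPart x p q = 0 := by
  cases p with
  | zero => rfl
  | succ p => rw [hPart, hx p q (by lia), map_zero]

lemma vPart_eq_zero {n m : ℤ} {x : Total A} (hx : x ∈ F R A n m) {p q : ℕ}
    (h : (p + q : ℤ) ≠ n + 1 ∨ p < m) : C.vPart x p q = 0 := by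
  cases q with
  | zero => rfl
  | succ q => rw [vPart, hx p q (by lia), map_zero]

lemma vPart_inj_of_ne {p q p' q' : ℕ} (h : p' ≠ p) (x : A p q) :
    C.vPart (inj R A p q x) p' q' = 0 := by
  rw [vPart_inj, inj_ne (Or.inl h)]

lemma D_mem_F {n n' m : ℤ} (hn : n' = n + 1) {x : Total A} (hx : x ∈ F R A n m) :
    C.D x ∈ F R A n' m := by
  intro p q h
  rw [D_apply, C.hPart_eq_zero hx (by lia), C.vPart_eq_zero hx (by lia), smul_zero, add_zero]

/-- The total complex, filtered by columns. -/
def filtered : FilteredComplex R (Total A) where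
  D := C.D
  D_D := C.D_D
  F := F R A
  anti n p p' h x hx a b hab := hx a b (by lia)
  D_mem n m x hx := C.D_mem_F rfl hx
  le_of_nonpos n p x hx p' hp a b hab := by
    by_cases h : (a : ℤ) < p
    · exact hx a b (Or.inr h)
    · exact hx a b (by lia)
  eq_zero n p x hx h := DFinsupp.ext fun a => hx a.1 a.2 (by lia)
  gr := C.totalGr
  isGrading := C.isGrading_totalGr
  D_gr := C.D_mem_totalGr
  F_homogeneous n m i x hx p q h := by
    rw [gproj_total_apply, hx p q h, map_zero]

section LeadingTerm

variable {p q : ℕ}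

lemma isHomogeneousSub_boundaries_dv (p q : ℕ) :
    IsHomogeneousSub (C.isGrading p q).isInternal (boundaries (C.dv p) q) := by
  cases q with
  | zero =>
    rintro i x hx
    rw [(Submodule.mem_bot R[X]).1 hx, map_zero]
    exact zero_mem _
  | succ q =>
    rintro i _ ⟨x, rfl⟩
    exact ⟨_, map_gproj (C.isGrading p q).isInternal (C.isGrading p (q + 1)).isInternal
      (C.dv p q).toAddMonoidHom (C.dv_gr p q) i x⟩

lemma vPart_mem_boundaries_dv (x : Total A) (p q : ℕ) : C.vPart x p q ∈ boundaries (C.dv p) q := by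
  cases q with
  | zero => exact zero_mem _
  | succ q => exact ⟨_, rfl⟩

lemma exists_D_apply_eq_of_mem_boundaries_dv {n : ℤ} (hn : (p + q : ℤ) = n + 1) {x : A p q}
    (hx : x ∈ boundaries (C.dv p) q) : ∃ b ∈ F R A n p, C.D b (p, q) = x := by
  cases q with
  | zero =>
    refine ⟨0, zero_mem _, ?_⟩
    rw [(Submodule.mem_bot R[X]).1 hx, map_zero]
    rfl
  | succ q =>
    obtain ⟨t, rfl⟩ := hx
    refine ⟨inj R A p q ((-1 : ℤ) ^ p • t), inj_mem_F (by lia) le_rfl _, ?_⟩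
    rw [D_apply, hPart_inj, inj_ne (by lia), zero_add, vPart_succ, inj_same, map_zsmul, smul_smul,
      ← pow_add, Even.neg_one_pow ⟨p, rfl⟩, one_smul]

lemma mem_filtered_Z {n m k : ℤ} {x : Total A} :
    x ∈ C.filtered.Z n m k ↔ x ∈ F R A n m ∧ C.D x ∈ F R A (n + 1) k := Iff.rfl

lemma mem_F_succ {n : ℤ} (hn : (p + q : ℤ) = n) {x : Total A} (hx : x ∈ F R A n p)
    (h0 : x (p, q) = 0) : x ∈ F R A n (p + 1) := by
  intro a b hab
  by_cases h : (a + b : ℤ) ≠ n ∨ (a : ℤ) < p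
  · exact hx a b h
  · obtain ⟨rfl, rfl⟩ : a = p ∧ b = q := by lia
    exact h0

lemma dv_eq_zero_of_mem_Z {m : ℤ} (hm : p + 1 ≤ m) {z : Total A}
    (hz : z ∈ C.filtered.Z (p + q) p m) : C.dv p q (z (p, q)) = 0 := by
  obtain ⟨hzF, hDz⟩ := C.mem_filtered_Z.1 hz
  have hDz0 : C.D z (p, q + 1) = 0 := hDz p (q + 1) (by lia)
  rwa [D_apply, C.hPart_eq_zero hzF (by lia), zero_add, vPart_succ,
    ((IsUnit.neg isUnit_one).pow p).smul_eq_zero] at hDz0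

lemma mem_Z_of_dv_eq_zero {z : Total A} (hz : z ∈ F R A (p + q) p)
    (h : C.dv p q (z (p, q)) = 0) : z ∈ C.filtered.Z (p + q) p (p + 1) := by
  refine C.mem_filtered_Z.2 ⟨hz, mem_F_succ (q := q + 1) (by push_cast; ring)
    (C.D_mem_F rfl hz) ?_⟩
  rw [D_apply, C.hPart_eq_zero hz (by lia), vPart_succ, h, smul_zero, add_zero]

end LeadingTerm

section SecondPage

variable {q : ℕ} (K : CochainComplex (ModuleCat.{w} R[X]) ℕ)
  {grK : ∀ p, ℤ → AddSubgroup (K.X p)} (ρ : ∀ p, Submodule R[X] (A p q × K.X p))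

/-- Given relations `ρ p` that present `K.X p` as the cohomology of the `p`-th column in degree `q`,
the relation between a cochain of `K` and the classes on the second page of all elements of the
total complex whose leading term represents it. -/
def secondPageRel (p : ℕ) : Submodule R[X] (K.X p × (C.filtered.page 2).X (p, q)) where
  carrier := {x | ∃ z : Total A,
    (z, x.2) ∈ subquotRel (C.filtered.Z (p + q) p (p + 2)) (C.filtered.B 2 (p + q) p) ∧
      (z (p, q), x.1) ∈ ρ p}
  zero_mem' := ⟨0, zero_mem _, zero_mem _⟩
  add_mem' := fun ⟨z, hz, hzρ⟩ ⟨z', hz', hzρ'⟩ => ⟨z + z', add_mem hz hz', add_mem hzρ hzρ'⟩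
  smul_mem' := fun a _ ⟨z, hz, hzρ⟩ =>
    ⟨a • z, Submodule.smul_mem _ a hz, Submodule.smul_mem _ a hzρ⟩

variable {K ρ}

lemma mem_secondPageRel {p : ℕ} {c : K.X p} {y : (C.filtered.page 2).X (p, q)} :
    (c, y) ∈ C.secondPageRel K ρ p ↔
      ∃ (z : Total A) (hz : z ∈ C.filtered.Z (p + q) p (p + 2)),
        C.filtered.cls 2 (p + q) p ⟨z, hz⟩ = y ∧ (z (p, q), c) ∈ ρ p := by
  constructor
  · rintro ⟨z, hzy, hzc⟩
    obtain ⟨hz, hzy⟩ := mem_subquotRel.1 hzy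
    exact ⟨z, hz, hzy, hzc⟩
  · rintro ⟨z, hz, hzy, hzc⟩
    exact ⟨z, mem_subquotRel.2 ⟨hz, hzy⟩, hzc⟩

variable
  (hρ : ∀ p, IsSubquotientRel (LinearMap.ker (C.dv p q)) (boundaries (C.dv p) q) (C.gr p q) (grK p)
    (ρ p))
  (hd : ∀ p z c, (z, c) ∈ ρ p → (C.dh p q z, (K.d p (p + 1)).hom c) ∈ ρ (p + 1))

include hρ

lemma eq_zero_of_mem_secondPageRel {p : ℕ} {y : (C.filtered.page 2).X (p, q)}
    (hy : (0, y) ∈ C.secondPageRel K ρ p) : y = 0 := by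
  obtain ⟨z, hz, rfl, h0⟩ := C.mem_secondPageRel.1 hy
  obtain ⟨b, hb, hbz⟩ := C.exists_D_apply_eq_of_mem_boundaries_dv (n := p + q - 1) (by lia)
    ((hρ p).mem_zero_iff.1 h0)
  have hDb : C.D b ∈ F R A (p + q) p := C.D_mem_F (by lia) hb
  refine C.filtered.cls_eq_zero.2 ((C.filtered.mem_B (m := p + q - 1) (by lia) rfl).2
    ⟨z - C.D b, C.mem_filtered_Z.2 ⟨mem_F_succ rfl (sub_mem hz.1 hDb) ?_, ?_⟩, b,
      C.mem_filtered_Z.2 ⟨C.filtered.mem_of_le (by lia) hb, C.D_mem_F rfl hb⟩,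
      sub_add_cancel _ _⟩)
  · rw [DirectSum.sub_apply, hbz, sub_self]
  · rw [map_sub, C.D_D, sub_zero]
    exact hz.2

lemma isPresentation_secondPageRel (p : ℕ) :
    IsPresentation (grK p) (C.filtered.pageGr 2 (p, q)) (C.secondPageRel K ρ p) where
  exists_rep y := by
    obtain ⟨⟨z, hz⟩, rfl⟩ := C.filtered.cls_surjective _ _ _ y
    obtain ⟨c, hc⟩ := (hρ p).exists_mem_iff.2 (C.dv_eq_zero_of_mem_Z (by lia) hz)
    exact ⟨c, C.mem_secondPageRel.2 ⟨z, hz, rfl, hc⟩⟩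
  eq_zero hy := C.eq_zero_of_mem_secondPageRel hρ hy
  mem_gr_iff {i y} := by
    constructor
    · rintro ⟨⟨z, hz⟩, hzi, rfl⟩
      obtain ⟨c, hc⟩ := (hρ p).exists_mem_iff.2 (C.dv_eq_zero_of_mem_Z (by lia) hz)
      exact ⟨c, (hρ p).mem_gr_iff.2 ⟨_, hzi p q, hc⟩, C.mem_secondPageRel.2 ⟨z, hz, rfl, hc⟩⟩
    · rintro ⟨c, hci, hcy⟩
      obtain ⟨z, hz, rfl, hzc⟩ := C.mem_secondPageRel.1 hcy
      obtain ⟨x, hxi, hxc⟩ := (hρ p).mem_gr_iff.1 hci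
      have hzx : (z (p, q) - x, 0) ∈ ρ p := by simpa using sub_mem hzc hxc
      have hgzx := (hρ p).mem_zero_iff.2
        (C.isHomogeneousSub_boundaries_dv p q i _ ((hρ p).mem_zero_iff.1 hzx))
      rw [map_sub, gproj_of_mem _ hxi, ← C.gproj_total_apply] at hgzx
      have hgzc : (gproj C.isInternal_totalGr i z (p, q), c) ∈ ρ p := by
        simpa using add_mem hgzx hxc
      have hgz : (c, C.filtered.cls 2 (p + q) p ⟨_, C.filtered.Z_homogeneous _ _ _ i _ hz⟩) ∈
          C.secondPageRel K ρ p := C.mem_secondPageRel.2 ⟨_, _, rfl, hgzc⟩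
      have hsub : (c - c, _ - _) ∈ C.secondPageRel K ρ p := sub_mem hcy hgz
      rw [sub_self] at hsub
      exact ⟨_, gproj_mem C.isInternal_totalGr i z,
        (sub_eq_zero.1 (C.eq_zero_of_mem_secondPageRel hρ hsub)).symm⟩

include hd

lemma exists_mem_secondPageRel {p : ℕ} {c : K.X p} (hc : (K.d p (p + 1)).hom c = 0) :
    ∃ y, (c, y) ∈ C.secondPageRel K ρ p := by
  obtain ⟨x, hx⟩ := (hρ p).exists_rep c
  have hdhx := hd p x c hx
  rw [hc, (hρ (p + 1)).mem_zero_iff] at hdhx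
  obtain ⟨b, hb, hbx⟩ := C.exists_D_apply_eq_of_mem_boundaries_dv (n := p + q) (by lia) hdhx
  set z := inj R A p q x - b with hz
  have hzF : z ∈ F R A (p + q) p :=
    sub_mem (inj_mem_F rfl le_rfl x) (C.filtered.mem_of_le (by lia) hb)
  have hzx : z (p, q) = x := by
    rw [hz, DirectSum.sub_apply, inj_same, hb p q (by lia), sub_zero]
  have hDz : C.D z ∈ F R A (p + q + 1) (p + 1 : ℕ) := by
    have hdv : C.dv p q (z (p, q)) = 0 := hzx ▸ (hρ p).exists_mem_iff.1 ⟨c, hx⟩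
    exact_mod_cast (C.mem_filtered_Z.1 (C.mem_Z_of_dv_eq_zero hzF hdv)).2
  have hDz0 : C.D z (p + 1, q) = 0 := by
    rw [hz, map_sub, DirectSum.sub_apply, hbx, D_apply, hPart_succ, inj_same,
      C.vPart_inj_of_ne (by lia), smul_zero, add_zero, sub_self]
  refine ⟨_, C.mem_secondPageRel.2 ⟨z, C.mem_filtered_Z.2 ⟨hzF, ?_⟩, rfl, hzx ▸ hx⟩⟩
  exact C.filtered.mem_of_le (by lia) (mem_F_succ (by push_cast; ring) hDz hDz0)

lemma d_eq_zero_of_mem_secondPageRel {p : ℕ} {c : K.X p} {y : (C.filtered.page 2).X (p, q)}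
    (hcy : (c, y) ∈ C.secondPageRel K ρ p) : (K.d p (p + 1)).hom c = 0 := by
  obtain ⟨z, hz, rfl, hzc⟩ := C.mem_secondPageRel.1 hcy
  have hDz : C.D z (p + 1, q) = 0 := (C.mem_filtered_Z.1 hz).2 _ _ (by lia)
  rw [D_apply, hPart_succ] at hDz
  refine (hρ (p + 1)).eq_of_mem (hd p _ c hzc) ((hρ (p + 1)).mem_zero_iff.2 ?_)
  rw [eq_neg_of_add_eq_zero_left hDz]
  exact neg_mem (zsmul_mem (C.vPart_mem_boundaries_dv z (p + 1) q) _)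

lemma exists_d_eq_of_mem_secondPageRel_zero {p : ℕ} {c : K.X p}
    (hc : (c, 0) ∈ C.secondPageRel K ρ p) : ∃ j y, (K.d j p).hom y = c := by
  obtain ⟨z, hz, h0, hzc⟩ := C.mem_secondPageRel.1 hc
  obtain ⟨a, ha, b, hb, hab⟩ :=
    (C.filtered.mem_B (m := p + q - 1) (by lia) rfl).1 (C.filtered.cls_eq_zero.1 h0)
  have hzb : z (p, q) = C.hPart b p q + (-1 : ℤ) ^ p • C.vPart b p q := by
    rw [← show a + C.D b = z from hab, DirectSum.add_apply, ha.1 p q (by lia), zero_add, D_apply]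
  have hv := (hρ p).mem_zero_iff.2 (zsmul_mem (C.vPart_mem_boundaries_dv b p q) ((-1 : ℤ) ^ p))
  have hh : (C.hPart b p q, c) ∈ ρ p := by simpa [hzb] using sub_mem hzc hv
  cases p with
  | zero => exact ⟨0, 0, by rw [map_zero]; exact ((hρ 0).eq_zero hh).symm⟩
  | succ p =>
    have hbZ : b ∈ C.filtered.Z (p + q) p (p + 1) := by
      convert hb using 2 <;> push_cast <;> ring
    obtain ⟨c', hc'⟩ := (hρ p).exists_mem_iff.2 (C.dv_eq_zero_of_mem_Z le_rfl hbZ)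
    exact ⟨p, c', (hρ (p + 1)).eq_of_mem (hd p _ _ hc') hh⟩

lemma d_mem_secondPageRel_zero (p : ℕ) (c : K.X p) :
    ((K.d p (p + 1)).hom c, 0) ∈ C.secondPageRel K ρ (p + 1) := by
  obtain ⟨x, hx⟩ := (hρ p).exists_rep c
  have hdvx : C.dv p q (inj R A p q x (p, q)) = 0 := by
    rw [inj_same]
    exact (hρ p).exists_mem_iff.1 ⟨c, hx⟩
  have hxZ := C.mem_Z_of_dv_eq_zero (inj_mem_F rfl le_rfl x) hdvx
  have hDx : C.D (inj R A p q x) ∈ F R A ((p + 1 : ℕ) + q) (p + 1 : ℕ) := by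
    convert (C.mem_filtered_Z.1 hxZ).2 using 2 <;> push_cast <;> ring
  refine C.mem_secondPageRel.2 ⟨_, C.filtered.mem_Z_of_D_eq_zero hDx (C.D_D _),
    C.filtered.cls_eq_zero.2 (C.filtered.D_mem_B (m := p + q) (s := p) (by push_cast; ring)
      (by push_cast; ring) (by exact_mod_cast hxZ)), ?_⟩
  rw [D_apply, hPart_succ, inj_same, C.vPart_inj_of_ne (by lia), smul_zero, add_zero]
  exact hd p _ _ hx

theorem exists_secondPage_iso (p : ℕ) :
    ∃ e : K.homology p ≅ (C.filtered.page 2).X (p, q),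
      ∀ i, (homologyGrading K grK p i).map e.hom.hom.toAddMonoidHom =
        C.filtered.pageGr 2 (p, q) i := by
  have d_eq_zero {c : K.X p} (hc : ∃ y, (c, y) ∈ C.secondPageRel K ρ p) (l : ℕ) :
      (K.d p l).hom c = 0 := by
    obtain ⟨y, hcy⟩ := hc
    by_cases hl : p + 1 = l
    · subst hl
      exact C.d_eq_zero_of_mem_secondPageRel hρ hd hcy
    · rw [K.shape p l (by simpa using hl)]
      rfl
  have d_mem {c : K.X p} (hc : ∃ j y, (K.d j p).hom y = c) : (c, 0) ∈ C.secondPageRel K ρ p := by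
    obtain ⟨j, y, rfl⟩ := hc
    by_cases hj : j + 1 = p
    · subst hj
      exact C.d_mem_secondPageRel_zero hρ hd j y
    · rw [K.shape j p (by simpa using hj)]
      exact zero_mem _
  obtain ⟨e, he⟩ := exists_homology_equiv (C.isPresentation_secondPageRel hρ p)
    (fun c => ⟨d_eq_zero, fun h => C.exists_mem_secondPageRel hρ hd (h (p + 1))⟩)
    (fun c => ⟨C.exists_d_eq_of_mem_secondPageRel_zero hρ hd, d_mem⟩)
  exact ⟨e.toModuleIso, he⟩

end SecondPage

section Augmentation

/-- An augmentation of a double complex by a complex of graded modules such that the augmented rows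
are exact and the kernel of the augmentation is acyclic. -/
structure Augmentation (Q : ℕ → Type*) [∀ q, AddCommGroup (Q q)] [∀ q, Module R[X] (Q q)] where
  /-- the differential of the augmenting complex -/
  d (q : ℕ) : Q q →ₗ[R[X]] Q (q + 1)
  d_d (q : ℕ) (s : Q q) : d (q + 1) (d q s) = 0
  /-- the augmentation -/
  ε (q : ℕ) : Q q →ₗ[R[X]] A 0 q
  ε_d (q : ℕ) (s : Q q) : ε (q + 1) (d q s) = C.dv 0 q (ε q s)
  dh_ε (q : ℕ) (s : Q q) : C.dh 0 q (ε q s) = 0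
  row_exact (p q : ℕ) (x : A (p + 1) q) : C.dh (p + 1) q x = 0 → ∃ y, C.dh p q y = x
  exists_ε (q : ℕ) (x : A 0 q) : C.dh 0 q x = 0 → ∃ s, ε q s = x
  ker_zero (s : Q 0) : d 0 s = 0 → ε 0 s = 0 → s = 0
  ker_succ (q : ℕ) (s : Q (q + 1)) : d (q + 1) s = 0 → ε (q + 1) s = 0 →
    ∃ s', d q s' = s ∧ ε q s' = 0
  /-- the gradings of the augmenting complex -/
  gr (q : ℕ) : ℤ → AddSubgroup (Q q)
  isInternal (q : ℕ) : DirectSum.IsInternal (gr q)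
  d_gr (q : ℕ) (i : ℤ) (s : Q q) (hs : s ∈ gr q i) : d q s ∈ gr (q + 1) i
  ε_gr (q : ℕ) (i : ℤ) (s : Q q) (hs : s ∈ gr q i) : ε q s ∈ C.gr 0 q i

namespace Augmentation

variable {Q : ℕ → Type*} [∀ q, AddCommGroup (Q q)] [∀ q, Module R[X] (Q q)] {C}
  (ξ : C.Augmentation Q)

lemma mem_boundaries_of_ε_eq_zero {q : ℕ} {s : Q q} (hd : ξ.d q s = 0) (hε : ξ.ε q s = 0) :
    s ∈ boundaries ξ.d q := by
  cases q with
  | zero => exact ξ.ker_zero s hd hε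
  | succ q =>
    obtain ⟨s', rfl, -⟩ := ξ.ker_succ q s hd hε
    exact ⟨s', rfl⟩

include ξ in
lemma exists_sub_D_last_column {n : ℤ} {m : ℕ} {y : Total A} (hy : y ∈ F R A n 0)
    (hDy : ∀ p q, C.D y (p + 1, q) = 0) (hm : ∀ p q, m + 1 < p → y (p, q) = 0) :
    ∃ b ∈ F R A (n - 1) 0, ∀ p q, m < p → (y - C.D b) (p, q) = 0 := by
  by_cases hq : ∃ q : ℕ, (m + 1 + q : ℤ) = n
  · obtain ⟨q, hq⟩ := hq
    have hv : C.vPart y (m + 1 + 1) q = 0 := by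
      cases q with
      | zero => rfl
      | succ q => rw [vPart, hm _ _ (by lia), map_zero]
    have hdh : C.dh (m + 1) q (y (m + 1, q)) = 0 := by
      have hD := hDy (m + 1) q
      rwa [D_apply, hPart_succ, hv, smul_zero, add_zero] at hD
    obtain ⟨t, ht⟩ := ξ.row_exact m q _ hdh
    have htF : inj R A m q t ∈ F R A (n - 1) 0 := inj_mem_F (by lia) (by lia) t
    refine ⟨inj R A m q t, htF, fun p q' hp => ?_⟩
    by_cases hpq : p = m + 1 ∧ q' = q
    · obtain ⟨rfl, rfl⟩ := hpq
      rw [DirectSum.sub_apply, D_apply, hPart_succ, inj_same, ht, C.vPart_inj_of_ne (by lia),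
        smul_zero, add_zero, sub_self]
    · by_cases hpm : p = m + 1
      · exact sub_mem hy (C.D_mem_F (by lia) htF) p q' (by lia)
      · rw [DirectSum.sub_apply, hm p q' (by lia), D_apply, hPart_inj, inj_ne (by lia),
          C.vPart_inj_of_ne (by lia), smul_zero, add_zero, sub_zero]
  · refine ⟨0, zero_mem _, fun p q hp => ?_⟩
    rw [map_zero, sub_zero]
    by_cases hpm : p = m + 1
    · exact hy p q (Or.inl fun h => hq ⟨q, by lia⟩)
    · exact hm p q (by lia)

include ξ in
lemma exists_sub_D_of_vanishing {n : ℤ} (m : ℕ) {y : Total A} (hy : y ∈ F R A n 0)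
    (hDy : ∀ p q, C.D y (p + 1, q) = 0) (hm : ∀ p q, m < p → y (p, q) = 0) :
    ∃ b ∈ F R A (n - 1) 0, ∀ p q, (y - C.D b) (p + 1, q) = 0 := by
  induction m generalizing y with
  | zero => exact ⟨0, zero_mem _, fun p q => by rw [map_zero, sub_zero, hm _ _ (by lia)]⟩
  | succ m ih =>
    obtain ⟨b, hb, hbm⟩ := ξ.exists_sub_D_last_column hy hDy hm
    obtain ⟨b', hb', hb'm⟩ := ih (sub_mem hy (C.D_mem_F (by lia) hb))
      (fun p q => by rw [map_sub, C.D_D, sub_zero, hDy]) hbm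
    exact ⟨b + b', add_mem hb hb', fun p q => by rw [map_add, ← sub_sub, hb'm]⟩

lemma eq_inj_of_first_column {n : ℕ} {y : Total A} (hy : y ∈ F R A n 0)
    (h : ∀ p q, y (p + 1, q) = 0) : y = inj R A 0 n (y (0, n)) := by
  refine DFinsupp.ext fun ⟨p, q⟩ => ?_
  cases p with
  | zero =>
    by_cases hq : q = n
    · subst hq
      exact (inj_same 0 q _).symm
    · exact (hy 0 q (by lia)).trans (inj_ne (by lia) _).symm
  | succ p => exact (h p q).trans (inj_ne (by lia) _).symm

include ξ in
lemma exists_sub_D_eq_inj {n : ℕ} {y : Total A} (hy : y ∈ F R A n 0)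
    (hDy : ∀ p q, C.D y (p + 1, q) = 0) :
    ∃ b ∈ F R A (n - 1) 0, ∃ c, y - C.D b = inj R A 0 n c := by
  obtain ⟨b, hb, hyb⟩ := ξ.exists_sub_D_of_vanishing n hy hDy fun p q hp => hy p q (by lia)
  exact ⟨b, hb, _, eq_inj_of_first_column (sub_mem hy (C.D_mem_F (by lia) hb)) hyb⟩

lemma dh_eq_zero_and_dv_eq {q : ℕ} {c : A 0 q} {x : A 0 (q + 1)}
    (h : C.D (inj R A 0 q c) = inj R A 0 (q + 1) x) : C.dh 0 q c = 0 ∧ C.dv 0 q c = x := by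
  constructor
  · have h1 := DFunLike.congr_fun h (1, q)
    rwa [D_apply, C.vPart_inj_of_ne (by lia), hPart_succ, inj_same, smul_zero, add_zero,
      inj_ne (by lia)] at h1
  · have h0 := DFunLike.congr_fun h (0, q + 1)
    rwa [D_apply, vPart_succ, inj_same, inj_same, hPart, pow_zero, one_smul, zero_add] at h0

lemma D_inj_ε (q : ℕ) (s : Q q) :
    C.D (inj R A 0 q (ξ.ε q s)) = inj R A 0 (q + 1) (ξ.ε (q + 1) (ξ.d q s)) := by
  rw [D_inj, ξ.dh_ε, map_zero, pow_zero, one_smul, zero_add, ξ.ε_d]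

lemma exists_cocycle {n : ℕ} {z : Total A} (hz : z ∈ F R A n 0) (hDz : C.D z = 0) :
    ∃ s : Q n, ξ.d n s = 0 ∧ ∃ b ∈ F R A (n - 1) 0, C.D b = z - inj R A 0 n (ξ.ε n s) := by
  obtain ⟨b, hb, c, hc⟩ := ξ.exists_sub_D_eq_inj hz fun p q => by rw [hDz]; rfl
  have hDc : C.D (inj R A 0 n c) = inj R A 0 (n + 1) 0 := by
    rw [← hc, map_sub, C.D_D, hDz, sub_zero, map_zero]
  obtain ⟨hdh, hdv⟩ := dh_eq_zero_and_dv_eq hDc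
  obtain ⟨s, hs⟩ := ξ.exists_ε n c hdh
  obtain ⟨s', hs', hεs'⟩ := ξ.ker_succ n (ξ.d n s) (ξ.d_d n s) (by rw [ξ.ε_d, hs, hdv])
  refine ⟨s - s', by rw [map_sub, hs', sub_self], b, hb, ?_⟩
  rw [map_sub, hεs', sub_zero, hs, ← hc, sub_sub_cancel]

lemma mem_boundaries_of_eq_D {n : ℕ} {s : Q n} (hs : ξ.d n s = 0) {y : Total A}
    (hy : y ∈ F R A (n - 1) 0) (h : inj R A 0 n (ξ.ε n s) = C.D y) : s ∈ boundaries ξ.d n := by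
  cases n with
  | zero =>
    have h0 : y = 0 := C.filtered.eq_zero _ _ _ hy (by lia)
    rw [h0, map_zero] at h
    refine ξ.mem_boundaries_of_ε_eq_zero hs ?_
    rw [← inj_same (R := R) 0 0 (ξ.ε 0 s), h]
    rfl
  | succ m =>
    have hym : y ∈ F R A m 0 := by simpa using hy
    obtain ⟨b, _, c, hc⟩ := ξ.exists_sub_D_eq_inj hym
      fun p q => by rw [← h]; exact inj_ne (by lia) _
    have hDc : C.D (inj R A 0 m c) = inj R A 0 (m + 1) (ξ.ε (m + 1) s) := by
      rw [← hc, map_sub, C.D_D, sub_zero, h]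
    obtain ⟨hdh, hdv⟩ := dh_eq_zero_and_dv_eq hDc
    obtain ⟨s', hs'⟩ := ξ.exists_ε m c hdh
    have hss' := ξ.mem_boundaries_of_ε_eq_zero (s := s - ξ.d m s')
      (by rw [map_sub, hs, ξ.d_d, sub_zero]) (by rw [map_sub, ξ.ε_d, hs', hdv, sub_self])
    have hds' : ξ.d m s' ∈ boundaries ξ.d (m + 1) := ⟨s', rfl⟩
    simpa using add_mem hss' hds'

lemma exists_D_eq_of_mem_boundaries {n : ℕ} {s : Q n} (hs : s ∈ boundaries ξ.d n) :
    ∃ b ∈ F R A (n - 1) 0, C.D b = inj R A 0 n (ξ.ε n s) := by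
  cases n with
  | zero =>
    refine ⟨0, zero_mem _, ?_⟩
    rw [(Submodule.mem_bot R[X]).1 hs, map_zero, map_zero, map_zero]
  | succ n =>
    obtain ⟨s', rfl⟩ := hs
    exact ⟨inj R A 0 n (ξ.ε n s'), inj_mem_F (by push_cast; ring) (by lia) _, ξ.D_inj_ε n s'⟩

section TotalRel

variable {H : ℕ → Type*} [∀ n, AddCommGroup (H n)] [∀ n, Module R[X] (H n)]
  {grH : ∀ n, ℤ → AddSubgroup (H n)} (ρ : ∀ n, Submodule R[X] (Q n × H n))

/-- The relation obtained from relations `ρ n` between cochains of the augmenting complex and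
`H n` by relating every total cochain to the classes of the augmentations cohomologous to it. -/
def totalRel (n : ℕ) : Submodule R[X] (Total A × H n) where
  carrier := {x | ∃ s, (s, x.2) ∈ ρ n ∧ ∃ b ∈ F R A (n - 1) 0, C.D b = x.1 - inj R A 0 n (ξ.ε n s)}
  zero_mem' := ⟨0, zero_mem _, 0, zero_mem _, by simp⟩
  add_mem' := by
    rintro x x' ⟨s, hs, b, hb, h⟩ ⟨s', hs', b', hb', h'⟩
    refine ⟨s + s', add_mem hs hs', b + b', add_mem hb hb', ?_⟩
    rw [map_add C.D, h, h', map_add (ξ.ε n), map_add (inj R A 0 n), Prod.fst_add, add_sub_add_comm]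
  smul_mem' := by
    rintro a x ⟨s, hs, b, hb, h⟩
    refine ⟨a • s, Submodule.smul_mem _ a hs, a • b, Submodule.smul_mem _ a hb, ?_⟩
    rw [map_smul C.D, h, map_smul, map_smul, smul_sub, Prod.smul_fst]

variable {ρ}

lemma mk_inj_ε_mem_totalRel {n : ℕ} {s : Q n} {h : H n} (hs : (s, h) ∈ ρ n) :
    (inj R A 0 n (ξ.ε n s), h) ∈ ξ.totalRel ρ n :=
  ⟨s, hs, 0, zero_mem _, by rw [map_zero, sub_self]⟩

lemma D_mk_zero_mem_totalRel {n : ℕ} {b : Total A} (hb : b ∈ F R A (n - 1) 0) :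
    (C.D b, 0) ∈ ξ.totalRel ρ n :=
  ⟨0, zero_mem _, b, hb, by rw [map_zero, map_zero, sub_zero]⟩

variable (hρ : ∀ n, IsSubquotientRel (LinearMap.ker (ξ.d n)) (boundaries ξ.d n) (ξ.gr n) (grH n)
  (ρ n))

include hρ

lemma eq_zero_of_mem_totalRel {n : ℕ} {h : H n} (hh : (0, h) ∈ ξ.totalRel ρ n) : h = 0 := by
  obtain ⟨s, hs, b, hb, hDb⟩ := hh
  have hsB := ξ.mem_boundaries_of_eq_D ((hρ n).exists_mem_iff.1 ⟨h, hs⟩) (neg_mem hb)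
    (by rw [map_neg, hDb, zero_sub, neg_neg])
  exact (hρ n).eq_of_mem hs ((hρ n).mem_zero_iff.2 hsB)

lemma mem_gr_of_mem_totalRel {n : ℕ} {i : ℤ} {z : Total A} (hz : z ∈ C.totalGr i) {h : H n}
    (hzh : (z, h) ∈ ξ.totalRel ρ n) : h ∈ grH n i := by
  obtain ⟨s, hs, b, hb, hDb⟩ := id hzh
  have hds : ξ.d n (gproj (ξ.isInternal n) i s) = 0 :=
    isHomogeneousSub_ker (ξ.isInternal n) (ξ.isInternal (n + 1)) (ξ.d_gr n) i s
      ((hρ n).exists_mem_iff.1 ⟨h, hs⟩)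
  obtain ⟨h', hh'⟩ := (hρ n).exists_mem_iff.2 hds
  have hD : C.D (gproj C.isInternal_totalGr i b) = gproj C.isInternal_totalGr i (C.D b) :=
    map_gproj C.isInternal_totalGr C.isInternal_totalGr C.D.toAddMonoidHom C.D_mem_totalGr i b
  have hε : inj R A 0 n (ξ.ε n (gproj (ξ.isInternal n) i s)) =
      gproj C.isInternal_totalGr i (inj R A 0 n (ξ.ε n s)) :=
    map_gproj (ξ.isInternal n) C.isInternal_totalGr (inj R A 0 n ∘ₗ ξ.ε n).toAddMonoidHom
      (fun i s hs => C.inj_mem_totalGr (ξ.ε_gr n i s hs)) i s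
  have hzh' : (z, h') ∈ ξ.totalRel ρ n := by
    refine ⟨_, hh', gproj C.isInternal_totalGr i b, C.filtered.F_homogeneous _ _ i b hb, ?_⟩
    rw [hD, hε, hDb, map_sub, gproj_of_mem C.isInternal_totalGr hz]
  have hhh' : h - h' = 0 :=
    ξ.eq_zero_of_mem_totalRel hρ (by simpa using sub_mem hzh hzh')
  rw [sub_eq_zero.1 hhh']
  exact (hρ n).mem_gr_iff.2 ⟨_, gproj_mem _ i s, hh'⟩

lemma exists_mem_totalRel_iff {n : ℕ} {z : Total A} :
    (∃ h, (z, h) ∈ ξ.totalRel ρ n) ↔ z ∈ F R A n 0 ∧ C.D z = 0 := by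
  constructor
  · rintro ⟨h, s, hs, b, hb, hDb⟩
    have hds : ξ.d n s = 0 := (hρ n).exists_mem_iff.1 ⟨h, hs⟩
    rw [← sub_add_cancel z (inj R A 0 n (ξ.ε n s)), ← hDb]
    refine ⟨add_mem (C.D_mem_F (by lia) hb) (inj_mem_F (by lia) (by lia) _), ?_⟩
    rw [map_add, C.D_D, D_inj_ε, hds, map_zero, map_zero, add_zero]
  · rintro ⟨hz, hDz⟩
    obtain ⟨s, hs, b, hb, hDb⟩ := ξ.exists_cocycle hz hDz
    obtain ⟨h, hh⟩ := (hρ n).exists_mem_iff.2 hs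
    exact ⟨h, s, hh, b, hb, hDb⟩

lemma presentsCohomology_totalRel : C.filtered.PresentsCohomology grH (ξ.totalRel ρ) := fun n =>
  { exists_rep := fun h => by
      obtain ⟨s, hs⟩ := (hρ n).exists_rep h
      exact ⟨_, ξ.mk_inj_ε_mem_totalRel hs⟩
    eq_zero := ξ.eq_zero_of_mem_totalRel hρ
    mem_gr_iff := by
      refine ⟨fun hh => ?_, fun ⟨z, hz, hzh⟩ => ξ.mem_gr_of_mem_totalRel hρ hz hzh⟩
      obtain ⟨s, hsi, hs⟩ := (hρ n).mem_gr_iff.1 hh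
      exact ⟨_, C.inj_mem_totalGr (ξ.ε_gr n _ s hsi), ξ.mk_inj_ε_mem_totalRel hs⟩
    exists_mem_iff := ξ.exists_mem_totalRel_iff hρ
    mem_zero_iff := by
      refine ⟨fun ⟨s, hs, b, hb, hDb⟩ => ?_, fun ⟨b, hb, hDb⟩ => hDb ▸ ξ.D_mk_zero_mem_totalRel hb⟩
      obtain ⟨b', hb', hDb'⟩ := ξ.exists_D_eq_of_mem_boundaries ((hρ n).mem_zero_iff.1 hs)
      refine ⟨b + b', add_mem hb hb', (map_add C.D b b').trans ?_⟩
      rw [hDb, hDb', sub_add_cancel] }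

end TotalRel

end Augmentation

end Augmentation

end DoubleComplex

/-! ### Inserting an index into an increasing sequence -/

section Insertion

variable {ι : Type*} [LinearOrder ι] {p : ℕ}

lemma range_eq_insert_range_cechFace (τ : Fin (p + 2) ↪o ι) (k : Fin (p + 2)) :
    Set.range τ = insert (τ k) (Set.range (cechFace τ k)) := by
  change Set.range τ = insert (τ k) (Set.range (τ ∘ k.succAbove))
  rw [Set.range_comp, Fin.range_succAbove, ← Set.image_insert_eq, Set.insert_eq,
    Set.union_compl_self, Set.image_univ]

lemma notMem_range_cechFace (τ : Fin (p + 2) ↪o ι) (k : Fin (p + 2)) :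
    τ k ∉ Set.range (cechFace τ k) := by
  rintro ⟨l, hl⟩
  exact Fin.succAbove_ne k l (τ.injective hl)

lemma eq_and_eq_of_cechFace_eq {τ τ' : Fin (p + 2) ↪o ι} {k k' : Fin (p + 2)}
    (h : τ k = τ' k') (hface : cechFace τ k = cechFace τ' k') : τ = τ' ∧ k = k' := by
  have hτ : τ = τ' := OrderEmbedding.range_inj.1 <| by
    rw [range_eq_insert_range_cechFace τ k, range_eq_insert_range_cechFace τ' k', h, hface]
  subst hτ
  exact ⟨rfl, τ.injective h⟩

lemma exists_cechFace_eq {m : ι} {σ : Fin (p + 1) ↪o ι} (hm : m ∉ Set.range σ) :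
    ∃ (τ : Fin (p + 2) ↪o ι) (k : Fin (p + 2)), τ k = m ∧ cechFace τ k = σ := by
  have hm' : m ∉ Finset.univ.map σ.toEmbedding := by simpa using hm
  have hcard : (insert m (Finset.univ.map σ.toEmbedding)).card = p + 2 := by
    rw [Finset.card_insert_of_notMem hm', Finset.card_map, Finset.card_fin]
  obtain ⟨τ, hτ⟩ : ∃ τ : Fin (p + 2) ↪o ι, Set.range τ = insert m (Set.range σ) :=
    ⟨_, (Finset.range_orderEmbOfFin _ hcard).trans (by simp)⟩
  obtain ⟨k, rfl⟩ : m ∈ Set.range τ := hτ ▸ Set.mem_insert _ _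
  refine ⟨τ, k, rfl, OrderEmbedding.range_inj.1 ?_⟩
  rw [range_eq_insert_range_cechFace τ k] at hτ
  rw [← Set.insert_sdiff_self_of_notMem (notMem_range_cechFace τ k), hτ,
    Set.insert_sdiff_self_of_notMem hm]

lemma cechFace_cechFace_succAbove (τ : Fin (p + 3) ↪o ι) (k : Fin (p + 3)) (j : Fin (p + 2)) :
    cechFace (cechFace τ (k.succAbove j)) (j.predAbove k) = cechFace (cechFace τ k) j :=
  RelEmbedding.ext fun l => congrArg τ (Fin.succAbove_succAbove_succAbove_predAbove k j l)

variable {G : Type*} [AddCommGroup G]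

open Classical in
/-- The contraction of the alternating cochains on the full simplex with vertex set `ι` given by
the vertex `m`. Its value at `α₀ < ⋯ < αₚ` is that of `x` at `(m, α₀, …, αₚ)`: up to sign, this is
the value at the increasing rearrangement, and it is zero if `m` is one of the `αⱼ`. -/
def insertHomotopy (m : ι) (x : (Fin (p + 2) ↪o ι) → G) (σ : Fin (p + 1) ↪o ι) : G :=
  if h : ∃ τk : (Fin (p + 2) ↪o ι) × Fin (p + 2), τk.1 τk.2 = m ∧ cechFace τk.1 τk.2 = σ then
    (-1 : ℤ) ^ (h.choose.2 : ℕ) • x h.choose.1 else 0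

lemma insertHomotopy_cechFace (x : (Fin (p + 2) ↪o ι) → G) (τ : Fin (p + 2) ↪o ι)
    (k : Fin (p + 2)) :
    insertHomotopy (τ k) x (cechFace τ k) = (-1 : ℤ) ^ (k : ℕ) • x τ := by
  have h : ∃ τk : (Fin (p + 2) ↪o ι) × Fin (p + 2),
    τk.1 τk.2 = τ k ∧ cechFace τk.1 τk.2 = cechFace τ k := ⟨(τ, k), rfl, rfl⟩
  obtain ⟨hτ, hk⟩ := eq_and_eq_of_cechFace_eq h.choose_spec.1 h.choose_spec.2
  rw [insertHomotopy, dif_pos h, hτ, hk]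

lemma insertHomotopy_of_mem_range {m : ι} {σ : Fin (p + 1) ↪o ι} (hm : m ∈ Set.range σ)
    (x : (Fin (p + 2) ↪o ι) → G) : insertHomotopy m x σ = 0 := by
  refine dif_neg ?_
  rintro ⟨⟨τ, k⟩, rfl, rfl⟩
  exact notMem_range_cechFace τ k hm

lemma sum_insertHomotopy_of_mem_range {m : ι} {σ : Fin (p + 2) ↪o ι} (hm : m ∈ Set.range σ)
    (x : (Fin (p + 2) ↪o ι) → G) :
    ∑ j : Fin (p + 2), (-1 : ℤ) ^ (j : ℕ) • insertHomotopy m x (cechFace σ j) = x σ := by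
  obtain ⟨k, rfl⟩ := hm
  rw [Finset.sum_eq_single k, insertHomotopy_cechFace, smul_smul, ← mul_pow, neg_one_mul, neg_neg,
    one_pow, one_smul]
  · intro j _ hjk
    obtain ⟨l, hl⟩ := Fin.exists_succAbove_eq hjk.symm
    rw [insertHomotopy_of_mem_range ⟨l, congrArg σ hl⟩, smul_zero]
  · exact fun h => absurd (Finset.mem_univ k) h

lemma sum_insertHomotopy_of_cocycle (x : (Fin (p + 2) ↪o ι) → G) {τ : Fin (p + 3) ↪o ι}
    (hx : ∑ j : Fin (p + 3), (-1 : ℤ) ^ (j : ℕ) • x (cechFace τ j) = 0) (k : Fin (p + 3)) :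
    ∑ j : Fin (p + 2), (-1 : ℤ) ^ (j : ℕ) • insertHomotopy (τ k) x (cechFace (cechFace τ k) j) =
      x (cechFace τ k) := by
  have hterm (j : Fin (p + 2)) :
      (-1 : ℤ) ^ (j : ℕ) • insertHomotopy (τ k) x (cechFace (cechFace τ k) j) =
        -((-1 : ℤ) ^ (k : ℕ) •
          ((-1 : ℤ) ^ (k.succAbove j : ℕ) • x (cechFace τ (k.succAbove j)))) := by
    have hk : τ k = cechFace τ (k.succAbove j) (j.predAbove k) :=
      congrArg τ (Fin.succAbove_succAbove_predAbove k j).symm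
    rw [← cechFace_cechFace_succAbove, hk, insertHomotopy_cechFace, smul_smul, smul_smul,
      ← neg_smul]
    congr 1
    have hsign := Fin.neg_one_pow_succAbove_add_predAbove (R := ℤ) k j
    rw [pow_add, pow_add] at hsign
    have hsq (n : ℕ) : (-1 : ℤ) ^ n * (-1) ^ n = 1 := by simp [← mul_pow]
    linear_combination (-1 : ℤ) ^ (j : ℕ) * (-1) ^ (k.succAbove j : ℕ) * hsign -
      (-1 : ℤ) ^ (j : ℕ) * (-1) ^ (j.predAbove k : ℕ) * hsq (k.succAbove j) -
      (-1 : ℤ) ^ (k : ℕ) * (-1) ^ (k.succAbove j : ℕ) * hsq j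
  rw [Fin.sum_univ_succAbove _ k, add_eq_zero_iff_neg_eq] at hx
  rw [Finset.sum_congr rfl fun j _ => hterm j, Finset.sum_neg_distrib, ← Finset.smul_sum, ← hx,
    smul_neg, neg_neg, smul_smul, ← mul_pow, neg_one_mul, neg_neg, one_pow, one_smul]

lemma sum_insertHomotopy {J : Set ι} {m : ι} (hm : m ∈ J) {x : (Fin (p + 2) ↪o ι) → G}
    (hx : ∀ τ : Fin (p + 3) ↪o ι, (∀ k, τ k ∈ J) →
      ∑ j : Fin (p + 3), (-1 : ℤ) ^ (j : ℕ) • x (cechFace τ j) = 0)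
    {σ : Fin (p + 2) ↪o ι} (hσ : ∀ k, σ k ∈ J) :
    ∑ j : Fin (p + 2), (-1 : ℤ) ^ (j : ℕ) • insertHomotopy m x (cechFace σ j) = x σ := by
  by_cases hmσ : m ∈ Set.range σ
  · exact sum_insertHomotopy_of_mem_range hmσ x
  · obtain ⟨τ, k, rfl, rfl⟩ := exists_cechFace_eq hmσ
    exact sum_insertHomotopy_of_cocycle x (hx τ (Fin.succAboveCases k hm hσ)) k

end Insertion

/-! ### Singular cochains of subspaces -/

lemma alternatingCofaceMapComplex_d_apply {R : Type v} [CommRing R]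
    (Y : CosimplicialObject (ModuleCat.{w} R)) (q : ℕ)
    (x : ((AlgebraicTopology.alternatingCofaceMapComplex _).obj Y).X q) :
    (((AlgebraicTopology.alternatingCofaceMapComplex _).obj Y).d q (q + 1)).hom x =
      ∑ j : Fin (q + 2), (-1 : ℤ) ^ (j : ℕ) • (Y.δ j).hom x := by
  have h : ((AlgebraicTopology.alternatingCofaceMapComplex _).obj Y).d q (q + 1) =
      AlgebraicTopology.AlternatingCofaceMapComplex.objD Y q :=
    CochainComplex.of_d _ (AlgebraicTopology.AlternatingCofaceMapComplex.objD Y) _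
  rw [h, AlgebraicTopology.AlternatingCofaceMapComplex.objD]
  refine (LinearMap.congr_fun (ModuleCat.hom_sum _ _) x).trans ?_
  rw [LinearMap.sum_apply]
  rfl

section SubspaceCochains

/-- The singular cochain complex as a contravariant functor of the subspaces of `X`. -/
def subspaceCochains (R : Type v) [CommRing R] (X : Type u) [TopologicalSpace X] :
    (Set X)ᵒᵖ ⥤ CochainComplex (ModuleCat.{max u v} R) ℕ :=
  (subspaceFunctor X).op ⋙ singularCochainFunctor R

variable (R : Type v) [CommRing R] {X : Type u} [TopologicalSpace X]

/-- The singular `q`-cochains of the subspace `B`. -/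
abbrev singularCochains (B : Set X) (q : ℕ) : ModuleCat.{max u v} R :=
  ((subspaceCochains R X).obj (op B)).X q

variable {R}

/-- The coboundary of singular cochains of the subspace `B`. -/
abbrev singularD (B : Set X) (q : ℕ) : singularCochains R B q →ₗ[R] singularCochains R B (q + 1) :=
  (((subspaceCochains R X).obj (op B)).d q (q + 1)).hom

/-- The restriction of singular cochains to a smaller subspace. -/
abbrev resCochain {B B' : Set X} (h : B ⊆ B') (q : ℕ) :
    singularCochains R B' q →ₗ[R] singularCochains R B q :=
  (((subspaceCochains R X).map (homOfLE h).op).f q).hom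

/-- The singular simplices of a subspace are the continuous maps from a standard simplex. -/
def simplexEquiv (B : Set X) (q : ℕ) :
    (TopCat.toSSet.obj (TopCat.of B)).obj (op (SimplexCategory.mk q)) ≃ C(Simp (q + 1), B) :=
  TopCat.toSSetObjEquiv (TopCat.of B) (op (SimplexCategory.mk q))

/-- A singular cochain of a subspace as a function on continuous maps. -/
def cochainEquiv (B : Set X) (q : ℕ) : singularCochains R B q ≃ₗ[R] (C(Simp (q + 1), B) → R) :=
  LinearEquiv.funCongrLeft R R (simplexEquiv B q).symm

lemma cochainEquiv_d (B : Set X) (q : ℕ) (x : singularCochains R B q) :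
    cochainEquiv B (q + 1) (singularD B q x) = coboundary (cochainEquiv B q x) := by
  funext s
  refine (congrFun (congrArg (cochainEquiv B (q + 1)) (alternatingCofaceMapComplex_d_apply
    (((CosimplicialObject.whiskering _ _).obj (functionsFunctor R)).obj
      ((simplicialCosimplicialEquiv (Type u)).functor.obj
        (op (TopCat.toSSet.obj (TopCat.of B))))) q x)) s).trans ?_
  refine (congrFun (map_sum (cochainEquiv B (q + 1)) _ _) s).trans ?_
  rw [Finset.sum_apply, coboundary]
  refine Finset.sum_congr rfl fun j _ => ?_
  refine (congrFun (map_zsmul (cochainEquiv B (q + 1)) _ _) s).trans ?_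
  rw [Pi.smul_apply]
  congr 1
  refine congrArg (fun s' : C(Simp (q + 1), B) => x ((simplexEquiv B q).symm s')) ?_
    (a₁ := s.comp ⟨_, stdSimplex.continuous_map (j.succAbove)⟩)
  ext t
  exact congrArg (fun t => (s t : X)) (map_eq_affineSimplex _ t)

/-- A simplex of `X` with values in `B`, as a simplex of `B`. -/
def liftSimplex {n : ℕ} {B : Set X} (s : C(Simp n, X)) (h : ∀ t, s t ∈ B) : C(Simp n, B) :=
  ⟨fun t => ⟨s t, h t⟩, s.continuous.subtype_mk h⟩

/-- The inclusion of a subspace. -/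
def valMap (B : Set X) : C(B, X) := ⟨Subtype.val, continuous_subtype_val⟩

variable {q : ℕ}

open Classical in
/-- The value of a singular cochain of the subspace `B` on a simplex of `X`, which is zero if the
simplex does not lie in `B`. -/
def evalAt (B : Set X) (s : C(Simp (q + 1), X)) : singularCochains R B q →ₗ[R] R :=
  if h : ∀ t, s t ∈ B then LinearMap.proj (liftSimplex s h) ∘ₗ (cochainEquiv B q).toLinearMap else 0

lemma evalAt_of_mem {B : Set X} {s : C(Simp (q + 1), X)} (h : ∀ t, s t ∈ B)
    (x : singularCochains R B q) : evalAt B s x = cochainEquiv B q x (liftSimplex s h) := by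
  rw [evalAt, dif_pos h]
  rfl

lemma evalAt_resCochain {B B' : Set X} (hB : B ⊆ B') {s : C(Simp (q + 1), X)}
    (h : ∀ t, s t ∈ B) (x : singularCochains R B' q) :
    evalAt B s (resCochain hB q x) = evalAt B' s x := by
  rw [evalAt_of_mem h, evalAt_of_mem fun t => hB (h t)]
  rfl

lemma singularCochains_ext {B : Set X} {x y : singularCochains R B q}
    (h : ∀ s : C(Simp (q + 1), X), (∀ t, s t ∈ B) → evalAt B s x = evalAt B s y) : x = y := by
  refine (cochainEquiv B q).injective (funext fun s => ?_)
  have := h ((valMap B).comp s) fun t => (s t).2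
  rwa [evalAt_of_mem fun t => (s t).2, evalAt_of_mem fun t => (s t).2] at this

/-- The singular cochain of `B` given by a function on the simplices of `X`. -/
def cochainOf (B : Set X) (φ : C(Simp (q + 1), X) → R) : singularCochains R B q :=
  (cochainEquiv B q).symm fun s => φ ((valMap B).comp s)

lemma evalAt_cochainOf {B : Set X} (φ : C(Simp (q + 1), X) → R) {s : C(Simp (q + 1), X)}
    (h : ∀ t, s t ∈ B) : evalAt B s (cochainOf B φ) = φ s := by
  rw [evalAt_of_mem h, cochainOf, LinearEquiv.apply_symm_apply]
  rfl

/-! ### Exactness of the Čech complex of singular cochains -/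

section Exactness

variable {Y : Type*} [TopologicalSpace Y] {f : C(X, Y)} {ι : Type w} {U : ι → Set Y}

variable (f U) in
/-- The indices of the members of the cover which contain the image of a simplex. -/
def simplexIndices {n : ℕ} (s : C(Simp n, X)) : Set ι := {a | ∀ t, f (s t) ∈ U a}

variable [LinearOrder ι] {A : Set X} {p : ℕ}

lemma forall_mem_cechInter_iff {n : ℕ} {σ : Fin (p + 1) ↪o ι} {s : C(Simp n, X)} :
    (∀ t, s t ∈ A ∩ f ⁻¹' cechInter U σ) ↔ (∀ t, s t ∈ A) ∧ ∀ k, σ k ∈ simplexIndices f U s := by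
  simp only [cechInter, Set.mem_inter_iff, Set.mem_preimage, Set.mem_iInter, simplexIndices,
    Set.mem_ofPred_eq]
  exact ⟨fun h => ⟨fun t => (h t).1, fun k t => (h t).2 k⟩, fun h t => ⟨h.1 t, fun k => h.2 k t⟩⟩

lemma inter_preimage_cechInter_subset (f : C(X, Y)) (U : ι → Set Y) (A : Set X)
    (σ : Fin (p + 2) ↪o ι) (j : Fin (p + 2)) :
    A ∩ f ⁻¹' cechInter U σ ⊆ A ∩ f ⁻¹' cechInter U (cechFace σ j) :=
  Set.inter_subset_inter_right _ (Set.preimage_mono (cechInter_subset U σ j))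

/-- The Čech differential of a family of singular cochains on the sets `A ∩ f⁻¹(U_{α₀…αₚ})`. -/
def singularCechDelta (x : ∀ σ : Fin (p + 1) ↪o ι, singularCochains R (A ∩ f ⁻¹' cechInter U σ) q)
    (τ : Fin (p + 2) ↪o ι) : singularCochains R (A ∩ f ⁻¹' cechInter U τ) q :=
  ∑ j : Fin (p + 2), (-1 : ℤ) ^ (j : ℕ) •
    resCochain (inter_preimage_cechInter_subset f U A τ j) q (x (cechFace τ j))

lemma singularCechDelta_zero (τ : Fin (p + 2) ↪o ι) :
    singularCechDelta (R := R) (f := f) (U := U) (A := A) (q := q) 0 τ = 0 :=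
  Finset.sum_eq_zero fun _ _ => (congrArg _ (map_zero _)).trans (smul_zero _)

lemma singularCechDelta_resCochain (x : singularCochains R A q) (τ : Fin 2 ↪o ι) :
    singularCechDelta (f := f) (U := U) (fun _ => resCochain Set.inter_subset_left q x) τ = 0 := by
  have hres (j : Fin 2) : resCochain (inter_preimage_cechInter_subset f U A τ j) q
      (resCochain Set.inter_subset_left q x) = resCochain Set.inter_subset_left q x := rfl
  rw [singularCechDelta, Fin.sum_univ_two, hres, hres]
  simp only [Fin.val_zero, pow_zero, one_smul, Fin.val_one, pow_one, neg_smul, add_neg_cancel]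

lemma evalAt_singularCechDelta
    (x : ∀ σ : Fin (p + 1) ↪o ι, singularCochains R (A ∩ f ⁻¹' cechInter U σ) q)
    {τ : Fin (p + 2) ↪o ι} {s : C(Simp (q + 1), X)} (hs : ∀ t, s t ∈ A ∩ f ⁻¹' cechInter U τ) :
    evalAt (A ∩ f ⁻¹' cechInter U τ) s (singularCechDelta x τ) =
      ∑ j : Fin (p + 2), (-1 : ℤ) ^ (j : ℕ) • evalAt _ s (x (cechFace τ j)) := by
  rw [singularCechDelta, map_sum]
  refine Finset.sum_congr rfl fun j _ => ?_
  rw [map_zsmul, evalAt_resCochain _ hs]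

-- On each simplex, the Čech complex is the cochain complex of the full simplex whose vertices are
-- the members of the cover containing that simplex, and any such vertex contracts it.
lemma exists_singularCechDelta_eq
    {x : ∀ σ : Fin (p + 2) ↪o ι, singularCochains R (A ∩ f ⁻¹' cechInter U σ) q}
    (hx : ∀ τ, singularCechDelta x τ = 0) :
    ∃ y : ∀ σ : Fin (p + 1) ↪o ι, singularCochains R (A ∩ f ⁻¹' cechInter U σ) q,
      ∀ σ, singularCechDelta y σ = x σ := by
  classical
  refine ⟨fun σ => cochainOf _ fun s => if h : (simplexIndices f U s).Nonempty then
    insertHomotopy h.some (fun τ => evalAt _ s (x τ)) σ else 0,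
    fun σ => singularCochains_ext fun s hs => ?_⟩
  obtain ⟨hA, hσ⟩ := forall_mem_cechInter_iff.1 hs
  have hne : (simplexIndices f U s).Nonempty := ⟨_, hσ 0⟩
  have hcocycle (τ : Fin (p + 3) ↪o ι) (hτ : ∀ k, τ k ∈ simplexIndices f U s) :
      ∑ j : Fin (p + 3), (-1 : ℤ) ^ (j : ℕ) • evalAt _ s (x (cechFace τ j)) = 0 := by
    rw [← evalAt_singularCechDelta x (forall_mem_cechInter_iff.2 ⟨hA, hτ⟩), hx, map_zero]
  rw [evalAt_singularCechDelta _ hs,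
    ← sum_insertHomotopy (x := fun τ => evalAt _ s (x τ)) hne.some_mem hcocycle hσ]
  refine Finset.sum_congr rfl fun j _ => ?_
  rw [evalAt_cochainOf _ fun t => inter_preimage_cechInter_subset f U A σ j (hs t), dif_pos hne]

lemma evalAt_eq_of_singularCechDelta_eq_zero
    {x : ∀ σ : Fin 1 ↪o ι, singularCochains R (A ∩ f ⁻¹' cechInter U σ) q}
    (hx : ∀ τ, singularCechDelta x τ = 0) {s : C(Simp (q + 1), X)} (hA : ∀ t, s t ∈ A)
    {σ σ' : Fin 1 ↪o ι} (hσ : σ 0 ∈ simplexIndices f U s) (hσ' : σ' 0 ∈ simplexIndices f U s) :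
    evalAt _ s (x σ) = evalAt _ s (x σ') := by
  wlog hlt : σ 0 < σ' 0 generalizing σ σ'
  · rcases (not_lt.1 hlt).lt_or_eq with h | h
    · exact (this hσ' hσ h).symm
    · rw [show σ = σ' from RelEmbedding.ext fun l => by rw [Subsingleton.elim l 0, h]]
  have hmono : StrictMono ![σ 0, σ' 0] := by simpa [Fin.strictMono_iff_lt_succ] using hlt
  obtain ⟨τ, hτ⟩ : ∃ τ : Fin 2 ↪o ι, ⇑τ = ![σ 0, σ' 0] :=
    ⟨OrderEmbedding.ofStrictMono _ hmono, rfl⟩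
  have hface₀ : cechFace τ 0 = σ' := RelEmbedding.ext fun (l : Fin 1) => by
    rw [Subsingleton.elim l 0]
    exact congrFun hτ 1
  have hface₁ : cechFace τ 1 = σ := RelEmbedding.ext fun (l : Fin 1) => by
    rw [Subsingleton.elim l 0]
    exact congrFun hτ 0
  have hs : ∀ t, s t ∈ A ∩ f ⁻¹' cechInter U τ :=
    forall_mem_cechInter_iff.2 ⟨hA, fun k => by fin_cases k <;> simpa [hτ]⟩
  have hsum := evalAt_singularCechDelta x hs
  rw [hx, map_zero, Fin.sum_univ_two, hface₀, hface₁] at hsum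
  simp only [Fin.val_zero, pow_zero, one_smul, Fin.val_one, pow_one, neg_smul] at hsum
  exact (add_neg_eq_zero.1 hsum.symm).symm

/-- The sequence consisting of one element. -/
def singleEmb (m : ι) : Fin 1 ↪o ι :=
  OrderEmbedding.ofStrictMono (fun _ => m) (Subsingleton.strictMono _)

lemma exists_resCochain_eq
    {x : ∀ σ : Fin 1 ↪o ι, singularCochains R (A ∩ f ⁻¹' cechInter U σ) q}
    (hx : ∀ τ, singularCechDelta x τ = 0) :
    ∃ y : singularCochains R A q, ∀ σ, resCochain Set.inter_subset_left q y = x σ := by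
  classical
  refine ⟨cochainOf _ fun s => if h : (simplexIndices f U s).Nonempty then
    evalAt _ s (x (singleEmb h.some)) else 0, fun σ => singularCochains_ext fun s hs => ?_⟩
  obtain ⟨hA, hσ⟩ := forall_mem_cechInter_iff.1 hs
  have hne : (simplexIndices f U s).Nonempty := ⟨_, hσ 0⟩
  rw [evalAt_resCochain _ hs, evalAt_cochainOf _ hA, dif_pos hne]
  exact evalAt_eq_of_singularCechDelta_eq_zero hx hA hne.some_mem (hσ 0)

lemma forall_resCochain_eq_zero_iff {x : singularCochains R A q} :
    (∀ σ : Fin 1 ↪o ι, resCochain (Set.inter_subset_left : A ∩ f ⁻¹' cechInter U σ ⊆ A) q x = 0) ↔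
      VanishesOnSmall (fun a => {z : A | f z ∈ U a}) (cochainEquiv A q x) := by
  constructor
  · intro hx s a h
    have hs := (forall_mem_cechInter_iff (A := A) (f := f) (U := U) (σ := singleEmb a)
      (s := (valMap A).comp s)).2 ⟨fun t => (s t).2, fun _ => h⟩
    have h0 := evalAt_resCochain Set.inter_subset_left hs x
    rw [hx, map_zero, evalAt_of_mem fun t => (s t).2] at h0
    exact h0.symm
  · refine fun hx σ => singularCochains_ext fun s hs => ?_
    obtain ⟨hA, hσ⟩ := forall_mem_cechInter_iff.1 hs
    rw [evalAt_resCochain _ hs, map_zero, evalAt_of_mem hA]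
    exact hx _ (σ 0) (hσ 0)

lemma eq_zero_of_forall_resCochain_eq_zero (hcover : ⋃ a, U a = Set.univ)
    {x : singularCochains R A 0}
    (hx : ∀ σ : Fin 1 ↪o ι,
      resCochain (Set.inter_subset_left : A ∩ f ⁻¹' cechInter U σ ⊆ A) 0 x = 0) : x = 0 := by
  refine (cochainEquiv A 0).injective (funext fun s => ?_)
  obtain ⟨a, ha⟩ := Set.iUnion_eq_univ_iff.1 hcover (f (s (stdSimplex.vertex 0)))
  rw [forall_resCochain_eq_zero_iff.1 hx s a fun t => ?_, map_zero]
  · rfl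
  · rwa [Subsingleton.elim t (stdSimplex.vertex 0)]

lemma exists_singularD_eq_of_forall_resCochain_eq_zero (hU : ∀ a, IsOpen (U a))
    (hcover : ⋃ a, U a = Set.univ) {x : singularCochains R A (q + 1)}
    (hd : singularD A (q + 1) x = 0)
    (hx : ∀ σ : Fin 1 ↪o ι,
      resCochain (Set.inter_subset_left : A ∩ f ⁻¹' cechInter U σ ⊆ A) (q + 1) x = 0) :
    ∃ y : singularCochains R A q, singularD A q y = x ∧ ∀ σ : Fin 1 ↪o ι,
      resCochain (Set.inter_subset_left : A ∩ f ⁻¹' cechInter U σ ⊆ A) q y = 0 := by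
  have hcoc : coboundary (cochainEquiv A (q + 1) x) = 0 := by rw [← cochainEquiv_d, hd, map_zero]
  obtain ⟨ψ, hψ, hψx⟩ := (forall_resCochain_eq_zero_iff.1 hx).exists_coboundary_eq
    (fun a => (hU a).preimage (f.continuous.comp continuous_subtype_val))
    (fun z => Set.iUnion_eq_univ_iff.1 hcover (f z)) hcoc
  refine ⟨(cochainEquiv A q).symm ψ, (cochainEquiv A (q + 1)).injective ?_,
    forall_resCochain_eq_zero_iff.2 ?_⟩
  · rw [cochainEquiv_d, LinearEquiv.apply_symm_apply, hψx]
  · rwa [LinearEquiv.apply_symm_apply]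

end Exactness

end SubspaceCochains

/-! ### Graded modules with prescribed homogeneous components -/

section Components

variable {R : Type v} [CommRing R] {Λ : Type*} {M M' : Type*} [AddCommGroup M] [Module R[X] M]
  [AddCommGroup M'] [Module R[X] M']

/-- The graded `R[t]`-module `M` is the product of the graded modules `α(N a)`, where `comp i` maps
an element to its components of degree `i`. -/
structure HasComponents (N : Λ → PersistenceModule.{v, w} R) (gr : ℤ → AddSubgroup M)
    (comp : ∀ i, M →+ ∀ a, (N a).obj i) : Prop where
  ext {x y : M} (h : ∀ i, comp i x = comp i y) : x = y
  exists_support (x : M) : ∃ s : Finset ℤ, ∀ i ∉ s, comp i x = 0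
  exists_components (s : Finset ℤ) (y : ∀ i a, (N a).obj i) (hy : ∀ i ∉ s, y i = 0) :
    ∃ x, ∀ i, comp i x = y i
  C_smul (r : R) (x : M) (i : ℤ) (a : Λ) : comp i ((C r : R[X]) • x) a = r • comp i x a
  X_smul (x : M) (i : ℤ) (a : Λ) : comp (i + 1) ((X : R[X]) • x) a =
    ((N a).map (homOfLE (Int.le_add_one le_rfl) : i ⟶ i + 1)).hom (comp i x a)
  mem_gr {i : ℤ} {x : M} : x ∈ gr i ↔ ∀ j, j ≠ i → comp j x = 0

namespace HasComponents

variable {N : Λ → PersistenceModule.{v, w} R} {gr : ℤ → AddSubgroup M}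
  {comp : ∀ i, M →+ ∀ a, (N a).obj i} (h : HasComponents N gr comp)

include h

lemma exists_of_forall (s : Finset ℤ) {P : ∀ i, (∀ a, (N a).obj i) → Prop}
    (hzero : ∀ i ∉ s, P i 0) (hP : ∀ i, ∃ y, P i y) : ∃ x, ∀ i, P i (comp i x) := by
  classical
  choose y hy using hP
  obtain ⟨x, hx⟩ := h.exists_components s (fun i => if i ∈ s then y i else 0) fun i hi => if_neg hi
  refine ⟨x, fun i => ?_⟩
  rw [hx]
  split_ifs with hi
  exacts [hy i, hzero i hi]

lemma exists_mem_gr (x : M) (i : ℤ) : ∃ y ∈ gr i, comp i y = comp i x := by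
  classical
  obtain ⟨y, hy⟩ := h.exists_components {i} (fun j => if j = i then comp j x else 0)
    fun j hj => if_neg (by simpa using hj)
  exact ⟨y, h.mem_gr.2 fun j hj => (hy j).trans (if_neg hj), (hy i).trans (if_pos rfl)⟩

lemma comp_sum (s : Finset ℤ) {g : ℤ → M} (hg : ∀ i, g i ∈ gr i) (j : ℤ) :
    comp j (∑ i ∈ s, g i) = if j ∈ s then comp j (g j) else 0 := by
  rw [map_sum]
  split_ifs with hj
  · exact Finset.sum_eq_single_of_mem j hj fun i _ hi => h.mem_gr.1 (hg i) j hi.symm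
  · exact Finset.sum_eq_zero fun i hi => h.mem_gr.1 (hg i) j fun hji => hj (hji ▸ hi)

lemma isInternal : DirectSum.IsInternal gr := by
  refine isInternal_of_sum (fun x => ?_) fun s g hg hsum i hi => h.ext fun j => ?_
  · choose y hy hyx using h.exists_mem_gr x
    obtain ⟨s, hs⟩ := h.exists_support x
    refine ⟨s, y, hy, h.ext fun j => ?_⟩
    rw [h.comp_sum s hy]
    split_ifs with hj
    exacts [(hyx j).symm, hs j hj]
  · rw [map_zero]
    obtain rfl | hj := eq_or_ne j i
    · have := h.comp_sum s hg j
      rwa [hsum, map_zero, if_pos hi, eq_comm] at this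
    · exact h.mem_gr.1 (hg i) j hj

lemma isGrading : IsGrading (R := R) gr where
  isInternal := h.isInternal
  C_smul_mem r i x hx := h.mem_gr.2 fun j hj => funext fun a => by
    rw [h.C_smul, h.mem_gr.1 hx j hj]
    exact smul_zero _
  X_smul_mem i x hx := h.mem_gr.2 fun j hj => funext fun a => by
    obtain ⟨j, rfl⟩ : ∃ k, j = k + 1 := ⟨j - 1, by ring⟩
    rw [h.X_smul, h.mem_gr.1 hx j (by lia)]
    exact map_zero _

lemma map_mem_gr {Λ' : Type*} {N' : Λ' → PersistenceModule.{v, w} R} {gr' : ℤ → AddSubgroup M'}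
    {comp' : ∀ i, M' →+ ∀ a, (N' a).obj i} (h' : HasComponents N' gr' comp') {x : M} {y : M'}
    (hxy : ∀ i, comp i x = 0 → comp' i y = 0) {i : ℤ} (hx : x ∈ gr i) : y ∈ gr' i :=
  h'.mem_gr.2 fun j hj => hxy j (h.mem_gr.1 hx j hj)

end HasComponents

end Components

section Alpha

variable {R : Type v} [CommRing R] {M M' : PersistenceModule.{v, w} R}

lemma Alpha.exists_support (m : Alpha M) : ∃ s : Finset ℤ, ∀ i ∉ s, Alpha.component M i m = 0 := by
  classical
  exact ⟨DFinsupp.support ((Alpha.of M).symm m), fun i hi => DFinsupp.notMem_support_iff.1 hi⟩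

lemma Alpha.exists_components (s : Finset ℤ) (y : ∀ i, M.obj i) (hy : ∀ i ∉ s, y i = 0) :
    ∃ m : Alpha M, ∀ i, Alpha.component M i m = y i := by
  refine ⟨Alpha.of M (DFinsupp.mk s fun i => y i), fun i => ?_⟩
  change (DFinsupp.mk s (fun i => y i) : ⨁ i, M.obj i) i = y i
  by_cases hi : i ∈ s
  · exact DFinsupp.mk_of_mem hi
  · exact (DFinsupp.mk_of_notMem hi).trans (hy i hi).symm

lemma Alpha.mem_grading_iff {i : ℤ} {m : Alpha M} :
    m ∈ Alpha.grading M i ↔ ∀ j, j ≠ i → Alpha.component M j m = 0 := by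
  constructor
  · rintro ⟨x, rfl⟩ j hj
    exact DirectSum.of_eq_of_ne _ _ _ hj
  · intro h
    refine ⟨Alpha.component M i m, Alpha.ext fun j => ?_⟩
    by_cases hj : j = i
    · subst hj
      exact DirectSum.of_eq_same (β := fun i => M.obj i) _ _
    · rw [h j hj]
      exact DirectSum.of_eq_of_ne _ _ _ hj

lemma Alpha.component_C_smul (r : R) (m : Alpha M) (i : ℤ) :
    Alpha.component M i ((C r : R[X]) • m) = r • Alpha.component M i m := by
  rw [Alpha.C_smul, map_smul]

/-- The component of degree `i` of an element of `α(M)`, as a family indexed by a point. -/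
def Alpha.components (M : PersistenceModule.{v, w} R) (i : ℤ) : Alpha M →+ (Unit → M.obj i) where
  toFun m _ := Alpha.component M i m
  map_zero' := funext fun _ => map_zero _
  map_add' _ _ := funext fun _ => map_add _ _ _

lemma Alpha.hasComponents (M : PersistenceModule.{v, w} R) :
    HasComponents (fun _ : Unit => M) (Alpha.grading M) (Alpha.components M) where
  ext h := Alpha.ext fun i => congrFun (h i) ()
  exists_support x := by
    obtain ⟨s, hs⟩ := Alpha.exists_support x
    exact ⟨s, fun i hi => funext fun _ => hs i hi⟩
  exists_components s y hy := by
    obtain ⟨m, hm⟩ := Alpha.exists_components s (fun i => y i ()) fun i hi => congrFun (hy i hi) ()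
    exact ⟨m, fun i => funext fun _ => hm i⟩
  C_smul r x i _ := Alpha.component_C_smul r x i
  X_smul x i _ := Alpha.component_X_smul M x i
  mem_gr := Alpha.mem_grading_iff.trans
    (forall₂_congr fun _ _ => ⟨fun h => funext fun _ => h, fun h => congrFun h ()⟩)

lemma Alpha.map_mem_grading (g : M ⟶ M') {i : ℤ} {m : Alpha M} (hm : m ∈ Alpha.grading M i) :
    Alpha.map g m ∈ Alpha.grading M' i :=
  (Alpha.hasComponents M).map_mem_gr (Alpha.hasComponents M')
    (fun i h => funext fun a => (congrArg (g.app i).hom (congrFun h a)).trans (map_zero _)) hm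

end Alpha

section CechComponents

variable {R : Type v} [CommRing R] {Y : Type*} {ι : Type*} [LinearOrder ι] {U : ι → Set Y}
  {F F' : (Set Y)ᵒᵖ ⥤ PersistenceModule.{v, w} R} {p : ℕ}

/-- The components of degree `i` of a Čech cochain. -/
def cechComponent (i : ℤ) : cechCochains U F p →+
    (∀ σ : Fin (p + 1) ↪o ι, (F.obj (op (cechInter U σ))).obj i) where
  toFun c σ := Alpha.component _ i (c.1 σ)
  map_zero' := funext fun _ => map_zero _
  map_add' _ _ := funext fun _ => map_add _ _ _

lemma cechComponent_apply (i : ℤ) (c : cechCochains U F p) (σ : Fin (p + 1) ↪o ι) :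
    cechComponent i c σ = Alpha.component _ i (c.1 σ) := rfl

lemma cechCochains_ext {c c' : cechCochains U F p}
    (h : ∀ i σ, cechComponent i c σ = cechComponent i c' σ) : c = c' :=
  Subtype.ext (funext fun σ => Alpha.ext fun i => h i σ)

variable (U F) in
/-- The grading `cechGrading`, regarded as a grading of the module of Čech cochains and not of the
term of the Čech complex. -/
def cochainGrading (p : ℕ) (i : ℤ) : AddSubgroup (cechCochains U F p) := cechGrading U F p i

lemma mem_cochainGrading_iff {i : ℤ} {c : cechCochains U F p} :
    c ∈ cochainGrading U F p i ↔ ∀ j, j ≠ i → cechComponent j c = 0 := by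
  have hmem : c ∈ cochainGrading U F p i ↔
      ∀ σ, σ ∈ Set.univ → c.1 σ ∈ Alpha.grading (F.obj (op (cechInter U σ))) i := Iff.rfl
  rw [hmem]
  exact ⟨fun h j hj => funext fun σ => Alpha.mem_grading_iff.1 (h σ trivial) j hj,
    fun h σ _ => Alpha.mem_grading_iff.2 fun j hj => congrFun (h j hj) σ⟩

variable (U F p) in
lemma hasComponents_cechCochains :
    HasComponents (fun σ : Fin (p + 1) ↪o ι => F.obj (op (cechInter U σ))) (cochainGrading U F p)
      cechComponent where
  ext h := cechCochains_ext fun i σ => congrFun (h i) σ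
  exists_support c := by
    obtain ⟨s, hs⟩ := c.2
    exact ⟨s, fun i hi => funext fun σ => hs σ i hi⟩
  exists_components s y hy := by
    choose m hm using fun σ => Alpha.exists_components (M := F.obj (op (cechInter U σ))) s
      (fun i => y i σ) fun i hi => congrFun (hy i hi) σ
    refine ⟨⟨m, s, fun σ i hi => ?_⟩, fun i => funext fun σ => hm σ i⟩
    rw [hm, hy i hi]
    rfl
  C_smul r c i σ := Alpha.component_C_smul r (c.1 σ) i
  X_smul c i σ := Alpha.component_X_smul _ (c.1 σ) i
  mem_gr := mem_cochainGrading_iff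

lemma cechComponent_cechDelta (c : cechCochains U F p) (i : ℤ) (σ : Fin (p + 2) ↪o ι) :
    cechComponent i (cechDelta U F p c) σ = ∑ j : Fin (p + 2), (-1 : ℤ) ^ (j : ℕ) •
      ((F.map (homOfLE (cechInter_subset U σ j)).op).app i).hom
        (cechComponent i c (cechFace σ j)) := by
  rw [cechComponent_apply, cechDelta_apply, map_sum]
  refine Finset.sum_congr rfl fun j _ => ?_
  rw [map_zsmul]
  rfl

lemma cechDelta_mem_cochainGrading {i : ℤ} {c : cechCochains U F p}
    (hc : c ∈ cochainGrading U F p i) : cechDelta U F p c ∈ cochainGrading U F (p + 1) i := by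
  refine (hasComponents_cechCochains U F p).map_mem_gr (hasComponents_cechCochains U F (p + 1))
    (fun j hj => funext fun σ => ?_) hc
  rw [cechComponent_cechDelta, hj]
  exact Finset.sum_eq_zero fun k _ => (congrArg _ (map_zero _)).trans (smul_zero _)

variable (U) in
/-- The map of Čech cochains induced by a morphism of presheaves. -/
def cechMap (g : F ⟶ F') (p : ℕ) : cechCochains U F p →ₗ[R[X]] cechCochains U F' p :=
  LinearMap.codRestrict _
    (LinearMap.pi fun σ => Alpha.map (g.app (op (cechInter U σ))) ∘ₗ LinearMap.proj σ ∘ₗ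
      (cechCochains U F p).subtype)
    (by
      rintro ⟨c, s, hs⟩
      refine ⟨s, fun σ i hi => ?_⟩
      exact (Alpha.component_map _ _ i).trans ((congrArg _ (hs σ i hi)).trans (map_zero _)))

lemma cechComponent_cechMap (g : F ⟶ F') (c : cechCochains U F p) (i : ℤ) (σ : Fin (p + 1) ↪o ι) :
    cechComponent i (cechMap U g p c) σ =
      ((g.app (op (cechInter U σ))).app i).hom (cechComponent i c σ) := rfl

lemma cechMap_mem_cochainGrading (g : F ⟶ F') {i : ℤ} {c : cechCochains U F p}
    (hc : c ∈ cochainGrading U F p i) : cechMap U g p c ∈ cochainGrading U F' p i := by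
  refine (hasComponents_cechCochains U F p).map_mem_gr (hasComponents_cechCochains U F' p)
    (fun j hj => funext fun σ => ?_) hc
  rw [cechComponent_cechMap, hj]
  exact map_zero _

lemma cechDelta_cechMap (g : F ⟶ F') (c : cechCochains U F p) :
    cechDelta U F' p (cechMap U g p c) = cechMap U g (p + 1) (cechDelta U F p c) := by
  refine cechCochains_ext fun i σ => ?_
  rw [cechComponent_cechDelta, cechComponent_cechMap, cechComponent_cechDelta, map_sum]
  refine Finset.sum_congr rfl fun j _ => ?_
  rw [map_zsmul, cechComponent_cechMap]
  congr 1
  exact congrArg (fun h => (h.app i).hom (cechComponent i c (cechFace σ j)))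
    (g.naturality (homOfLE (cechInter_subset U σ j)).op).symm

end CechComponents

/-! ### Cohomology of complexes of graded modules, degree by degree -/

section ComponentRel

variable {R : Type v} [CommRing R]

/-- A subgroup of an `R[t]`-module which is stable under `R` and `t`, as a submodule. -/
def submoduleOfStable {M : Type*} [AddCommGroup M] [Module R[X] M]
    (N : AddSubgroup M) (hC : ∀ (a : R), ∀ m ∈ N, (C a : R[X]) • m ∈ N)
    (hX : ∀ m ∈ N, (X : R[X]) • m ∈ N) : Submodule R[X] M :=
  { N with
    smul_mem' := by
      intro P
      induction P using Polynomial.induction_on with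
      | C a => exact fun hm => hC a _ hm
      | add P Q hP hQ => intro m hm; rw [add_smul]; exact N.add_mem (hP hm) (hQ hm)
      | monomial n a ih =>
        intro m hm
        rw [pow_succ, ← mul_assoc, mul_smul]
        exact ih (hX m hm) }

variable {Λ : Type*} {L : Λ → ℤ ⥤ CochainComplex (ModuleCat.{w} R) ℕ} {q : ℕ}
  {Q H : Type*} [AddCommGroup Q] [Module R[X] Q] [AddCommGroup H] [Module R[X] H]
  {grQ : ℤ → AddSubgroup Q} {grH : ℤ → AddSubgroup H} {cQ : ∀ i, Q →+ ∀ a, ((L a).obj i).X q}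
  {cH : ∀ i, H →+ ∀ a, ((L a).obj i).homology q}

/-- The relation between cocycles and cohomology classes whose components correspond. -/
def componentRel (hQ : HasComponents (fun a => L a ⋙ HomologicalComplex.eval _ _ q) grQ cQ)
    (hH : HasComponents (fun a => L a ⋙ HomologicalComplex.homologyFunctor _ _ q) grH cH) :
    Submodule R[X] (Q × H) :=
  submoduleOfStable
    (⨅ i, ⨅ a, (classRel ((L a).obj i) q).toAddSubgroup.comap
      (((Pi.evalAddMonoidHom _ a).comp (cQ i)).prodMap ((Pi.evalAddMonoidHom _ a).comp (cH i))))
    (fun r x hx => by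
      simp only [AddSubgroup.mem_iInf] at hx ⊢
      intro i a
      have hrx := (classRel ((L a).obj i) q).smul_mem r (hx i a)
      exact AddSubgroup.mem_comap.2 (Set.mem_of_eq_of_mem
        (congrArg₂ Prod.mk (hQ.C_smul r x.1 i a) (hH.C_smul r x.2 i a)) hrx))
    (fun x hx => by
      simp only [AddSubgroup.mem_iInf] at hx ⊢
      intro i a
      obtain ⟨i, rfl⟩ : ∃ k, i = k + 1 := ⟨i - 1, by ring⟩
      have htx := map_mem_classRel
        ((L a).map (homOfLE (Int.le_add_one le_rfl) : i ⟶ i + 1)) (hx i a)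
      exact AddSubgroup.mem_comap.2 (Set.mem_of_eq_of_mem
        (congrArg₂ Prod.mk (hQ.X_smul x.1 i a) (hH.X_smul x.2 i a)) htx))

section

variable {hQ : HasComponents (fun a => L a ⋙ HomologicalComplex.eval _ _ q) grQ cQ}
  {hH : HasComponents (fun a => L a ⋙ HomologicalComplex.homologyFunctor _ _ q) grH cH}

lemma mem_componentRel {z : Q} {c : H} :
    (z, c) ∈ componentRel hQ hH ↔ ∀ i a, (cQ i z a, cH i c a) ∈ classRel ((L a).obj i) q := by
  change (z, c) ∈ (⨅ i, ⨅ a, _ : AddSubgroup (Q × H)) ↔ _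
  simp only [AddSubgroup.mem_iInf]
  rfl

lemma exists_mem_componentRel_iff {z : Q} : (∃ c, (z, c) ∈ componentRel hQ hH) ↔
    ∀ i a l, (((L a).obj i).d q l).hom (cQ i z a) = 0 := by
  refine ⟨fun ⟨c, hc⟩ i a => d_eq_zero_of_mem_classRel (mem_componentRel.1 hc i a), fun hz => ?_⟩
  obtain ⟨s, hs⟩ := hQ.exists_support z
  obtain ⟨c, hc⟩ := hH.exists_of_forall s
    (P := fun i y => ∀ a, (cQ i z a, y a) ∈ classRel ((L a).obj i) q)
    (fun i hi a => Set.mem_of_eq_of_mem (congrArg (·, 0) (congrFun (hs i hi) a)) (zero_mem _))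
    (fun i => by
      choose y hy using fun a => exists_mem_classRel_iff.2 (hz i a)
      exact ⟨y, hy⟩)
  exact ⟨c, mem_componentRel.2 hc⟩

lemma mem_componentRel_zero_iff {z : Q} : (z, 0) ∈ componentRel hQ hH ↔
    ∀ i a, ∃ j x, (((L a).obj i).d j q).hom x = cQ i z a := by
  rw [mem_componentRel]
  refine forall₂_congr fun i a => ?_
  rw [map_zero]
  exact mem_classRel_zero_iff

lemma exists_mem_componentRel_and_eq_zero (c : H) :
    ∃ z, (z, c) ∈ componentRel hQ hH ∧ ∀ i, cH i c = 0 → cQ i z = 0 := by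
  have hzero (i : ℤ) (hc : cH i c = 0) (a : Λ) : (0, cH i c a) ∈ classRel ((L a).obj i) q :=
    Set.mem_of_eq_of_mem (congrArg (0, ·) (congrFun hc a)) (zero_mem _)
  obtain ⟨s, hs⟩ := hH.exists_support c
  obtain ⟨z, hz⟩ := hQ.exists_of_forall s
    (P := fun i y => (∀ a, (y a, cH i c a) ∈ classRel ((L a).obj i) q) ∧ (cH i c = 0 → y = 0))
    (fun i hi => ⟨hzero i (hs i hi), fun _ => rfl⟩)
    (fun i => by
      by_cases hc : cH i c = 0
      · exact ⟨0, hzero i hc, fun _ => rfl⟩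
      · choose y hy using fun a => (isPresentation_classRel (K := (L a).obj i)
          fun _ _ => ⊥).exists_rep (cH i c a)
        exact ⟨y, hy, fun hc' => absurd hc' hc⟩)
  exact ⟨z, mem_componentRel.2 fun i => (hz i).1, fun i => (hz i).2⟩

lemma component_eq_zero_of_mem_componentRel {z : Q} {c : H} (hzc : (z, c) ∈ componentRel hQ hH)
    {i : ℤ} (hz : cQ i z = 0) : cH i c = 0 := by
  refine funext fun a => (isPresentation_classRel (K := (L a).obj i) fun _ _ => ⊥).eq_zero ?_
  have hmem := mem_componentRel.1 hzc i a
  rwa [hz] at hmem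

lemma isPresentation_componentRel : IsPresentation grQ grH (componentRel hQ hH) where
  exists_rep c := by
    obtain ⟨z, hz, -⟩ := exists_mem_componentRel_and_eq_zero (hQ := hQ) (hH := hH) c
    exact ⟨z, hz⟩
  eq_zero hc := hH.ext fun i =>
    (component_eq_zero_of_mem_componentRel hc (map_zero _)).trans (map_zero _).symm
  mem_gr_iff {i c} := by
    constructor
    · intro hc
      obtain ⟨z, hzc, hz⟩ := exists_mem_componentRel_and_eq_zero (hQ := hQ) (hH := hH) c
      exact ⟨z, hH.map_mem_gr hQ hz hc, hzc⟩
    · rintro ⟨z, hz, hzc⟩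
      exact hQ.map_mem_gr hH (fun _ => component_eq_zero_of_mem_componentRel hzc) hz

end

section

variable {Q : ℕ → Type*} [∀ q, AddCommGroup (Q q)] [∀ q, Module R[X] (Q q)]
  {grQ : ∀ q, ℤ → AddSubgroup (Q q)} {cQ : ∀ q i, Q q →+ ∀ a, ((L a).obj i).X q}
  {d : ∀ q, Q q →ₗ[R[X]] Q (q + 1)}
  (hQ : ∀ q, HasComponents (fun a => L a ⋙ HomologicalComplex.eval _ _ q) (grQ q) (cQ q))
  (hd : ∀ q z i a, cQ (q + 1) i (d q z) a = (((L a).obj i).d q (q + 1)).hom (cQ q i z a))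

include hd

lemma exists_d_eq_of_mem_boundaries {z : Q q} (hz : z ∈ boundaries d q) (i : ℤ) (a : Λ) :
    ∃ j x, (((L a).obj i).d j q).hom x = cQ q i z a := by
  cases q with
  | zero =>
    obtain rfl : z = 0 := hz
    exact ⟨0, 0, (map_zero _).trans (congrFun (map_zero (cQ 0 i)) a).symm⟩
  | succ q =>
    obtain ⟨y, rfl⟩ := hz
    exact ⟨q, cQ q i y a, (hd q y i a).symm⟩

include hQ

lemma mem_ker_iff_components {z : Q q} :
    z ∈ LinearMap.ker (d q) ↔ ∀ i a l, (((L a).obj i).d q l).hom (cQ q i z a) = 0 := by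
  constructor
  · intro hz i a l
    obtain rfl | hl := eq_or_ne (q + 1) l
    · rw [← hd, hz, map_zero]
      rfl
    · rw [((L a).obj i).shape q l hl]
      rfl
  · intro hz
    exact (hQ (q + 1)).ext fun i => funext fun a =>
      (hd q z i a).trans ((hz i a (q + 1)).trans (congrFun (map_zero (cQ (q + 1) i)) a).symm)

lemma mem_range_of_forall_exists_d_eq {z : Q (q + 1)}
    (h : ∀ i a, ∃ x, (((L a).obj i).d q (q + 1)).hom x = cQ (q + 1) i z a) :
    z ∈ LinearMap.range (d q) := by
  obtain ⟨s, hs⟩ := (hQ (q + 1)).exists_support z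
  obtain ⟨y, hy⟩ := (hQ q).exists_of_forall s
    (P := fun i y => ∀ a, (((L a).obj i).d q (q + 1)).hom (y a) = cQ (q + 1) i z a)
    (fun i hi a => (map_zero _).trans (congrFun (hs i hi) a).symm)
    (fun i => by
      choose y hy using h i
      exact ⟨y, hy⟩)
  exact ⟨y, (hQ (q + 1)).ext fun i => funext fun a => (hd q y i a).trans (hy i a)⟩

lemma mem_boundaries_iff_components {z : Q q} :
    z ∈ boundaries d q ↔ ∀ i a, ∃ j x, (((L a).obj i).d j q).hom x = cQ q i z a := by
  refine ⟨exists_d_eq_of_mem_boundaries hd, fun h => ?_⟩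
  have hshape (i : ℤ) (a : Λ) (hq : ∀ j x, j + 1 = q → (((L a).obj i).d j q).hom x ≠ cQ q i z a) :
      cQ q i z a = 0 := by
    obtain ⟨j, x, hx⟩ := h i a
    rw [← hx, ((L a).obj i).shape j q fun hj => hq j x hj hx]
    rfl
  cases q with
  | zero =>
    exact (hQ 0).ext fun i => funext fun a =>
      (hshape i a fun _ _ hj => absurd hj (Nat.succ_ne_zero _)).trans
        (congrFun (map_zero (cQ 0 i)) a).symm
  | succ q =>
    refine mem_range_of_forall_exists_d_eq hQ hd fun i a => ?_
    by_contra! hne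
    refine hne 0 ((map_zero _).trans (hshape i a ?_).symm)
    rintro j x hj
    obtain rfl : j = q := Nat.succ_injective hj
    exact hne x

lemma isSubquotientRel_componentRel
    (hH : HasComponents (fun a => L a ⋙ HomologicalComplex.homologyFunctor _ _ q) grH cH) :
    IsSubquotientRel (LinearMap.ker (d q)) (boundaries d q) (grQ q) grH
      (componentRel (hQ q) hH) where
  toIsPresentation := isPresentation_componentRel
  exists_mem_iff := exists_mem_componentRel_iff.trans (mem_ker_iff_components hQ hd).symm
  mem_zero_iff := mem_componentRel_zero_iff.trans (mem_boundaries_iff_components hQ hd).symm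

end

end ComponentRel

/-! ### The double complex of Čech cochains with values in singular cochains -/

section Presheaf

lemma antitone_inter_preimage {X Y : Type*} (f : X → Y) {K : ℕ → Set X} (hK : Antitone K)
    (V : Set Y) : Antitone fun i => K i ∩ f ⁻¹' V :=
  fun _ _ h => Set.inter_subset_inter_left _ (hK h)

lemma cechComplex_d {R : Type v} [CommRing R] {Y : Type*} {ι : Type*} [LinearOrder ι]
    (U : ι → Set Y) (F : (Set Y)ᵒᵖ ⥤ PersistenceModule.{v, w} R) (p : ℕ) :
    (cechComplex U F).d p (p + 1) = ModuleCat.ofHom (cechDelta U F p) :=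
  CochainComplex.of_d (fun p => ModuleCat.of R[X] (cechCochains U F p))
    (fun p => ModuleCat.ofHom (cechDelta U F p)) p

variable (R : Type v) [CommRing R] {X : Type u} [TopologicalSpace X] {Y : Type*}

section Filtered

variable {L L' : ℕ → Set X} (hL : Antitone L) (hL' : Antitone L')

/-- The singular cochain complexes `S^*(L_i; R)` of a decreasing sequence of subspaces, with the
indexing convention of `persistentCohomology`. -/
def filteredCochains : ℤ ⥤ CochainComplex (ModuleCat.{max u v} R) ℕ where
  obj i := (subspaceCochains R X).obj (op (L i.toNat))
  map h := (subspaceCochains R X).map (homOfLE (hL (Int.toNat_le_toNat (leOfHom h)))).op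
  map_id _ := (subspaceCochains R X).map_id _
  map_comp _ _ := (subspaceCochains R X).map_comp _ _

/-- The restriction of singular cochains between decreasing sequences of subspaces. -/
def filteredCochainsRes (h : ∀ i, L' i ⊆ L i) : filteredCochains R hL ⟶ filteredCochains R hL' where
  app i := (subspaceCochains R X).map (homOfLE (h i.toNat)).op
  naturality _ _ _ := ((subspaceCochains R X).map_comp _ _).symm.trans
    ((subspaceCochains R X).map_comp _ _)

/-- The persistence module `i ↦ S^q(L_i; R)` of singular cochains. -/
def persistentCochains (q : ℕ) : PersistenceModule.{v, max u v} R :=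
  filteredCochains R hL ⋙ HomologicalComplex.eval _ _ q

/-- The coboundary of singular cochains as a morphism of persistence modules. -/
def persistentCochainsD (q : ℕ) : persistentCochains R hL q ⟶ persistentCochains R hL (q + 1) :=
  Functor.whiskerLeft (filteredCochains R hL) (HomologicalComplex.dNatTrans _ _ q (q + 1))

end Filtered

variable (f : X → Y) {K : ℕ → Set X} (hK : Antitone K)

/-- The presheaf `V ↦ (i ↦ S^*(K_i ∩ f⁻¹ V; R))` on `Y`. -/
def filteredCochainsPresheaf : (Set Y)ᵒᵖ ⥤ ℤ ⥤ CochainComplex (ModuleCat.{max u v} R) ℕ where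
  obj V := filteredCochains R (antitone_inter_preimage f hK V.unop)
  map h := filteredCochainsRes R _ _ fun i =>
    Set.inter_subset_inter_right (K i) (Set.preimage_mono (leOfHom h.unop))
  map_id _ := by
    ext1; funext i
    exact (subspaceCochains R X).map_id _
  map_comp _ _ := by
    ext1; funext i
    exact (subspaceCochains R X).map_comp _ _

/-- The presheaf of persistence modules `V ↦ (i ↦ S^q(K_i ∩ f⁻¹ V; R))` on `Y`. -/
def cochainPresheaf (q : ℕ) : (Set Y)ᵒᵖ ⥤ PersistenceModule.{v, max u v} R :=
  filteredCochainsPresheaf R f hK ⋙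
    (Functor.whiskeringRight _ _ _).obj (HomologicalComplex.eval _ _ q)

/-- The coboundary of singular cochains as a morphism of presheaves. -/
def cochainPresheafD (q : ℕ) : cochainPresheaf R f hK q ⟶ cochainPresheaf R f hK (q + 1) :=
  Functor.whiskerLeft (filteredCochainsPresheaf R f hK)
    ((Functor.whiskeringRight _ _ _).map (HomologicalComplex.dNatTrans _ _ q (q + 1)))

variable {ι : Type w} [LinearOrder ι] (U : ι → Set Y)

/-- The double complex of Čech cochains with values in singular cochains. -/
def cechDoubleComplex :
    DoubleComplex R (fun p q => cechCochains U (cochainPresheaf R f hK q) p) where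
  dh p q := cechDelta U (cochainPresheaf R f hK q) p
  dv p q := cechMap U (cochainPresheafD R f hK q) p
  dh_dh p q := cechDelta_cechDelta U (cochainPresheaf R f hK q) p
  dv_dv p q c := cechCochains_ext fun i σ => by
    rw [map_zero]
    exact LinearMap.congr_fun (congrArg ModuleCat.Hom.hom (((subspaceCochains R X).obj
      (op (K i.toNat ∩ f ⁻¹' cechInter U σ))).d_comp_d q (q + 1) (q + 1 + 1)))
      (cechComponent i c σ)
  dh_dv p q := cechDelta_cechMap (cochainPresheafD R f hK q)
  gr p q := cochainGrading U (cochainPresheaf R f hK q) p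
  isGrading p q := (hasComponents_cechCochains U (cochainPresheaf R f hK q) p).isGrading
  dh_gr _ _ _ _ hx := cechDelta_mem_cochainGrading hx
  dv_gr _ _ _ _ hx := cechMap_mem_cochainGrading _ hx

/-- The relation between Čech cochains with values in singular cocycles and Čech cochains with
values in singular cohomology. -/
def cechClassRel (p q : ℕ) : Submodule R[X]
    (cechCochains U (cochainPresheaf R f hK q) p ×
      (cechComplex U (persistentCohomologyPresheaf R f K hK q)).X p) :=
  componentRel
    (L := fun σ => (filteredCochainsPresheaf R f hK).obj (op (cechInter U σ)))
    (hasComponents_cechCochains U (cochainPresheaf R f hK q) p)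
    (hasComponents_cechCochains U (persistentCohomologyPresheaf R f K hK q) p)

lemma isSubquotientRel_cechClassRel (p q : ℕ) :
    IsSubquotientRel (LinearMap.ker ((cechDoubleComplex R f hK U).dv p q))
      (boundaries ((cechDoubleComplex R f hK U).dv p) q) ((cechDoubleComplex R f hK U).gr p q)
      (cechGrading U (persistentCohomologyPresheaf R f K hK q) p)
      (cechClassRel R f hK U p q) :=
  isSubquotientRel_componentRel
    (fun q => hasComponents_cechCochains U (cochainPresheaf R f hK q) p) (fun _ _ _ _ => rfl)
    (hasComponents_cechCochains U (persistentCohomologyPresheaf R f K hK q) p)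

variable {R f hK U} in
lemma mem_cechClassRel {p q : ℕ} {z : cechCochains U (cochainPresheaf R f hK q) p}
    {c : cechCochains U (persistentCohomologyPresheaf R f K hK q) p} :
    (z, c) ∈ cechClassRel R f hK U p q ↔ ∀ i σ, (cechComponent i z σ, cechComponent i c σ) ∈
      classRel ((subspaceCochains R X).obj (op (K i.toNat ∩ f ⁻¹' cechInter U σ))) q :=
  mem_componentRel

variable {R f hK U} in
lemma cechDelta_mem_cechClassRel {p q : ℕ} {z : cechCochains U (cochainPresheaf R f hK q) p}
    {c : cechCochains U (persistentCohomologyPresheaf R f K hK q) p}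
    (h : (z, c) ∈ cechClassRel R f hK U p q) :
    (cechDelta U (cochainPresheaf R f hK q) p z,
      cechDelta U (persistentCohomologyPresheaf R f K hK q) p c) ∈
        cechClassRel R f hK U (p + 1) q := by
  refine mem_cechClassRel.2 fun i σ => ?_
  have hsub (j : Fin (p + 2)) :
      K i.toNat ∩ f ⁻¹' cechInter U σ ⊆ K i.toNat ∩ f ⁻¹' cechInter U (cechFace σ j) :=
    Set.inter_subset_inter_right _ (Set.preimage_mono (cechInter_subset U σ j))
  have hface (j : Fin (p + 2)) :=
    map_mem_classRel ((subspaceCochains R X).map (homOfLE (hsub j)).op)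
      (mem_cechClassRel.1 h i (cechFace σ j))
  exact Set.mem_of_eq_of_mem
    (congrArg₂ Prod.mk (cechComponent_cechDelta z i σ) (cechComponent_cechDelta c i σ))
    (sum_mk_mem fun j _ => zsmul_mem (hface j) ((-1) ^ (j : ℕ)))

variable {R f hK U} in
lemma cechComplex_d_mem_cechClassRel (p q : ℕ) (z : cechCochains U (cochainPresheaf R f hK q) p)
    (c : (cechComplex U (persistentCohomologyPresheaf R f K hK q)).X p)
    (h : (z, c) ∈ cechClassRel R f hK U p q) :
    (cechDelta U (cochainPresheaf R f hK q) p z,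
      ((cechComplex U (persistentCohomologyPresheaf R f K hK q)).d p (p + 1)).hom c) ∈
        cechClassRel R f hK U (p + 1) q := by
  rw [cechComplex_d]
  exact cechDelta_mem_cechClassRel h

end Presheaf

/-! ### The augmentation by the singular cochains of the total space -/

section Augmentation

variable (R : Type v) [CommRing R] {X : Type u} [TopologicalSpace X] {K : ℕ → Set X}
  (hK : Antitone K)

/-- The relation between singular cocycles and cohomology classes in a filtered space. -/
def persistentClassRel (q : ℕ) : Submodule R[X]
    (Alpha (persistentCochains R hK q) × Alpha (persistentCohomology R K hK q)) :=
  componentRel (L := fun _ : Unit => filteredCochains R hK)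
    (Alpha.hasComponents (persistentCochains R hK q))
    (Alpha.hasComponents (persistentCohomology R K hK q))

lemma isSubquotientRel_persistentClassRel (q : ℕ) :
    IsSubquotientRel (LinearMap.ker (Alpha.map (persistentCochainsD R hK q)))
      (boundaries (fun q => Alpha.map (persistentCochainsD R hK q)) q)
      (Alpha.grading (persistentCochains R hK q))
      (Alpha.grading (persistentCohomology R K hK q)) (persistentClassRel R hK q) :=
  isSubquotientRel_componentRel (L := fun _ : Unit => filteredCochains R hK)
    (d := fun q => Alpha.map (persistentCochainsD R hK q))
    (fun q => Alpha.hasComponents (persistentCochains R hK q)) (fun _ _ _ _ => rfl)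
    (Alpha.hasComponents (persistentCohomology R K hK q))

lemma alphaMap_persistentCochainsD_comp {q : ℕ} (s : Alpha (persistentCochains R hK q)) :
    Alpha.map (persistentCochainsD R hK (q + 1)) (Alpha.map (persistentCochainsD R hK q) s) = 0 :=
  Alpha.ext fun i => by
    rw [map_zero]
    exact LinearMap.congr_fun (congrArg ModuleCat.Hom.hom (((subspaceCochains R X).obj
      (op (K i.toNat))).d_comp_d q (q + 1) (q + 1 + 1))) (Alpha.component _ i s)

section

variable {Y : Type*} (f : X → Y) {ι : Type w} [LinearOrder ι] (U : ι → Set Y) (q : ℕ)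

/-- The restriction of a singular cochain to the members of the cover. -/
def cechAugmentation :
    Alpha (persistentCochains R hK q) →ₗ[R[X]] cechCochains U (cochainPresheaf R f hK q) 0 :=
  LinearMap.codRestrict _
    (LinearMap.pi fun σ => Alpha.map (Functor.whiskerRight (filteredCochainsRes R hK
      (antitone_inter_preimage f hK (cechInter U σ)) fun _ => Set.inter_subset_left)
        (HomologicalComplex.eval _ _ q)))
    (by
      intro s
      obtain ⟨S, hS⟩ := Alpha.exists_support s
      refine ⟨S, fun σ i hi => ?_⟩
      exact (Alpha.component_map _ _ i).trans ((congrArg _ (hS i hi)).trans (map_zero _)))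

variable {R hK f U q}

lemma cechComponent_cechAugmentation (s : Alpha (persistentCochains R hK q)) (i : ℤ)
    (σ : Fin 1 ↪o ι) :
    cechComponent i (cechAugmentation R hK f U q s) σ =
      resCochain (Set.inter_subset_left : K i.toNat ∩ f ⁻¹' cechInter U σ ⊆ K i.toNat) q
        (Alpha.component _ i s) := rfl

lemma resCochain_eq_zero_of_cechAugmentation {s : Alpha (persistentCochains R hK q)}
    (hs : cechAugmentation R hK f U q s = 0) (i : ℤ) (σ : Fin 1 ↪o ι) :
    resCochain (Set.inter_subset_left : K i.toNat ∩ f ⁻¹' cechInter U σ ⊆ K i.toNat) q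
      (Alpha.component _ i s) = 0 := by
  rw [← cechComponent_cechAugmentation, hs, map_zero]
  rfl

lemma cechAugmentation_mem_cochainGrading {i : ℤ} {s : Alpha (persistentCochains R hK q)}
    (hs : s ∈ Alpha.grading (persistentCochains R hK q) i) :
    cechAugmentation R hK f U q s ∈ cochainGrading U (cochainPresheaf R f hK q) 0 i :=
  mem_cochainGrading_iff.2 fun j hj => funext fun σ => by
    rw [cechComponent_cechAugmentation, Alpha.mem_grading_iff.1 hs j hj]
    exact map_zero _

lemma cechAugmentation_persistentCochainsD (s : Alpha (persistentCochains R hK q)) :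
    cechAugmentation R hK f U (q + 1) (Alpha.map (persistentCochainsD R hK q) s) =
      cechMap U (cochainPresheafD R f hK q) 0 (cechAugmentation R hK f U q s) :=
  cechCochains_ext fun i σ => LinearMap.congr_fun (congrArg ModuleCat.Hom.hom
    (((subspaceCochains R X).map (homOfLE (Set.inter_subset_left :
      K i.toNat ∩ f ⁻¹' cechInter U σ ⊆ K i.toNat)).op).comm q (q + 1)).symm)
        (Alpha.component _ i s)

end

variable {Y : Type*} [TopologicalSpace Y] {f : C(X, Y)} {ι : Type w} [LinearOrder ι]
  {U : ι → Set Y} {p q : ℕ}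

variable {R hK}

lemma cechComponent_cechDelta_cochainPresheaf (c : cechCochains U (cochainPresheaf R f hK q) p)
    (i : ℤ) (σ : Fin (p + 2) ↪o ι) :
    cechComponent i (cechDelta U (cochainPresheaf R f hK q) p c) σ =
      singularCechDelta (A := K i.toNat) (f := f) (cechComponent i c) σ :=
  cechComponent_cechDelta c i σ

lemma singularCechDelta_eq_zero_of_cechDelta {c : cechCochains U (cochainPresheaf R f hK q) p}
    (hc : cechDelta U (cochainPresheaf R f hK q) p c = 0) (i : ℤ) (σ : Fin (p + 2) ↪o ι) :
    singularCechDelta (A := K i.toNat) (f := f) (cechComponent i c) σ = 0 := by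
  rw [← cechComponent_cechDelta_cochainPresheaf, hc, map_zero]
  rfl

lemma cechDelta_cechAugmentation (s : Alpha (persistentCochains R hK q)) :
    cechDelta U (cochainPresheaf R f hK q) 0 (cechAugmentation R hK f U q s) = 0 := by
  refine cechCochains_ext fun i σ => (cechComponent_cechDelta_cochainPresheaf _ i σ).trans ?_
  rw [map_zero]
  exact singularCechDelta_resCochain (Alpha.component _ i s) σ

lemma exists_cechDelta_eq {x : cechCochains U (cochainPresheaf R f hK q) (p + 1)}
    (hx : cechDelta U (cochainPresheaf R f hK q) (p + 1) x = 0) :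
    ∃ y, cechDelta U (cochainPresheaf R f hK q) p y = x := by
  obtain ⟨S, hS⟩ :=
    (hasComponents_cechCochains U (cochainPresheaf R f hK q) (p + 1)).exists_support x
  obtain ⟨y, hy⟩ := (hasComponents_cechCochains U (cochainPresheaf R f hK q) p).exists_of_forall S
    (P := fun i y => ∀ σ, singularCechDelta (A := K i.toNat) (f := f) y σ = cechComponent i x σ)
    (fun i hi σ => (singularCechDelta_zero σ).trans (congrFun (hS i hi) σ).symm)
    (fun i => exists_singularCechDelta_eq (singularCechDelta_eq_zero_of_cechDelta hx i))
  exact ⟨y, cechCochains_ext fun i σ =>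
    (cechComponent_cechDelta_cochainPresheaf y i σ).trans (hy i σ)⟩

lemma exists_cechAugmentation_eq {x : cechCochains U (cochainPresheaf R f hK q) 0}
    (hx : cechDelta U (cochainPresheaf R f hK q) 0 x = 0) :
    ∃ s, cechAugmentation R hK f U q s = x := by
  obtain ⟨S, hS⟩ := (hasComponents_cechCochains U (cochainPresheaf R f hK q) 0).exists_support x
  obtain ⟨y, hy⟩ := (Alpha.hasComponents (persistentCochains R hK q)).exists_of_forall S
    (P := fun i y => ∀ σ, resCochain
      (Set.inter_subset_left : K i.toNat ∩ f ⁻¹' cechInter U σ ⊆ K i.toNat) q (y ()) =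
        cechComponent i x σ)
    (fun i hi σ => (map_zero _).trans (congrFun (hS i hi) σ).symm)
    (fun i => by
      obtain ⟨y, hy⟩ := exists_resCochain_eq (singularCechDelta_eq_zero_of_cechDelta hx i)
      exact ⟨fun _ => y, hy⟩)
  exact ⟨y, cechCochains_ext hy⟩

lemma eq_zero_of_cechAugmentation_eq_zero (hcover : ⋃ a, U a = Set.univ)
    {s : Alpha (persistentCochains R hK 0)} (hs : cechAugmentation R hK f U 0 s = 0) : s = 0 :=
  Alpha.ext fun i => (eq_zero_of_forall_resCochain_eq_zero hcover
    (resCochain_eq_zero_of_cechAugmentation hs i)).trans (map_zero _).symm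

lemma exists_persistentCochainsD_eq (hU : ∀ a, IsOpen (U a)) (hcover : ⋃ a, U a = Set.univ)
    {s : Alpha (persistentCochains R hK (q + 1))}
    (hd : Alpha.map (persistentCochainsD R hK (q + 1)) s = 0)
    (hs : cechAugmentation R hK f U (q + 1) s = 0) :
    ∃ s', Alpha.map (persistentCochainsD R hK q) s' = s ∧ cechAugmentation R hK f U q s' = 0 := by
  obtain ⟨S, hS⟩ := Alpha.exists_support s
  obtain ⟨y, hy⟩ := (Alpha.hasComponents (persistentCochains R hK q)).exists_of_forall S
    (P := fun i y => singularD (K i.toNat) q (y ()) = Alpha.component _ i s ∧ ∀ σ, resCochain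
      (Set.inter_subset_left : K i.toNat ∩ f ⁻¹' cechInter U σ ⊆ K i.toNat) q (y ()) = 0)
    (fun i hi => ⟨(map_zero _).trans (hS i hi).symm, fun σ => map_zero _⟩)
    (fun i => by
      obtain ⟨y, hy⟩ := exists_singularD_eq_of_forall_resCochain_eq_zero hU hcover
        ((congrArg (Alpha.component _ i) hd).trans (map_zero _))
        (resCochain_eq_zero_of_cechAugmentation hs i)
      exact ⟨fun _ => y, hy⟩)
  refine ⟨y, Alpha.ext fun i => (hy i).1, cechCochains_ext fun i σ => ?_⟩
  rw [map_zero]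
  exact (hy i).2 σ

variable (R hK f) in
/-- The augmentation of the Čech double complex by the singular cochains of the total space. -/
def singularAugmentation (hU : ∀ a, IsOpen (U a)) (hcover : ⋃ a, U a = Set.univ) :
    (cechDoubleComplex R f hK U).Augmentation (fun q => Alpha (persistentCochains R hK q)) where
  d q := Alpha.map (persistentCochainsD R hK q)
  d_d _ := alphaMap_persistentCochainsD_comp R hK
  ε := cechAugmentation R hK f U
  ε_d _ := cechAugmentation_persistentCochainsD
  dh_ε _ := cechDelta_cechAugmentation
  row_exact _ _ _ := exists_cechDelta_eq
  exists_ε _ _ := exists_cechAugmentation_eq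
  ker_zero _ _ := eq_zero_of_cechAugmentation_eq_zero hcover
  ker_succ _ _ := exists_persistentCochainsD_eq hU hcover
  gr q := Alpha.grading (persistentCochains R hK q)
  isInternal q := (Alpha.hasComponents (persistentCochains R hK q)).isInternal
  d_gr _ _ _ := Alpha.map_mem_grading _
  ε_gr _ _ _ := cechAugmentation_mem_cochainGrading

end Augmentation

lemma map_symm_toLinearEquiv_eq {S : Type*} [Ring S] {M N : ModuleCat.{w} S} (e : M ≅ N)
    {G : AddSubgroup M} {G' : AddSubgroup N} (h : G.map e.hom.hom.toAddMonoidHom = G') :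
    G'.map e.toLinearEquiv.symm.toLinearMap.toAddMonoidHom = G := by
  subst h
  rw [AddSubgroup.map_map]
  convert AddSubgroup.map_id G
  ext x
  exact e.toLinearEquiv.symm_apply_apply x

end PersistentLeray

end

open PersistentLeray in
theorem mainTheorem1_general {R : Type v} [CommRing R] {X : Type u} [TopologicalSpace X]
    {Y : Type*} [TopologicalSpace Y] (f : C(X, Y))
    {ι : Type w} [LinearOrder ι] (U : ι → Set Y) (hU : ∀ a, IsOpen (U a))
    (hcover : ⋃ a, U a = Set.univ) (K : ℕ → Set X) (hK : Antitone K) :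
    ∃ 𝓔 : GradedSpectralSequence.{v, max u v w} R,
      (∀ p q : ℕ,
        ∃ e : (𝓔.E.page 2 le_rfl).X (p, q) ≃ₗ[R[X]]
            cechCohomology U (persistentCohomologyPresheaf R f K hK q) p,
          ∀ i : ℤ, (𝓔.gr 2 le_rfl (p, q) i).map e.toLinearMap.toAddMonoidHom =
            homologyGrading (cechComplex U (persistentCohomologyPresheaf R f K hK q))
              (cechGrading U (persistentCohomologyPresheaf R f K hK q)) p i) ∧
      𝓔.ConvergesTo (fun n => Alpha (persistentCohomology R K hK n))
        (fun n => Alpha.grading (persistentCohomology R K hK n)) := by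
  refine ⟨(cechDoubleComplex R f hK U).filtered.spectralSequence, fun p q => ?_, ?_⟩
  · obtain ⟨e, he⟩ := (cechDoubleComplex R f hK U).exists_secondPage_iso
      (fun p => isSubquotientRel_cechClassRel R f hK U p q)
      (fun p => cechComplex_d_mem_cechClassRel p q) p
    exact ⟨e.toLinearEquiv.symm, fun i => map_symm_toLinearEquiv_eq e (he i)⟩
  · exact ((singularAugmentation R hK f hU hcover).presentsCohomology_totalRel
      (isSubquotientRel_persistentClassRel R hK)).convergesTo fun n =>
        (Alpha.hasComponents (persistentCohomology R K hK n)).isInternal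

open PersistentLeray in
theorem mainTheorem1 {R : Type v} [CommRing R] {X : Type u} [TopologicalSpace X]
    {Y : Type*} [TopologicalSpace Y] (f : C(X, Y))
    {ι : Type w} [LinearOrder ι] (U : ι → Set Y) (hU : ∀ a, IsOpen (U a))
    (hcover : ⋃ a, U a = Set.univ) (hfin : LocallyFinite fun a => f ⁻¹' U a)
    (N : ℕ) (K : ℕ → Set X) (hK : Antitone K) (hK0 : K 0 = Set.univ) (hKN : K N = ∅) :
    ∃ 𝓔 : GradedSpectralSequence.{v, max u v w} R,
      (∀ p q : ℕ,
        ∃ e : (𝓔.E.page 2).X (p, q) ≃ₗ[R[X]]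
            cechCohomology U (persistentCohomologyPresheaf R f K hK q) p,
          ∀ i : ℤ, (𝓔.gr 2 le_rfl (p, q) i).map e.toLinearMap.toAddMonoidHom =
            homologyGrading (cechComplex U (persistentCohomologyPresheaf R f K hK q))
              (cechGrading U (persistentCohomologyPresheaf R f K hK q)) p i) ∧
      𝓔.ConvergesTo (fun n => Alpha (persistentCohomology R K hK n))
        (fun n => Alpha.grading (persistentCohomology R K hK n)) :=
  mainTheorem1_general f U hU hcover K hK
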